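/- Let $q,c,d$ be indeterminates over $\mathbb{Q}$. Write $(a;q)_k=\prod_{j=0}^{k-1}(1-aq^j)$, $[m]=(1-q^m)/(1-q)$, let $\Phi_n(q)$ be the $n$-th cyclotomic polynomial, and put $$B(n,q)=\frac{(n^2-1)(1-q)^2}{24}+\sum_{k=1}^{(n-1)/4}\frac{q^{4k-2}}{[4k-2]^2}.$$ For rational functions $A_1,A_2\in\mathbb{Q}(c,d)(q)$ and a polynomial $P\in\mathbb{Q}(c,d)[q]$, write $A_1\equiv A_2\pmod P$ if $A_1-A_2=P\,u/v$ with $u,v\in\mathbb{Q}(c,d)[q]$, $v\neq 0$ and $v$ prime to $P$. Let $n\equiv 1\pmod 4$ be a positive integer and let $M=(n-1)/4$ or $M=n-1$. Then, modulo $[n]\Phi_n(q)^3$, $$\sum_{k=0}^{M}[8k+1]\frac{(q;q^4)_k^4\,(cq;q^4)_k\,(dq;q^4)_k}{(q^4;q^4)_k^4\,(q^4/c;q^4)_k\,(q^4/d;q^4)_k}(cd)^{-k}q^{5k}$$ $$\equiv\frac{(q^2;q^4)_{(n-1)/4}}{(q^4;q^4)_{(n-1)/4}}\,[n]\,q^{(1-n)/4}\left\{1+[n]^2B(n,q)\right\}\sum_{k=0}^{(n-1)/4}\frac{(q^3/(cd);q^4)_k\,(q;q^4)_k^3}{(q^4;q^4)_k\,(q^4/c;q^4)_k\,(q^4/d;q^4)_k\,(q^2;q^4)_k}q^{4k}.$$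 -/

import Mathlib

open Polynomial

/-- The `q`-shifted factorial `(a; q)_k = (1 - a)(1 - a q) ⋯ (1 - a q ^ (k - 1))`. -/
def qShifted {R : Type*} [CommRing R] (a q : R) (k : ℕ) : R :=
  ∏ j ∈ Finset.range k, (1 - a * q ^ j)

/-- The `q`-integer `[n] = (1 - q ^ n) / (1 - q) = 1 + q + ⋯ + q ^ (n - 1)`. -/
def qInt {R : Type*} [CommRing R] (q : R) (n : ℕ) : R :=
  ∑ i ∈ Finset.range n, q ^ i

theorem qInt_eq_div {F : Type*} [Field F] {q : F} (hq : q ≠ 1) (n : ℕ) :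
    qInt q n = (1 - q ^ n) / (1 - q) := by
  have h : (1 - q) ≠ 0 := sub_ne_zero.mpr (Ne.symm hq)
  rw [eq_div_iff h]
  exact geom_sum_mul_neg q n

/-- `B(n, q) = (n² - 1)(1 - q)² / 24 + ∑_{k = 1}^{(n - 1) / 4} q ^ (4k - 2) / [4k - 2]²`. -/
def qB {F : Type*} [Field F] (n : ℕ) (q : F) : F :=
  ((n : F) ^ 2 - 1) * (1 - q) ^ 2 / 24 +
    ∑ k ∈ Finset.Icc 1 ((n - 1) / 4), q ^ (4 * k - 2) / qInt q (4 * k - 2) ^ 2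

/-- Congruence of two rational functions of `q` (over a field `K`) modulo a polynomial `P`:
the difference `A - B` equals `P * u / v` with `u, v` polynomials, `v` nonzero and prime to `P`. -/
def RatCongr {K : Type*} [Field K] (P : K[X]) (A B : RatFunc K) : Prop :=
  ∃ u v : K[X], v ≠ 0 ∧ IsCoprime v P ∧
    A - B = algebraMap K[X] (RatFunc K) (P * u) / algebraMap K[X] (RatFunc K) v

/-- The field `ℚ(c, d)` of rational functions in two indeterminates `c, d`. -/
abbrev ParamField : Type := FractionRing (MvPolynomial (Fin 2) ℚ)

/-- The indeterminate `c`, as an element of `ℚ(c, d)(q)`. -/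
noncomputable def parC : RatFunc ParamField :=
  RatFunc.C (algebraMap (MvPolynomial (Fin 2) ℚ) ParamField (MvPolynomial.X 0))

/-- The indeterminate `d`, as an element of `ℚ(c, d)(q)`. -/
noncomputable def parD : RatFunc ParamField :=
  RatFunc.C (algebraMap (MvPolynomial (Fin 2) ℚ) ParamField (MvPolynomial.X 1))

/-! The congruence is tested at one prime of `ℚ(c, d)[q]` at a time: by `ratCongr_of_valuation_le`
it is enough to bound the valuation of the difference of the two sides by that of the modulus, at
each prime dividing the modulus. At such a prime `q` reduces to a primitive `m`-th root of unity
with `m > 1` and `m ∣ n`, and the constants `c`, `d` reduce to no power of it. By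
`exists_hasOrderAt_of_modulus` the difference must be divisible by `(1 - q ^ n) ^ 4` if `m = n`, and
only by `1 - q ^ m` otherwise.

Case `m = n = 4K + 1`. Replace the four factors `(q; q⁴)_k` by `(vq; q⁴)_k` and `(uᵢq; q⁴)_k`, `i =
1, 2, 3`, with denominators adjusted so that the series stays very-well-poised, and let each
parameter be `1` or `x = q ^ (-n)`; these values differ by `δ`, which has the valuation of `1 - q ^
n`. Ring operations and inversion of units preserve divisibility of mixed differences, so the fourth
difference of the sum over the cube is divisible by `δ ^ 4`. For `v = x` the sum is zero, the terms
`k` and `K - k` cancelling. For `v = 1` and some `uᵢ = x`, Watson's transformation evaluates it as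
`[n] W(uⱼ, u_l) ∑ φ`, where `j`, `l` are the other two indices. This determines the value at `(1; 1,
1, 1)` modulo `δ ^ 4`; the third difference of a symmetric interpolation `symPrefactor * ∑ φ`
rewrites it as `[n] (3 W(1, 1) - 3 W(x, 1) + W(x, x)) ∑ φ`.

The bracket is expanded to second order in `δ`. Its relative `δ ^ 2` coefficient is a sum of `-z ^ e
/ (1 - z ^ e) ^ 2` over the multiples `e` of 4 below `n`; the evaluation `∑ z ^ e / (1 - z ^ e) ^ 2
= (1 - n ^ 2) / 12` over `0 < e < n` for roots of unity turns it into the sum in `B(n, q)`.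

Case `m < n`. Both sides vanish modulo `1 - q ^ m`: the left side splits into blocks of length `m`,
each vanishing by the same antisymmetry, and on the right the factor `[n]` survives once zeros and
poles are counted. -/

/-! ### Elementary rules for `q`-shifted factorials. -/

section QShifted

variable {R : Type*} [CommRing R] (a q : R)

theorem qShifted_zero : qShifted a q 0 = 1 := by simp [qShifted]

theorem qShifted_succ (k : ℕ) : qShifted a q (k + 1) = qShifted a q k * (1 - a * q ^ k) := by
  simp [qShifted, Finset.prod_range_succ]

theorem qShifted_add (m k : ℕ) :
    qShifted a q (m + k) = qShifted a q m * qShifted (a * q ^ m) q k := by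
  simp [qShifted, Finset.prod_range_add, pow_add, mul_assoc]

theorem qShifted_succ_left (k : ℕ) :
    qShifted a q (k + 1) = (1 - a) * qShifted (a * q) q k := by
  rw [add_comm, qShifted_add]; simp [qShifted]

theorem qShifted_ne_zero_of_le {F : Type*} [Field F] {a q : F} {m k : ℕ} (h : m ≤ k)
    (hk : qShifted a q k ≠ 0) : qShifted a q m ≠ 0 := by
  obtain ⟨r, rfl⟩ := Nat.exists_eq_add_of_le h
  rw [qShifted_add] at hk
  exact left_ne_zero_of_mul hk

theorem qShifted_shift_ne_zero {F : Type*} [Field F] {a q : F} {m k N : ℕ} (h : m + k ≤ N)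
    (hk : qShifted a q N ≠ 0) : qShifted (a * q ^ m) q k ≠ 0 := by
  have := qShifted_ne_zero_of_le h hk
  rw [qShifted_add] at this
  exact right_ne_zero_of_mul this

end QShifted

/-! ### Saalschütz summation, Bailey's lemma and Watson's transformation. -/

section Summation

variable {F : Type*} [Field F]

/-- The summand of the `q`-Pfaff–Saalschütz sum, in a form without parameters in denominators. -/
def saalTerm (q D E g : F) (r s : ℕ) : F :=
  qShifted D q r * qShifted E q r * qShifted g q s * g ^ r * qShifted (D * E * g * q ^ r) q s /
    (qShifted q q r * qShifted q q s)

/-- Creative telescoping: the coefficients are those of the first-order recurrence in `N` for the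
closed form in `sum_saalTerm`, and the right-hand side is the certificate. Carrying `s` with `r + s
= N` avoids truncated subtraction in the induction. -/
theorem sum_saalTerm_diff {q : F} (D E g : F) {N : ℕ} (hq : qShifted q q (N + 1) ≠ 0) (r s : ℕ)
    (h : r + s = N) :
    ∑ i ∈ Finset.range (r + 1), ((1 - q ^ (N + 1)) * saalTerm q D E g i (N + 1 - i) -
      (1 - E * g * q ^ N) * (1 - D * g * q ^ N) * saalTerm q D E g i (N - i)) =
    - (q ^ s * g * (1 - D * q ^ r) * (1 - E * q ^ r)) * saalTerm q D E g r s := by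
  induction r generalizing s with
  | zero =>
    obtain rfl : s = N := by omega
    have h1 := qShifted_ne_zero_of_le (Nat.le_succ s) hq
    have h2 : (1 - q * q ^ s) ≠ 0 := by
      rw [qShifted_succ] at hq; exact right_ne_zero_of_mul hq
    simp only [zero_add, Finset.range_one, Finset.sum_singleton, saalTerm, qShifted_zero,
      Nat.sub_zero, pow_zero, mul_one, one_mul, qShifted_succ _ _ s, pow_succ']
    generalize q ^ s = S at *
    field_simp
    ring
  | succ r ih =>
    rw [Finset.sum_range_succ, ih (s + 1) (by omega)]
    have e1 : N + 1 - (r + 1) = s + 1 := by omega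
    have e2 : N - (r + 1) = s := by omega
    have e3 : N + 1 = (s + 1) + (r + 1) := by omega
    have e4 : N = s + (r + 1) := by omega
    have hr := qShifted_ne_zero_of_le (show r + 1 ≤ N + 1 by omega) hq
    have hs := qShifted_ne_zero_of_le (show s + 1 ≤ N + 1 by omega) hq
    rw [qShifted_succ] at hr hs
    have hr1 := left_ne_zero_of_mul hr
    have hr2 := right_ne_zero_of_mul hr
    have hs1 := left_ne_zero_of_mul hs
    have hs2 := right_ne_zero_of_mul hs
    rw [e1, e2, e3, e4]
    simp only [saalTerm, qShifted_succ _ _ r, qShifted_succ g _ s, qShifted_succ q _ s]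
    rw [qShifted_succ_left (D * E * g * q ^ r) q s, qShifted_succ (D * E * g * q ^ (r + 1)) q s,
      show D * E * g * q ^ r * q = D * E * g * q ^ (r + 1) by ring]
    generalize qShifted (D * E * g * q ^ (r + 1)) q s = Y
    simp only [pow_add, pow_one]
    generalize q ^ s = S at *
    generalize q ^ r = T at *
    have hs3 : 1 - S * q ≠ 0 := by rwa [mul_comm]
    have hr3 : 1 - T * q ≠ 0 := by rwa [mul_comm]
    field_simp
    ring

/-- The `q`-Pfaff–Saalschütz summation. -/
theorem sum_saalTerm {q : F} (D E g : F) (N : ℕ) (hq : qShifted q q N ≠ 0) :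
    ∑ i ∈ Finset.range (N + 1), saalTerm q D E g i (N - i) =
      qShifted (E * g) q N * qShifted (D * g) q N / qShifted q q N := by
  induction N with
  | zero => simp [saalTerm, qShifted]
  | succ N ih =>
    have h1 := qShifted_ne_zero_of_le (Nat.le_succ N) hq
    have h2 : (1 - q * q ^ N) ≠ 0 := by
      rw [qShifted_succ] at hq; exact right_ne_zero_of_mul hq
    have h3 := sum_saalTerm_diff D E g hq N 0 (by omega)
    rw [Finset.sum_sub_distrib, ← Finset.mul_sum, ← Finset.mul_sum, ih h1] at h3
    -- The term `i = N + 1`, outside the telescoped range, cancels the boundary term of `h3`, so the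
    -- full sums satisfy the recurrence exactly.
    have h4 : (1 - q ^ (N + 1)) * saalTerm q D E g (N + 1) (N + 1 - (N + 1)) =
        g * (1 - D * q ^ N) * (1 - E * q ^ N) * saalTerm q D E g N 0 := by
      simp only [saalTerm, qShifted_succ _ _ N, Nat.sub_self, qShifted_zero, pow_succ']
      generalize q ^ N = S at *
      field_simp
    have h5 : (1 - q ^ (N + 1)) * ∑ i ∈ Finset.range (N + 1 + 1),
        saalTerm q D E g i (N + 1 - i) = (1 - E * g * q ^ N) * (1 - D * g * q ^ N) *
          (qShifted (E * g) q N * qShifted (D * g) q N / qShifted q q N) := by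
      rw [Finset.sum_range_succ, mul_add, h4]
      linear_combination h3
    have h6 : 1 - q ^ (N + 1) ≠ 0 := by rwa [pow_succ']
    apply mul_left_cancel₀ h6
    rw [h5]
    simp only [qShifted_succ _ _ N, pow_succ']
    generalize hU : 1 - q * q ^ N = U at *
    field_simp

/-- Bailey's lemma, with `g = a q / (d e)`. -/
theorem bailey_lemma {q a d e g : F} {N : ℕ} (hg : a * q = g * d * e) (α β : ℕ → F)
    (hq : qShifted q q N ≠ 0) (ha : qShifted (a * q) q (N + N) ≠ 0)
    (hd : qShifted (g * d) q N ≠ 0) (he : qShifted (g * e) q N ≠ 0)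
    (hβ : ∀ j ≤ N, β j = ∑ k ∈ Finset.range (j + 1),
      α k / (qShifted q q (j - k) * qShifted (a * q) q (j + k))) :
    ∑ k ∈ Finset.range (N + 1), qShifted d q k * qShifted e q k * g ^ k /
        (qShifted (g * e) q k * qShifted (g * d) q k) * α k /
          (qShifted q q (N - k) * qShifted (a * q) q (N + k)) =
      (∑ j ∈ Finset.range (N + 1), qShifted d q j * qShifted e q j * qShifted g q (N - j) *
        g ^ j / qShifted q q (N - j) * β j) / (qShifted (g * e) q N * qShifted (g * d) q N) := by
  -- Interchange of the two summations, with `j = k + i`.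
  have h1 : ∑ j ∈ Finset.range (N + 1), qShifted d q j * qShifted e q j * qShifted g q (N - j) *
        g ^ j / qShifted q q (N - j) * β j =
      ∑ k ∈ Finset.range (N + 1), ∑ i ∈ Finset.range (N - k + 1),
        qShifted d q (k + i) * qShifted e q (k + i) * qShifted g q (N - k - i) *
        g ^ (k + i) / qShifted q q (N - k - i) *
          (α k / (qShifted q q i * qShifted (a * q) q (k + k + i))) := by
    rw [Finset.sum_congr rfl (fun j hj => by
      rw [hβ j (Nat.lt_succ_iff.mp (Finset.mem_range.mp hj)), Finset.mul_sum])]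
    rw [Finset.sum_sigma', Finset.sum_sigma']
    refine Finset.sum_bij' (fun x _ => ⟨x.2, x.1 - x.2⟩) (fun x _ => ⟨x.1 + x.2, x.1⟩)
      ?_ ?_ ?_ ?_ ?_
    · rintro ⟨j, k⟩ h; simp only [Finset.mem_sigma, Finset.mem_range] at h ⊢; omega
    · rintro ⟨j, k⟩ h; simp only [Finset.mem_sigma, Finset.mem_range] at h ⊢; omega
    · rintro ⟨j, k⟩ h; simp only [Finset.mem_sigma, Finset.mem_range] at h
      simp only [Sigma.mk.injEq, heq_eq_eq, and_true]; omega
    · rintro ⟨j, k⟩ h; simp only [Finset.mem_sigma, Finset.mem_range] at h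
      simp
    · rintro ⟨j, k⟩ h; simp only [Finset.mem_sigma, Finset.mem_range] at h
      simp only
      rw [show k + (j - k) = j by omega, show N - k - (j - k) = N - j by omega,
        show k + k + (j - k) = j + k by omega]
  rw [h1, Finset.sum_div]
  refine Finset.sum_congr rfl fun k hk => ?_
  have hk' : k ≤ N := Nat.lt_succ_iff.mp (Finset.mem_range.mp hk)
  obtain ⟨s, rfl⟩ := Nat.exists_eq_add_of_le hk'
  rw [Nat.add_sub_cancel_left]
  have hs : qShifted q q s ≠ 0 := qShifted_ne_zero_of_le (by omega) hq
  have hC : qShifted (a * q) q (k + k) ≠ 0 := qShifted_ne_zero_of_le (by omega) ha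
  have hC' : qShifted (a * q * q ^ (k + k)) q s ≠ 0 :=
    qShifted_shift_ne_zero (by omega) ha
  have h2 := sum_saalTerm (d * q ^ k) (e * q ^ k) g s hs
  -- The inner sum is a Saalschütz sum with `D = d q ^ k` and `E = e q ^ k`; the relation `a q = g d
  -- e` makes `D E g` equal to `a q ^ (2k + 1)`.
  have h3 : ∀ i ∈ Finset.range (s + 1),
      qShifted d q (k + i) * qShifted e q (k + i) * qShifted g q (s - i) *
        g ^ (k + i) / qShifted q q (s - i) *
          (α k / (qShifted q q i * qShifted (a * q) q (k + k + i))) =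
      qShifted d q k * qShifted e q k * g ^ k * α k /
        (qShifted (a * q) q (k + k) * qShifted (a * q * q ^ (k + k)) q s) *
        saalTerm q (d * q ^ k) (e * q ^ k) g i (s - i) := by
    intro i hi
    obtain ⟨t, rfl⟩ := Nat.exists_eq_add_of_le (Nat.lt_succ_iff.mp (Finset.mem_range.mp hi))
    rw [Nat.add_sub_cancel_left]
    rw [qShifted_add] at hC'
    have h4 := left_ne_zero_of_mul hC'
    have h5 := right_ne_zero_of_mul hC'
    have h6 : d * q ^ k * (e * q ^ k) * g * q ^ i = a * q * q ^ (k + k) * q ^ i := by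
      rw [hg]; ring
    have h7 := qShifted_ne_zero_of_le (show i ≤ i + t by omega) hs
    have h8 := qShifted_ne_zero_of_le (show t ≤ i + t by omega) hs
    rw [saalTerm, h6, qShifted_add d, qShifted_add e, qShifted_add (a * q) q (k + k) i,
      qShifted_add _ _ i t, pow_add g]
    field_simp
  rw [Finset.sum_congr rfl h3, ← Finset.mul_sum, h2]
  rw [show k + s + k = k + k + s by omega, qShifted_add (a * q) q (k + k) s]
  rw [qShifted_add] at hd he
  have hd1 := left_ne_zero_of_mul hd
  have hd2 := right_ne_zero_of_mul hd
  have he1 := left_ne_zero_of_mul he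
  have he2 := right_ne_zero_of_mul he
  rw [qShifted_add (g * e), qShifted_add (g * d),
    show e * q ^ k * g = g * e * q ^ k by ring, show d * q ^ k * g = g * d * q ^ k by ring]
  field_simp

/-- The `α`-sequence of the unit Bailey pair. -/
def unitBailey (q a : F) (k : ℕ) : F :=
  (1 - a * q ^ (2 * k)) / (1 - a) * qShifted a q k / qShifted q q k *
    ∏ j ∈ Finset.range k, (-q ^ j)

/-- The sum is indefinitely summable, so induction on the number of terms suffices; `s` stands for
`j - 1 - r`. -/
theorem sum_unitBailey_partial {q a : F} (ha1 : 1 - a ≠ 0) {j r s : ℕ} (hj : r + s + 1 = j)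
    (hq : qShifted q q j ≠ 0) (ha : qShifted (a * q) q (j + j) ≠ 0) :
    ∑ k ∈ Finset.range (r + 1),
      unitBailey q a k / (qShifted q q (j - k) * qShifted (a * q) q (j + k)) =
    (∏ i ∈ Finset.range r, (-q ^ i)) * q ^ r * qShifted (a * q) q r /
      ((1 - q ^ j) * qShifted q q r * qShifted q q s * qShifted (a * q) q (j + r)) := by
  induction r generalizing s with
  | zero =>
    obtain rfl : s + 1 = j := by omega
    rw [qShifted_succ] at hq
    have h1 := left_ne_zero_of_mul hq
    have h2 := right_ne_zero_of_mul hq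
    have h3 := qShifted_ne_zero_of_le (show s + 1 ≤ s + 1 + (s + 1) by omega) ha
    rw [← pow_succ'] at h2
    simp [unitBailey, qShifted_zero, qShifted_succ q q s, ← pow_succ']
    field_simp
  | succ r ih =>
    rw [Finset.sum_range_succ, ih (s := s + 1) (by omega)]
    have hs := qShifted_ne_zero_of_le (show s + 1 ≤ j by omega) hq
    have hr := qShifted_ne_zero_of_le (show r + 1 ≤ j by omega) hq
    have hjr := qShifted_ne_zero_of_le (show j + r + 1 ≤ j + j by omega) ha
    have hj0 : 1 - q ^ j ≠ 0 := by
      obtain rfl : j = (r + s + 1) + 1 := by omega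
      rw [qShifted_succ] at hq; rw [pow_succ']; exact right_ne_zero_of_mul hq
    rw [show j + (r + 1) = j + r + 1 by omega, show j - (r + 1) = s + 1 by omega]
    rw [qShifted_succ] at hs hr hjr
    have hs1 := left_ne_zero_of_mul hs
    have hs2 := right_ne_zero_of_mul hs
    have hr1 := left_ne_zero_of_mul hr
    have hr2 := right_ne_zero_of_mul hr
    have hjr1 := left_ne_zero_of_mul hjr
    have hjr2 := right_ne_zero_of_mul hjr
    rw [unitBailey, qShifted_succ_left a q r]
    simp only [qShifted_succ q q r, qShifted_succ q q s, qShifted_succ (a * q) q (j + r),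
      qShifted_succ (a * q) q r, Finset.prod_range_succ]
    obtain rfl : j = r + s + 2 := by omega
    generalize qShifted (a * q) q (r + s + 2 + r) = Y at *
    rw [show r + s + 2 + r = 2 * r + s + 2 by ring] at *
    simp only [pow_add, pow_mul', pow_one] at *
    generalize q ^ s = S at *
    generalize q ^ r = T at *
    generalize hU1 : 1 - q * S = U1 at *
    generalize hU2 : 1 - q * T = U2 at *
    generalize hU3 : 1 - T * S * q ^ 2 = U3 at *
    generalize hU4 : 1 - a * q * (T ^ 2 * S * q ^ 2) = U4 at *
    field_simp
    subst hU1 hU2 hU3 hU4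
    ring

/-- For `j > 0` the last summand is the negative of the partial sum up to `j - 1`. Hence the unit
sequence `1, 0, 0, …` is the `β` belonging to `unitBailey`. -/
theorem sum_unitBailey {q a : F} (ha1 : 1 - a ≠ 0) (j : ℕ)
    (hq : qShifted q q j ≠ 0) (ha : qShifted (a * q) q (j + j) ≠ 0) :
    ∑ k ∈ Finset.range (j + 1),
      unitBailey q a k / (qShifted q q (j - k) * qShifted (a * q) q (j + k)) =
    if j = 0 then 1 else 0 := by
  rcases j with _ | j
  · simp [unitBailey, qShifted_zero, div_self ha1]
  · rw [Finset.sum_range_succ, sum_unitBailey_partial (s := 0) ha1 (by omega) hq ha]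
    have hjr := qShifted_ne_zero_of_le (show j + 1 + j + 1 ≤ j + 1 + (j + 1) by omega) ha
    rw [qShifted_succ] at hq hjr
    have hs1 := left_ne_zero_of_mul hq
    have hs2 := right_ne_zero_of_mul hq
    have hjr1 := left_ne_zero_of_mul hjr
    have hjr2 := right_ne_zero_of_mul hjr
    have hs3 : 1 - q ^ (j + 1) ≠ 0 := by rwa [pow_succ']
    rw [unitBailey, qShifted_succ_left a q j, show j + 1 + (j + 1) = j + 1 + j + 1 by omega]
    simp only [qShifted_succ q q j, qShifted_succ (a * q) q (j + 1 + j), Nat.sub_self,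
      qShifted_zero, Finset.prod_range_succ, Nat.succ_ne_zero, if_false]
    generalize qShifted (a * q) q (j + 1 + j) = Y at *
    rw [show j + 1 + j = 2 * j + 1 by ring] at *
    simp only [pow_add, mul_add, pow_mul', pow_one, mul_one] at *
    generalize q ^ j = T at *
    generalize hU2 : 1 - q * T = U2 at *
    generalize hU3 : 1 - T * q = U3 at *
    generalize hU4 : 1 - a * q * (T ^ 2 * q) = U4 at *
    field_simp
    subst hU2 hU3 hU4
    ring

/-- Watson's transformation, in the form in which Bailey's lemma gives it. -/
theorem watson_bailey {q a b c d e g h : F} {N : ℕ} (ha1 : 1 - a ≠ 0)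
    (hg : a * q = g * d * e) (hh : a * q = h * b * c)
    (hq : qShifted q q N ≠ 0) (ha : qShifted (a * q) q (N + N) ≠ 0)
    (hb : qShifted (h * b) q N ≠ 0) (hc : qShifted (h * c) q N ≠ 0)
    (hd : qShifted (g * d) q N ≠ 0) (he : qShifted (g * e) q N ≠ 0) :
    ∑ k ∈ Finset.range (N + 1), qShifted d q k * qShifted e q k * g ^ k /
        (qShifted (g * e) q k * qShifted (g * d) q k) *
        (qShifted b q k * qShifted c q k * h ^ k /
          (qShifted (h * c) q k * qShifted (h * b) q k) * unitBailey q a k) /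
          (qShifted q q (N - k) * qShifted (a * q) q (N + k)) =
      (∑ j ∈ Finset.range (N + 1), qShifted d q j * qShifted e q j * qShifted g q (N - j) *
        g ^ j / qShifted q q (N - j) *
          (qShifted h q j / (qShifted q q j * (qShifted (h * c) q j * qShifted (h * b) q j)))) /
        (qShifted (g * e) q N * qShifted (g * d) q N) := by
  -- Bailey's lemma is used twice. Applied with `b`, `c` to the unit pair it gives a `β` with a
  -- single term, since the unit `β` vanishes beyond index 0; applied to that new pair with `d`, `e`
  -- it gives the claim.
  refine bailey_lemma hg _ _ hq ha hd he fun j hj => ?_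
  have := bailey_lemma (N := j) hh (unitBailey q a) (fun i => if i = 0 then 1 else 0)
    (qShifted_ne_zero_of_le hj hq) (qShifted_ne_zero_of_le (by omega) ha)
    (qShifted_ne_zero_of_le hj hb) (qShifted_ne_zero_of_le hj hc)
    (fun i hi => (sum_unitBailey ha1 i (qShifted_ne_zero_of_le (by omega) hq)
      (qShifted_ne_zero_of_le (by omega) ha)).symm)
  rw [this]
  rw [Finset.sum_range_succ']
  simp [qShifted_zero]
  rw [div_div]

/-- With `Z = q ^ (1 - N) / X`, each factor `1 - Z q ^ j` is `-Z q ^ j` times the factor `1 - X q ^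
(N - 1 - j)` of the other product. This trades factorials of length `N - j` for factorials of length
`j`. -/
theorem qShifted_reverse {q X Z : F} {N : ℕ} (hZ : Z * X * q ^ N = q) (j : ℕ) (hj : j ≤ N)
    (hq : q ≠ 0) :
    qShifted X q (N - j) * qShifted Z q j =
      qShifted X q N * (∏ i ∈ Finset.range j, (-q ^ i)) * Z ^ j := by
  induction j with
  | zero => simp [qShifted_zero]
  | succ j ih =>
    have ih := ih (by omega)
    obtain ⟨s, rfl⟩ := Nat.exists_eq_add_of_le hj
    rw [show j + 1 + s - j = s + 1 by omega, qShifted_succ] at ih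
    rw [show j + 1 + s - (j + 1) = s by omega, qShifted_succ, Finset.prod_range_succ, pow_succ]
    have h1 : 1 - Z * q ^ j = -(Z * q ^ j) * (1 - X * q ^ s) := by
      have : Z * X * q ^ (j + s) = 1 := by
        apply mul_right_cancel₀ hq
        linear_combination hZ
      linear_combination -this
    rw [h1]
    linear_combination (-(Z * q ^ j)) * ih

/-- Watson's transformation of a terminating very-well-poised `₈φ₇` series into a balanced `₄φ₃`,
with `f = q ^ (-N)`, `g = a q / (d e)`, `h = a q / (b c)` and `z = d e q ^ (-N) / a`. -/
theorem watson {q a b c d e f g h z : F} {N : ℕ} (ha1 : 1 - a ≠ 0) (hq0 : q ≠ 0)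
    (hf : f * q ^ N = 1) (hz : z * g * q ^ N = q)
    (hg : a * q = g * d * e) (hh : a * q = h * b * c)
    (hq : qShifted q q N ≠ 0) (ha : qShifted (a * q) q (N + N) ≠ 0)
    (hb : qShifted (h * b) q N ≠ 0) (hc : qShifted (h * c) q N ≠ 0)
    (hd : qShifted (g * d) q N ≠ 0) (he : qShifted (g * e) q N ≠ 0)
    (hzn : qShifted z q N ≠ 0) :
    ∑ k ∈ Finset.range (N + 1), (1 - a * q ^ (2 * k)) / (1 - a) *
        (qShifted a q k * qShifted b q k * qShifted c q k * qShifted d q k * qShifted e q k *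
          qShifted f q k) /
        (qShifted q q k * qShifted (h * c) q k * qShifted (h * b) q k * qShifted (g * e) q k *
          qShifted (g * d) q k * qShifted (a * q * q ^ N) q k) * (g * h * q ^ N) ^ k =
      qShifted (a * q) q N * qShifted g q N / (qShifted (g * e) q N * qShifted (g * d) q N) *
      ∑ j ∈ Finset.range (N + 1), qShifted h q j * qShifted d q j * qShifted e q j *
        qShifted f q j / (qShifted q q j * qShifted (h * c) q j * qShifted (h * b) q j *
          qShifted z q j) * q ^ j := by
  have key := watson_bailey ha1 hg hh hq ha hb hc hd he
  have haN := qShifted_ne_zero_of_le (show N ≤ N + N by omega) ha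
  -- Reversal turns `1 / (q; q)_{N - k}` into a multiple of `(q ^ (-N); q)_k`, and `(a q; q)_{N +
  -- k}` splits off `(a q; q)_N`.
  have hL : ∀ k ∈ Finset.range (N + 1), (1 - a * q ^ (2 * k)) / (1 - a) *
        (qShifted a q k * qShifted b q k * qShifted c q k * qShifted d q k * qShifted e q k *
          qShifted f q k) /
        (qShifted q q k * qShifted (h * c) q k * qShifted (h * b) q k * qShifted (g * e) q k *
          qShifted (g * d) q k * qShifted (a * q * q ^ N) q k) * (g * h * q ^ N) ^ k =
      (qShifted (a * q) q N * qShifted q q N) * (qShifted d q k * qShifted e q k * g ^ k /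
        (qShifted (g * e) q k * qShifted (g * d) q k) *
        (qShifted b q k * qShifted c q k * h ^ k /
          (qShifted (h * c) q k * qShifted (h * b) q k) * unitBailey q a k) /
          (qShifted q q (N - k) * qShifted (a * q) q (N + k))) := by
    intro k hk
    have hk : k ≤ N := Nat.lt_succ_iff.mp (Finset.mem_range.mp hk)
    have hr := qShifted_reverse (q := q) (X := q) (Z := f) (N := N)
      (by linear_combination q * hf) k hk hq0
    have n1 := qShifted_ne_zero_of_le (show N - k ≤ N by omega) hq
    have n2 := qShifted_ne_zero_of_le hk hq
    have n3 := qShifted_ne_zero_of_le hk hb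
    have n4 := qShifted_ne_zero_of_le hk hc
    have n5 := qShifted_ne_zero_of_le hk hd
    have n6 := qShifted_ne_zero_of_le hk he
    have n7 : qShifted (a * q * q ^ N) q k ≠ 0 := qShifted_shift_ne_zero (by omega) ha
    have hfk : qShifted f q k = qShifted q q N * (∏ i ∈ Finset.range k, (-q ^ i)) * f ^ k /
        qShifted q q (N - k) := by
      rw [eq_div_iff n1, ← hr, mul_comm]
    have hfq : f ^ k * (q ^ N) ^ k = 1 := by rw [← mul_pow, hf, one_pow]
    rw [hfk, unitBailey, qShifted_add (a * q) q N k]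
    rw [mul_pow, mul_pow]
    generalize q ^ N = X at *
    field_simp
    linear_combination (qShifted a q k * qShifted b q k * qShifted c q k * qShifted d q k *
      qShifted e q k * (1 - a * q ^ (2 * k)) * (∏ i ∈ Finset.range k, (-q ^ i)) * g ^ k * h ^ k) * hfq
  rw [Finset.sum_congr rfl hL, ← Finset.mul_sum, key, mul_div_assoc', Finset.mul_sum,
    Finset.sum_div, Finset.mul_sum]
  -- On this side reversal is also applied to `(g; q)_{N - j}`, which puts `(z; q)_j` into the
  -- denominator.
  refine Finset.sum_congr rfl fun j hj => ?_
  have hj : j ≤ N := Nat.lt_succ_iff.mp (Finset.mem_range.mp hj)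
  have hr := qShifted_reverse (q := q) (X := q) (Z := f) (N := N)
    (by linear_combination q * hf) j hj hq0
  have hr2 := qShifted_reverse (q := q) (X := g) (Z := z) (N := N) hz j hj hq0
  have n1 := qShifted_ne_zero_of_le (show N - j ≤ N by omega) hq
  have n2 := qShifted_ne_zero_of_le hj hq
  have n3 := qShifted_ne_zero_of_le hj hb
  have n4 := qShifted_ne_zero_of_le hj hc
  have n5 := qShifted_ne_zero_of_le hj hzn
  have hfk : qShifted f q j = qShifted q q N * (∏ i ∈ Finset.range j, (-q ^ i)) * f ^ j /
      qShifted q q (N - j) := by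
    rw [eq_div_iff n1, ← hr, mul_comm]
  have hgk : qShifted g q (N - j) = qShifted g q N * (∏ i ∈ Finset.range j, (-q ^ i)) * z ^ j /
      qShifted z q j := by
    rw [eq_div_iff n5, ← hr2]
  have hfq : g ^ j * z ^ j = q ^ j * f ^ j := by
    rw [← mul_pow, ← mul_pow]
    congr 1
    have : q ^ N ≠ 0 := pow_ne_zero _ hq0
    apply mul_right_cancel₀ this
    linear_combination hz - q * hf
  rw [hfk, hgk]
  field_simp
  linear_combination (qShifted d q j * qShifted e q j * qShifted g q N *
    (∏ i ∈ Finset.range j, (-q ^ i)) * qShifted h q j) * hfq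

end Summation

/-! ### Antisymmetry of a terminating very-well-poised series. -/

section Antisymmetry

variable {F : Type*} [Field F]

theorem prod_neg_pow_sq (q : F) (k : ℕ) :
    (∏ i ∈ Finset.range k, (-q ^ i)) ^ 2 * q ^ k = q ^ (k * k) := by
  induction k with
  | zero => simp
  | succ k ih =>
    rw [Finset.prod_range_succ]
    linear_combination q ^ (2 * k + 1) * ih

/-- Since the condition is symmetric in `X` and `Z`, reversal applies to numerator and denominator
alike and the sign products cancel. A well-poised series with `a = q ^ (-N)` consists of such
ratios. -/
theorem qShifted_ratio_reflect {q X Z : F} {N k : ℕ} (hZ : Z * X * q ^ N = q) (hk : k ≤ N)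
    (hq : q ≠ 0) (hX0 : X ≠ 0) (hZ0 : Z ≠ 0) (hn : qShifted Z q N ≠ 0) :
    qShifted X q (N - k) / qShifted Z q (N - k) =
      (Z / X) ^ k / ((∏ i ∈ Finset.range N, (-q ^ i)) * Z ^ N) *
        (qShifted X q k / qShifted Z q k) := by
  have hZ' : X * Z * q ^ N = q := by rw [mul_comm X Z, hZ]
  have h1 := qShifted_reverse hZ k hk hq
  have h2 := qShifted_reverse hZ' k hk hq
  have h3 := qShifted_reverse hZ N le_rfl hq
  rw [Nat.sub_self, qShifted_zero, one_mul] at h3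
  have n1 := qShifted_ne_zero_of_le hk hn
  have n2 := qShifted_ne_zero_of_le (Nat.sub_le N k) hn
  have hp : ∀ j, (∏ i ∈ Finset.range j, (-q ^ i)) ≠ 0 := fun j =>
    Finset.prod_ne_zero_iff.mpr fun i _ => neg_ne_zero.mpr (pow_ne_zero _ hq)
  have n3 := hp N
  have n4 := hp k
  rw [div_pow]
  generalize (∏ i ∈ Finset.range N, (-q ^ i)) = p at *
  generalize (∏ i ∈ Finset.range k, (-q ^ i)) = r at *
  have hXk := pow_ne_zero k hX0
  have hZN := pow_ne_zero N hZ0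
  field_simp
  apply mul_right_cancel₀ (mul_ne_zero n4 (mul_ne_zero hn hXk))
  calc _ = (qShifted X q (N - k) * qShifted Z q k) * p * Z ^ N * r * qShifted Z q N * X ^ k * X ^ k := by
          ring
    _ = (qShifted X q N * r * Z ^ k) * p * Z ^ N * r * qShifted Z q N * X ^ k * X ^ k := by rw [h1]
    _ = (qShifted X q N * p * Z ^ N) * (qShifted Z q N * r * X ^ k) * Z ^ k * r * X ^ k := by ring
    _ = qShifted Z q N * (qShifted Z q (N - k) * qShifted X q k) * Z ^ k * r * X ^ k := by
          rw [← h2, ← h3]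
    _ = _ := by ring

/-- The summand of a very-well-poised series with parameter `a = v q`, base `q ^ 4`, and further
parameters `c q, d q, u₁ q, u₂ q, u₃ q`, normalised by `1 - q`. -/
def wpTerm {A : Type*} [CommRing A] [Inv A] (q v c d u₁ u₂ u₃ : A) (k : ℕ) : A :=
  (1 - v * q * (q ^ 4) ^ (2 * k)) * (1 - q)⁻¹ *
    (qShifted (v * q) (q ^ 4) k * qShifted (c * q) (q ^ 4) k * qShifted (d * q) (q ^ 4) k *
      qShifted (u₁ * q) (q ^ 4) k * qShifted (u₂ * q) (q ^ 4) k * qShifted (u₃ * q) (q ^ 4) k) *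
    (qShifted (q ^ 4) (q ^ 4) k * qShifted (v * q ^ 4 * c⁻¹) (q ^ 4) k *
      qShifted (v * q ^ 4 * d⁻¹) (q ^ 4) k * qShifted (v * q ^ 4 * u₁⁻¹) (q ^ 4) k *
      qShifted (v * q ^ 4 * u₂⁻¹) (q ^ 4) k * qShifted (v * q ^ 4 * u₃⁻¹) (q ^ 4) k)⁻¹ *
    (v ^ 2 * q ^ 5 * (c * d * u₁ * u₂ * u₃)⁻¹) ^ k

/-- Under `k ↦ N - k` each of the six ratios reproduces itself up to a monomial. The monomials
combine with the power of the argument, and the very-well-poised factor `1 - v q ^ (8k + 1)`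
supplies the sign. -/
theorem wpTerm_reflect {q v c d u₁ u₂ u₃ : F} {N k : ℕ} (hN : v * q * (q ^ 4) ^ N = 1)
    (hk : k ≤ N) (hc0 : c ≠ 0) (hd0 : d ≠ 0) (hu1 : u₁ ≠ 0) (hu2 : u₂ ≠ 0) (hu3 : u₃ ≠ 0)
    (n0 : qShifted (q ^ 4) (q ^ 4) N ≠ 0) (nc : qShifted (v * q ^ 4 * c⁻¹) (q ^ 4) N ≠ 0)
    (nd : qShifted (v * q ^ 4 * d⁻¹) (q ^ 4) N ≠ 0)
    (n1 : qShifted (v * q ^ 4 * u₁⁻¹) (q ^ 4) N ≠ 0)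
    (n2 : qShifted (v * q ^ 4 * u₂⁻¹) (q ^ 4) N ≠ 0)
    (n3 : qShifted (v * q ^ 4 * u₃⁻¹) (q ^ 4) N ≠ 0) :
    wpTerm q v c d u₁ u₂ u₃ (N - k) = - wpTerm q v c d u₁ u₂ u₃ k := by
  have hvq : v * q ≠ 0 := left_ne_zero_of_mul (by rw [hN]; exact one_ne_zero)
  have hv : v ≠ 0 := left_ne_zero_of_mul hvq
  have hq : q ≠ 0 := right_ne_zero_of_mul hvq
  have hQ : q ^ 4 ≠ 0 := pow_ne_zero 4 hq
  have hb : ∀ b : F, b ≠ 0 → qShifted (v * q ^ 4 * b⁻¹) (q ^ 4) N ≠ 0 →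
      qShifted (b * q) (q ^ 4) (N - k) / qShifted (v * q ^ 4 * b⁻¹) (q ^ 4) (N - k) =
      ((v * q ^ 4 * b⁻¹) / (b * q)) ^ k /
        ((∏ i ∈ Finset.range N, (-(q ^ 4) ^ i)) * (v * q ^ 4 * b⁻¹) ^ N) *
        (qShifted (b * q) (q ^ 4) k / qShifted (v * q ^ 4 * b⁻¹) (q ^ 4) k) := by
    intro b hb0 hn
    refine qShifted_ratio_reflect ?_ hk hQ (mul_ne_zero hb0 hq)
      (mul_ne_zero (mul_ne_zero hv hQ) (inv_ne_zero hb0)) hn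
    field_simp
    linear_combination hN
  have ha := qShifted_ratio_reflect (q := q ^ 4) (X := v * q) (Z := q ^ 4) (N := N) (k := k)
    (by linear_combination q ^ 4 * hN) hk hQ hvq hQ n0
  have h1 := hb u₁ hu1 n1
  have h2 := hb u₂ hu2 n2
  have h3 := hb u₃ hu3 n3
  have hc := hb c hc0 nc
  have hd := hb d hd0 nd
  have hp2 := prod_neg_pow_sq (q ^ 4) N
  have hp : (∏ i ∈ Finset.range N, (-(q ^ 4) ^ i)) ≠ 0 :=
    Finset.prod_ne_zero_iff.mpr fun i _ => neg_ne_zero.mpr (pow_ne_zero _ hQ)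
  have expand : ∀ j, wpTerm q v c d u₁ u₂ u₃ j = (1 - v * q * (q ^ 4) ^ (2 * j)) * (1 - q)⁻¹ *
      ((qShifted (v * q) (q ^ 4) j / qShifted (q ^ 4) (q ^ 4) j) *
      (qShifted (c * q) (q ^ 4) j / qShifted (v * q ^ 4 * c⁻¹) (q ^ 4) j) *
      (qShifted (d * q) (q ^ 4) j / qShifted (v * q ^ 4 * d⁻¹) (q ^ 4) j) *
      (qShifted (u₁ * q) (q ^ 4) j / qShifted (v * q ^ 4 * u₁⁻¹) (q ^ 4) j) *
      (qShifted (u₂ * q) (q ^ 4) j / qShifted (v * q ^ 4 * u₂⁻¹) (q ^ 4) j) *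
      (qShifted (u₃ * q) (q ^ 4) j / qShifted (v * q ^ 4 * u₃⁻¹) (q ^ 4) j)) *
      (v ^ 2 * q ^ 5 * (c * d * u₁ * u₂ * u₃)⁻¹) ^ j := by
    intro j
    rw [wpTerm, mul_inv, mul_inv, mul_inv, mul_inv, mul_inv]
    simp only [div_eq_mul_inv]
    ring
  rw [expand, expand, ha, hc, hd, h1, h2, h3]
  generalize qShifted (v * q) (q ^ 4) k / qShifted (q ^ 4) (q ^ 4) k = Ra
  generalize qShifted (c * q) (q ^ 4) k / qShifted (v * q ^ 4 * c⁻¹) (q ^ 4) k = Rc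
  generalize qShifted (d * q) (q ^ 4) k / qShifted (v * q ^ 4 * d⁻¹) (q ^ 4) k = Rd
  generalize qShifted (u₁ * q) (q ^ 4) k / qShifted (v * q ^ 4 * u₁⁻¹) (q ^ 4) k = R1
  generalize qShifted (u₂ * q) (q ^ 4) k / qShifted (v * q ^ 4 * u₂⁻¹) (q ^ 4) k = R2
  generalize qShifted (u₃ * q) (q ^ 4) k / qShifted (v * q ^ 4 * u₃⁻¹) (q ^ 4) k = R3
  set p := ∏ i ∈ Finset.range N, (-(q ^ 4) ^ i) with hpdef
  set z := v ^ 2 * q ^ 5 * (c * d * u₁ * u₂ * u₃)⁻¹ with hz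
  have hz0 : z ≠ 0 := by positivity
  have key : (1 - v * q * (q ^ 4) ^ (2 * (N - k))) *
      (((q ^ 4) / (v * q)) ^ k / (p * (q ^ 4) ^ N) *
      (((v * q ^ 4 * c⁻¹) / (c * q)) ^ k / (p * (v * q ^ 4 * c⁻¹) ^ N)) *
      (((v * q ^ 4 * d⁻¹) / (d * q)) ^ k / (p * (v * q ^ 4 * d⁻¹) ^ N)) *
      (((v * q ^ 4 * u₁⁻¹) / (u₁ * q)) ^ k / (p * (v * q ^ 4 * u₁⁻¹) ^ N)) *
      (((v * q ^ 4 * u₂⁻¹) / (u₂ * q)) ^ k / (p * (v * q ^ 4 * u₂⁻¹) ^ N)) *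
      (((v * q ^ 4 * u₃⁻¹) / (u₃ * q)) ^ k / (p * (v * q ^ 4 * u₃⁻¹) ^ N))) * z ^ (N - k) =
      -(1 - v * q * (q ^ 4) ^ (2 * k)) * z ^ k := by
    have e1 : ((q ^ 4) / (v * q)) ^ k / (p * (q ^ 4) ^ N) *
      (((v * q ^ 4 * c⁻¹) / (c * q)) ^ k / (p * (v * q ^ 4 * c⁻¹) ^ N)) *
      (((v * q ^ 4 * d⁻¹) / (d * q)) ^ k / (p * (v * q ^ 4 * d⁻¹) ^ N)) *
      (((v * q ^ 4 * u₁⁻¹) / (u₁ * q)) ^ k / (p * (v * q ^ 4 * u₁⁻¹) ^ N)) *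
      (((v * q ^ 4 * u₂⁻¹) / (u₂ * q)) ^ k / (p * (v * q ^ 4 * u₂⁻¹) ^ N)) *
      (((v * q ^ 4 * u₃⁻¹) / (u₃ * q)) ^ k / (p * (v * q ^ 4 * u₃⁻¹) ^ N)) =
      ((q ^ 4) / (v * q) * ((v * q ^ 4 * c⁻¹) / (c * q)) * ((v * q ^ 4 * d⁻¹) / (d * q)) *
        ((v * q ^ 4 * u₁⁻¹) / (u₁ * q)) * ((v * q ^ 4 * u₂⁻¹) / (u₂ * q)) *
        ((v * q ^ 4 * u₃⁻¹) / (u₃ * q))) ^ k / (p ^ 6 *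
        (q ^ 4 * (v * q ^ 4 * c⁻¹) * (v * q ^ 4 * d⁻¹) * (v * q ^ 4 * u₁⁻¹) *
        (v * q ^ 4 * u₂⁻¹) * (v * q ^ 4 * u₃⁻¹)) ^ N) := by
      simp only [mul_pow _ _ N, div_mul_div_comm]
      congr 1 <;> ring
    have e2 : (q ^ 4) / (v * q) * ((v * q ^ 4 * c⁻¹) / (c * q)) * ((v * q ^ 4 * d⁻¹) / (d * q)) *
        ((v * q ^ 4 * u₁⁻¹) / (u₁ * q)) * ((v * q ^ 4 * u₂⁻¹) / (u₂ * q)) *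
        ((v * q ^ 4 * u₃⁻¹) / (u₃ * q)) = (q ^ 4) ^ 2 * z ^ 2 := by
      rw [hz]; field_simp
    have e3 : q ^ 4 * (v * q ^ 4 * c⁻¹) * (v * q ^ 4 * d⁻¹) * (v * q ^ 4 * u₁⁻¹) *
        (v * q ^ 4 * u₂⁻¹) * (v * q ^ 4 * u₃⁻¹) = (v * q) ^ 3 * (q ^ 4) ^ 4 * z := by
      rw [hz]; field_simp
    -- The six sign products `p` pair up into the cube of `prod_neg_pow_sq`; the resulting `(q ^ 4)
    -- ^ (N * N)` is cancelled by `(v q) ^ N`.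
    have e4 : p ^ 6 * ((v * q) ^ 3 * (q ^ 4) ^ 4 * z) ^ N = (q ^ 4) ^ N * z ^ N := by
      apply mul_right_cancel₀ (pow_ne_zero N (pow_ne_zero 3 hQ))
      have h5 : ((v * q) * (q ^ 4) ^ N) ^ N = 1 := by rw [hN, one_pow]
      have h6 : (v * q) ^ N * (q ^ 4) ^ (N * N) = 1 := by rw [pow_mul, ← mul_pow, h5]
      calc p ^ 6 * ((v * q) ^ 3 * (q ^ 4) ^ 4 * z) ^ N * ((q ^ 4) ^ 3) ^ N =
            (p ^ 2 * (q ^ 4) ^ N) ^ 3 * ((v * q) ^ N) ^ 3 * ((q ^ 4) ^ N) ^ 4 * z ^ N := by ring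
        _ = ((v * q) ^ N * (q ^ 4) ^ (N * N)) ^ 3 * ((q ^ 4) ^ N) ^ 4 * z ^ N := by
            rw [hp2]; ring
        _ = _ := by rw [h6]; ring
    rw [e1, e2, e3, e4]
    obtain ⟨s, rfl⟩ := Nat.exists_eq_add_of_le hk
    rw [Nat.add_sub_cancel_left]
    have hzk := pow_ne_zero (k + s) hz0
    have hQk := pow_ne_zero (k + s) hQ
    rw [mul_div_assoc', div_mul_eq_mul_div, div_eq_iff (mul_ne_zero hQk hzk)]
    have h7 : v * q * (q ^ 4) ^ (2 * s) * (q ^ 4) ^ (2 * k) = (q ^ 4) ^ (k + s) := by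
      linear_combination (q ^ 4) ^ (k + s) * hN
    have h8 : v * q * (q ^ 4) ^ (2 * k) * (q ^ 4) ^ (k + s) = (q ^ 4) ^ (2 * k) := by
      linear_combination (q ^ 4) ^ (2 * k) * hN
    linear_combination (- z ^ (2 * k + s)) * h7 - z ^ (2 * k + s) * h8
  linear_combination ((1 - q)⁻¹ * Ra * Rc * Rd * R1 * R2 * R3) * key

theorem sum_wpTerm_eq_zero [CharZero F] {q v c d u₁ u₂ u₃ : F} {N : ℕ}
    (hN : v * q * (q ^ 4) ^ N = 1)
    (hc0 : c ≠ 0) (hd0 : d ≠ 0) (hu1 : u₁ ≠ 0) (hu2 : u₂ ≠ 0) (hu3 : u₃ ≠ 0)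
    (n0 : qShifted (q ^ 4) (q ^ 4) N ≠ 0) (nc : qShifted (v * q ^ 4 * c⁻¹) (q ^ 4) N ≠ 0)
    (nd : qShifted (v * q ^ 4 * d⁻¹) (q ^ 4) N ≠ 0)
    (n1 : qShifted (v * q ^ 4 * u₁⁻¹) (q ^ 4) N ≠ 0)
    (n2 : qShifted (v * q ^ 4 * u₂⁻¹) (q ^ 4) N ≠ 0)
    (n3 : qShifted (v * q ^ 4 * u₃⁻¹) (q ^ 4) N ≠ 0) :
    ∑ k ∈ Finset.range (N + 1), wpTerm q v c d u₁ u₂ u₃ k = 0 := by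
  have h := Finset.sum_range_reflect (fun k => wpTerm q v c d u₁ u₂ u₃ k) (N + 1)
  have h2 : ∑ k ∈ Finset.range (N + 1), wpTerm q v c d u₁ u₂ u₃ (N + 1 - 1 - k) =
      ∑ k ∈ Finset.range (N + 1), - wpTerm q v c d u₁ u₂ u₃ k :=
    Finset.sum_congr rfl fun k hk => wpTerm_reflect hN
      (Nat.lt_succ_iff.mp (Finset.mem_range.mp hk)) hc0 hd0 hu1 hu2 hu3 n0 nc nd n1 n2 n3
  rw [h2, Finset.sum_neg_distrib] at h
  exact self_eq_neg.mp h.symm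

end Antisymmetry

/-! ### Divisibility of mixed differences over a cube of parameters. -/

section Cube

variable {A : Type*} [CommRing A]

/-- Functions on `Bool` with values in `B` whose two values differ by a multiple of `δ`. -/
def diffSubring {B : Subring A} (δ : B) : Subring (Bool → A) where
  carrier := {g | g true ∈ B ∧ ∃ r ∈ B, g false = g true + δ * r}
  mul_mem' := by
    rintro f g ⟨hf, r, hr, hfr⟩ ⟨hg, s, hs, hgs⟩
    refine ⟨B.mul_mem hf hg, f true * s + r * g true + δ * r * s, ?_, ?_⟩
    · exact B.add_mem (B.add_mem (B.mul_mem hf hs) (B.mul_mem hr hg))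
        (B.mul_mem (B.mul_mem δ.2 hr) hs)
    · simp only [Pi.mul_apply, hfr, hgs]; ring
  one_mem' := ⟨B.one_mem, 0, B.zero_mem, by simp⟩
  add_mem' := by
    rintro f g ⟨hf, r, hr, hfr⟩ ⟨hg, s, hs, hgs⟩
    exact ⟨B.add_mem hf hg, r + s, B.add_mem hr hs, by simp only [Pi.add_apply, hfr, hgs]; ring⟩
  zero_mem' := ⟨B.zero_mem, 0, B.zero_mem, by simp⟩
  neg_mem' := by
    rintro f ⟨hf, r, hr, hfr⟩
    exact ⟨B.neg_mem hf, -r, B.neg_mem hr, by simp only [Pi.neg_apply, hfr]; ring⟩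

theorem const_mem_diffSubring {B : Subring A} (δ : B) {a : A} (ha : a ∈ B) :
    (fun _ => a) ∈ diffSubring δ :=
  ⟨ha, 0, B.zero_mem, by simp⟩

theorem cond_mem_diffSubring {B : Subring A} (δ : B) {a r : A} (ha : a ∈ B) (hr : r ∈ B) :
    (fun b => cond b a (a + δ * r)) ∈ diffSubring δ :=
  ⟨ha, r, hr, rfl⟩

theorem apply_mem_of_mem_diffSubring {B : Subring A} {δ : B} {g : Bool → A}
    (hg : g ∈ diffSubring δ) (b : Bool) : g b ∈ B := by
  obtain ⟨h, r, hr, he⟩ := hg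
  cases b
  · rw [he]; exact B.add_mem h (B.mul_mem δ.2 hr)
  · exact h

/-- Elements of `B` with the property `U` are invertible in `B`. -/
def InvClosed [Inv A] (B : Subring A) (U : A → Prop) : Prop :=
  ∀ a ∈ B, U a → a⁻¹ ∈ B ∧ a * a⁻¹ = 1

/-- This rests on `1 / (x + δ r) - 1 / x = -δ r / (x (x + δ r))`. It extends divisibility of
differences from polynomial to rational expressions, and it can be iterated along the coordinates of
a cube. -/
theorem InvClosed.diffSubring [Inv A] {B : Subring A} {U : A → Prop} (h : InvClosed B U) (δ : B) :
    InvClosed (diffSubring δ) fun g => ∀ b, U (g b) := by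
  intro g hg hU
  have ht := h _ (apply_mem_of_mem_diffSubring hg true) (hU true)
  have hf := h _ (apply_mem_of_mem_diffSubring hg false) (hU false)
  obtain ⟨hgt, r, hr, he⟩ := hg
  refine ⟨⟨ht.1, -(r * (g true)⁻¹ * (g false)⁻¹),
    B.neg_mem (B.mul_mem (B.mul_mem hr ht.1) hf.1), ?_⟩, ?_⟩
  · simp only [Pi.inv_apply]
    linear_combination (g false)⁻¹ * ht.2 * (-1) + (g true)⁻¹ * hf.2 -
      (g true)⁻¹ * (g false)⁻¹ * he
  · funext b
    cases b
    · exact hf.2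
    · exact ht.2

/-- The constant function with value `δ`, as an element of `diffSubring δ`. -/
def constDiff {B : Subring A} (δ : B) : diffSubring δ := ⟨fun _ => δ, const_mem_diffSubring δ δ.2⟩

/-- Functions on the cube `Bool³`, built by iterating `diffSubring`. -/
def diffSubring₃ {B : Subring A} (δ : B) : Subring (Bool → Bool → Bool → A) :=
  diffSubring (constDiff (constDiff δ))

/-- Functions on the cube `Bool⁴`, built by iterating `diffSubring`. -/
def diffSubring₄ {B : Subring A} (δ : B) : Subring (Bool → Bool → Bool → Bool → A) :=
  diffSubring (constDiff (constDiff (constDiff δ)))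

/-- Each coordinate contributes one factor `δ`: the quotient of a difference by `δ` again lies in
the subring of one dimension less. -/
theorem exists_third_difference {B : Subring A} {δ : B} {g : Bool → Bool → Bool → A}
    (hg : g ∈ diffSubring₃ δ) :
    ∃ r ∈ B, g true true true - g false true true - g true false true - g true true false +
      g false false true + g false true false + g true false false - g false false false =
        δ ^ 3 * r := by
  obtain ⟨-, r, hr, he⟩ := hg
  obtain ⟨-, s, hs, hre⟩ := hr
  obtain ⟨-, t, ht, hse⟩ := hs
  refine ⟨-t, B.neg_mem ht, ?_⟩
  have e : ∀ b c, g false b c = g true b c + δ * r b c := fun b c => by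
    have := congrFun (congrFun he b) c
    simpa [constDiff] using this
  have e2 : ∀ c, r false c = r true c + δ * s c := fun c => by
    have := congrFun hre c
    simpa [constDiff] using this
  rw [e, e, e, e, e2, e2, hse]
  ring

/-- As the face `false` is zero, the opposite face is `-δ` times an element of `diffSubring₃ δ`,
whose third difference contributes `δ ^ 3`. -/
theorem exists_fourth_difference {B : Subring A} {δ : B} {g : Bool → Bool → Bool → Bool → A}
    (hg : g ∈ diffSubring₄ δ) (h0 : ∀ a b c, g false a b c = 0) :
    ∃ r ∈ B, g true true true true - g true false true true - g true true false true -
      g true true true false + g true false false true + g true false true false +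
      g true true false false - g true false false false = δ ^ 4 * r := by
  obtain ⟨-, r, hr, he⟩ := hg
  obtain ⟨t, ht, hr⟩ := exists_third_difference hr
  refine ⟨-t, B.neg_mem ht, ?_⟩
  have e : ∀ a b c, g true a b c = - (δ * r a b c) := fun a b c => by
    have := congrFun (congrFun (congrFun he a) b) c
    simp only [h0, Pi.add_apply, Pi.mul_apply, constDiff] at this
    linear_combination -this
  rw [e, e, e, e, e, e, e, e]
  linear_combination (-δ : A) * hr

theorem qShifted_apply {ι : Type*} (a q : ι → A) (k : ℕ) (i : ι) :
    qShifted a q k i = qShifted (a i) (q i) k := by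
  simp [qShifted, Finset.prod_apply]

theorem qShifted_mem {B : Subring A} {a q : A} (ha : a ∈ B) (hq : q ∈ B) (k : ℕ) :
    qShifted a q k ∈ B :=
  B.prod_mem fun _ _ => B.sub_mem B.one_mem (B.mul_mem ha (B.pow_mem hq _))

/-- Functions on the cube form a ring with pointwise inverse but no field. Having `wpTerm` over such
rings makes the family of its values on the cube itself a `wpTerm`. -/
theorem wpTerm_apply {ι : Type*} [Inv A] (q v c d u₁ u₂ u₃ : ι → A) (k : ℕ) (i : ι) :
    wpTerm q v c d u₁ u₂ u₃ k i = wpTerm (q i) (v i) (c i) (d i) (u₁ i) (u₂ i) (u₃ i) k := by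
  simp [wpTerm, qShifted_apply]

end Cube

/-! ### Watson's transformation in base `q ^ 4`. -/

section WatsonSpecialised

/-- The summand of the balanced `₄φ₃` series on the right-hand side of Watson's transformation. -/
def phiTerm {A : Type*} [CommRing A] [Inv A] (q c d u₁ u₂ u₃ : A) (k : ℕ) : A :=
  (qShifted (q ^ 3 * (c * d)⁻¹) (q ^ 4) k * qShifted (u₁ * q) (q ^ 4) k *
      qShifted (u₂ * q) (q ^ 4) k * qShifted (u₃ * q) (q ^ 4) k) *
    (qShifted (q ^ 4) (q ^ 4) k * qShifted (q ^ 4 * c⁻¹) (q ^ 4) k *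
      qShifted (q ^ 4 * d⁻¹) (q ^ 4) k * qShifted (u₁ * u₂ * u₃ * q ^ 2) (q ^ 4) k)⁻¹ *
    q ^ (4 * k)

/-- The product on the right-hand side of Watson's transformation. -/
def watsonPrefactor {A : Type*} [CommRing A] [Inv A] (q : A) (K : ℕ) (u w : A) : A :=
  qShifted q (q ^ 4) K * qShifted (q ^ 3 * (u * w)⁻¹) (q ^ 4) K *
    (qShifted (q ^ 4 * u⁻¹) (q ^ 4) K * qShifted (q ^ 4 * w⁻¹) (q ^ 4) K)⁻¹

variable {F : Type*} [Field F]

theorem watsonPrefactor_comm (q : F) (K : ℕ) (u w : F) :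
    watsonPrefactor q K u w = watsonPrefactor q K w u := by
  rw [watsonPrefactor, watsonPrefactor, mul_comm u w, mul_comm (qShifted (q ^ 4 * u⁻¹) (q ^ 4) K)]

theorem phiTerm_swap₁₂ (q c d u₁ u₂ u₃ : F) :
    phiTerm q c d u₁ u₂ u₃ = phiTerm q c d u₂ u₁ u₃ := by
  funext k
  rw [phiTerm, phiTerm, mul_comm u₁ u₂]; ring

theorem phiTerm_swap₁₃ (q c d u₁ u₂ u₃ : F) :
    phiTerm q c d u₁ u₂ u₃ = phiTerm q c d u₃ u₂ u₁ := by
  funext k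
  rw [phiTerm, phiTerm, show u₁ * u₂ * u₃ = u₃ * u₂ * u₁ by ring]; ring

theorem wpTerm_swap₁₂ (q v c d u₁ u₂ u₃ : F) :
    wpTerm q v c d u₁ u₂ u₃ = wpTerm q v c d u₂ u₁ u₃ := by
  funext k
  rw [wpTerm, wpTerm, show c * d * u₁ * u₂ * u₃ = c * d * u₂ * u₁ * u₃ by ring]
  simp only [mul_inv]
  ring

theorem wpTerm_swap₁₃ (q v c d u₁ u₂ u₃ : F) :
    wpTerm q v c d u₁ u₂ u₃ = wpTerm q v c d u₃ u₂ u₁ := by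
  funext k
  rw [wpTerm, wpTerm, show c * d * u₁ * u₂ * u₃ = c * d * u₃ * u₂ * u₁ by ring]
  simp only [mul_inv]
  ring

/-- This is `watson` in base `q ^ 4` with `a = q` and numerator parameters `c q`, `d q`, `u₂ q`, `u₃
q`; the hypothesis on `u₁` makes `u₁ q` the terminating parameter. -/
theorem sum_wpTerm_eq_watson {q c d u₁ u₂ u₃ : F} {K : ℕ} (hu : u₁ * q * (q ^ 4) ^ K = 1)
    (hc0 : c ≠ 0) (hd0 : d ≠ 0) (hu2 : u₂ ≠ 0) (hu3 : u₃ ≠ 0) (hq1 : ∀ j : ℕ, j ≠ 0 → q ^ j ≠ 1)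
    (nc : qShifted (q ^ 4 * c⁻¹) (q ^ 4) K ≠ 0) (nd : qShifted (q ^ 4 * d⁻¹) (q ^ 4) K ≠ 0)
    (n2 : qShifted (q ^ 4 * u₂⁻¹) (q ^ 4) K ≠ 0) (n3 : qShifted (q ^ 4 * u₃⁻¹) (q ^ 4) K ≠ 0)
    (nz : qShifted (u₁ * u₂ * u₃ * q ^ 2) (q ^ 4) K ≠ 0) :
    ∑ k ∈ Finset.range (K + 1), wpTerm q 1 c d u₁ u₂ u₃ k =
      (1 - q ^ (4 * K + 1)) * (1 - q)⁻¹ * watsonPrefactor q K u₂ u₃ *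
        ∑ k ∈ Finset.range (K + 1), phiTerm q c d u₁ u₂ u₃ k := by
  have huq : u₁ * q ≠ 0 := left_ne_zero_of_mul (by rw [hu]; exact one_ne_zero)
  have hu1 : u₁ ≠ 0 := left_ne_zero_of_mul huq
  have hq : q ≠ 0 := right_ne_zero_of_mul huq
  have nq : ∀ m, qShifted (q ^ 4) (q ^ 4) m ≠ 0 := fun m =>
    Finset.prod_ne_zero_iff.mpr fun j _ => sub_ne_zero.mpr (by
      rw [← pow_succ', ← pow_mul]; exact (hq1 _ (by omega)).symm)
  have na : qShifted (q * q ^ 4) (q ^ 4) (K + K) ≠ 0 :=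
    Finset.prod_ne_zero_iff.mpr fun j _ => sub_ne_zero.mpr (by
      rw [← pow_succ', ← pow_mul, ← pow_add]; exact (hq1 _ (by omega)).symm)
  have h1q : 1 - q ≠ 0 := sub_ne_zero.mpr (by simpa using (hq1 1 one_ne_zero).symm)
  have e1 : (q ^ 3 * (c * d)⁻¹) * (d * q) = q ^ 4 * c⁻¹ := by field_simp
  have e2 : (q ^ 3 * (c * d)⁻¹) * (c * q) = q ^ 4 * d⁻¹ := by field_simp
  have e3 : (q ^ 3 * (u₂ * u₃)⁻¹) * (u₃ * q) = q ^ 4 * u₂⁻¹ := by field_simp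
  have e4 : (q ^ 3 * (u₂ * u₃)⁻¹) * (u₂ * q) = q ^ 4 * u₃⁻¹ := by field_simp
  have e5 : q * q ^ 4 * (q ^ 4) ^ K = q ^ 4 * u₁⁻¹ := by
    rw [eq_mul_inv_iff_mul_eq₀ hu1]; linear_combination q ^ 4 * hu
  have e6 : (q ^ 3 * (u₂ * u₃)⁻¹) * (q ^ 3 * (c * d)⁻¹) * (q ^ 4) ^ K =
      1 ^ 2 * q ^ 5 * (c * d * u₁ * u₂ * u₃)⁻¹ := by
    field_simp
    linear_combination hu
  have key := watson (q := q ^ 4) (a := q) (b := c * q) (c := d * q) (d := u₂ * q) (e := u₃ * q)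
    (f := u₁ * q) (g := q ^ 3 * (u₂ * u₃)⁻¹) (h := q ^ 3 * (c * d)⁻¹)
    (z := u₁ * u₂ * u₃ * q ^ 2) (N := K) h1q (pow_ne_zero 4 hq) hu
    (by field_simp; linear_combination hu) (by field_simp) (by field_simp) (nq K) na
    (by rwa [e2]) (by rwa [e1]) (by rwa [e4]) (by rwa [e3]) nz
  rw [e1, e2, e3, e4, e5, e6] at key
  have hL : ∑ k ∈ Finset.range (K + 1), wpTerm q 1 c d u₁ u₂ u₃ k = _ :=
    (Finset.sum_congr rfl fun k _ => by
      rw [wpTerm]; simp only [one_mul, div_eq_mul_inv, mul_inv]; ring).trans key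
  -- Shifting the base point from `q` to `q ^ 5` is the source of the factor that becomes `[n]`.
  have h5 : qShifted (q * q ^ 4) (q ^ 4) K =
      (1 - q ^ (4 * K + 1)) * (1 - q)⁻¹ * qShifted q (q ^ 4) K := by
    have h6 := qShifted_succ_left q (q ^ 4) K
    rw [qShifted_succ, ← pow_mul, ← pow_succ'] at h6
    rw [mul_right_comm, eq_mul_inv_iff_mul_eq₀ h1q]
    linear_combination -h6
  rw [hL, h5, Finset.mul_sum, Finset.mul_sum]
  refine Finset.sum_congr rfl fun k _ => ?_
  rw [watsonPrefactor, phiTerm, pow_mul]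
  simp only [div_eq_mul_inv, mul_inv]
  ring

end WatsonSpecialised

/-! ### Valuations at which `q` reduces to a root of unity. -/

section Setting

variable {F : Type*} [Field F] {Γ₀ : Type*} [LinearOrderedCommGroupWithZero Γ₀]

/-- `q` is an element of infinite order whose residue class is a primitive `n`-th root of unity in
a residue field of characteristic zero. -/
structure HasOrderAt (v : Valuation F Γ₀) (q : F) (n : ℕ) : Prop where
  map_natCast : ∀ j : ℕ, j ≠ 0 → v (j : F) = 1
  pow_ne_one : ∀ j : ℕ, j ≠ 0 → q ^ j ≠ 1
  map_base : v q = 1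
  map_one_sub_zpow : ∀ j : ℤ, ¬ (n : ℤ) ∣ j → v (1 - q ^ j) = 1
  map_one_sub_pow_lt : v (1 - q ^ n) < 1

/-- The residue class of `c` is a nonzero element that is no power of the residue class of `q`. -/
structure IsGenericAt (v : Valuation F Γ₀) (q c : F) : Prop where
  map_self : v c = 1
  map_one_sub : ∀ j : ℤ, v (1 - q ^ j * c⁻¹) = 1

variable {v : Valuation F Γ₀} {q c d : F} {n : ℕ}

theorem HasOrderAt.ne_zero (h : HasOrderAt v q n) : q ≠ 0 :=
  (Valuation.ne_zero_iff v).mp (by rw [h.map_base]; exact one_ne_zero)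

theorem IsGenericAt.ne_zero (h : IsGenericAt v q c) : c ≠ 0 :=
  (Valuation.ne_zero_iff v).mp (by rw [h.map_self]; exact one_ne_zero)

theorem ne_zero_of_map_eq_one {x : F} (h : v x = 1) : x ≠ 0 :=
  (Valuation.ne_zero_iff v).mp (by rw [h]; exact one_ne_zero)

theorem HasOrderAt.map_zpow (h : HasOrderAt v q n) (e : ℤ) : v (q ^ e) = 1 := by
  rw [map_zpow₀, h.map_base, one_zpow]

theorem HasOrderAt.map_qShifted (h : HasOrderAt v q n) {a : F} (e : ℤ) (ha : a = q ^ e) {k : ℕ}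
    (he : ∀ j < k, ¬ (n : ℤ) ∣ e + 4 * j) : v (qShifted a (q ^ 4) k) = 1 := by
  rw [qShifted, map_prod]
  refine Finset.prod_eq_one fun j hj => ?_
  rw [ha, ← pow_mul, ← zpow_natCast, ← zpow_add₀ h.ne_zero]
  have := he j (Finset.mem_range.mp hj)
  exact h.map_one_sub_zpow _ (by push_cast; exact this)

theorem IsGenericAt.map_qShifted (h : HasOrderAt v q n) (hc : IsGenericAt v q c) {a : F} (e : ℤ)
    (ha : a = q ^ e * c⁻¹) (k : ℕ) : v (qShifted a (q ^ 4) k) = 1 := by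
  rw [qShifted, map_prod]
  refine Finset.prod_eq_one fun j hj => ?_
  rw [ha, ← pow_mul, ← zpow_natCast, mul_right_comm, ← zpow_add₀ h.ne_zero]
  exact hc.map_one_sub _

theorem invClosed_integer (v : Valuation F Γ₀) : InvClosed v.integer (fun a => v a = 1) := by
  intro a _ ha
  refine ⟨?_, mul_inv_cancel₀ (ne_zero_of_map_eq_one ha)⟩
  rw [Valuation.mem_integer_iff, map_inv₀, ha, inv_one]

variable {A : Type*} [CommRing A] [Inv A]

/-- Membership is proved for an arbitrary `InvClosed` subring, with `U` in the role of "unit",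
because it is needed for functions of one two-valued parameter and of four. -/
theorem wpTerm_mem {B : Subring A} {U : A → Prop} (hB : InvClosed B U) {q v c d u₁ u₂ u₃ : A}
    {k : ℕ} (hq : q ∈ B) (hv : v ∈ B) (hc : c ∈ B) (hd : d ∈ B) (h1 : u₁ ∈ B) (h2 : u₂ ∈ B)
    (h3 : u₃ ∈ B) (Uq : U (1 - q)) (Uc : U c) (Ud : U d) (U1 : U u₁) (U2 : U u₂) (U3 : U u₃)
    (Uz : U (c * d * u₁ * u₂ * u₃))
    (Uden : U (qShifted (q ^ 4) (q ^ 4) k * qShifted (v * q ^ 4 * c⁻¹) (q ^ 4) k *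
      qShifted (v * q ^ 4 * d⁻¹) (q ^ 4) k * qShifted (v * q ^ 4 * u₁⁻¹) (q ^ 4) k *
      qShifted (v * q ^ 4 * u₂⁻¹) (q ^ 4) k * qShifted (v * q ^ 4 * u₃⁻¹) (q ^ 4) k)) :
    wpTerm q v c d u₁ u₂ u₃ k ∈ B := by
  have hQ : q ^ 4 ∈ B := B.pow_mem hq 4
  have num : ∀ b ∈ B, qShifted (b * q) (q ^ 4) k ∈ B := fun b hb =>
    qShifted_mem (B.mul_mem hb hq) hQ k
  have den : ∀ b ∈ B, U b → qShifted (v * q ^ 4 * b⁻¹) (q ^ 4) k ∈ B := fun b hb hU =>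
    qShifted_mem (B.mul_mem (B.mul_mem hv hQ) (hB b hb hU).1) hQ k
  refine B.mul_mem (B.mul_mem (B.mul_mem (B.mul_mem ?_ ?_) ?_) ?_) ?_
  · exact B.sub_mem B.one_mem (B.mul_mem (B.mul_mem hv hq) (B.pow_mem hQ _))
  · exact (hB _ (B.sub_mem B.one_mem hq) Uq).1
  · exact B.mul_mem (B.mul_mem (B.mul_mem (B.mul_mem (B.mul_mem (num _ hv) (num _ hc)) (num _ hd))
      (num _ h1)) (num _ h2)) (num _ h3)
  · refine (hB _ ?_ Uden).1
    exact B.mul_mem (B.mul_mem (B.mul_mem (B.mul_mem (B.mul_mem (qShifted_mem hQ hQ k)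
      (den _ hc Uc)) (den _ hd Ud)) (den _ h1 U1)) (den _ h2 U2)) (den _ h3 U3)
  · refine B.pow_mem (B.mul_mem (B.mul_mem (B.pow_mem hv _) (B.pow_mem hq _)) ?_) _
    exact (hB _ (B.mul_mem (B.mul_mem (B.mul_mem (B.mul_mem hc hd) h1) h2) h3) Uz).1

theorem phiTerm_mem {B : Subring A} {U : A → Prop} (hB : InvClosed B U) {q c d u₁ u₂ u₃ : A}
    {k : ℕ} (hq : q ∈ B) (hc : c ∈ B) (hd : d ∈ B) (h1 : u₁ ∈ B) (h2 : u₂ ∈ B)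
    (h3 : u₃ ∈ B) (Uc : U c) (Ud : U d) (Ucd : U (c * d))
    (Uden : U (qShifted (q ^ 4) (q ^ 4) k * qShifted (q ^ 4 * c⁻¹) (q ^ 4) k *
      qShifted (q ^ 4 * d⁻¹) (q ^ 4) k * qShifted (u₁ * u₂ * u₃ * q ^ 2) (q ^ 4) k)) :
    phiTerm q c d u₁ u₂ u₃ k ∈ B := by
  have hQ : q ^ 4 ∈ B := B.pow_mem hq 4
  have num : ∀ b ∈ B, qShifted (b * q) (q ^ 4) k ∈ B := fun b hb =>
    qShifted_mem (B.mul_mem hb hq) hQ k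
  have den : ∀ b ∈ B, U b → qShifted (q ^ 4 * b⁻¹) (q ^ 4) k ∈ B := fun b hb hU =>
    qShifted_mem (B.mul_mem hQ (hB b hb hU).1) hQ k
  refine B.mul_mem (B.mul_mem ?_ ?_) (B.pow_mem hq _)
  · refine B.mul_mem (B.mul_mem (B.mul_mem ?_ (num _ h1)) (num _ h2)) (num _ h3)
    exact qShifted_mem (B.mul_mem (B.pow_mem hq _) (hB _ (B.mul_mem hc hd) Ucd).1) hQ k
  · refine (hB _ ?_ Uden).1
    exact B.mul_mem (B.mul_mem (B.mul_mem (qShifted_mem hQ hQ k) (den _ hc Uc)) (den _ hd Ud))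
      (qShifted_mem (B.mul_mem (B.mul_mem (B.mul_mem h1 h2) h3) (B.pow_mem hq _)) hQ k)

theorem watsonPrefactor_mem {B : Subring A} {U : A → Prop} (hB : InvClosed B U) {q u w : A}
    {K : ℕ} (hq : q ∈ B) (hu : u ∈ B) (hw : w ∈ B) (Uu : U u) (Uw : U w) (Uuw : U (u * w))
    (Uden : U (qShifted (q ^ 4 * u⁻¹) (q ^ 4) K * qShifted (q ^ 4 * w⁻¹) (q ^ 4) K)) :
    watsonPrefactor q K u w ∈ B := by
  have hQ : q ^ 4 ∈ B := B.pow_mem hq 4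
  have den : ∀ b ∈ B, U b → qShifted (q ^ 4 * b⁻¹) (q ^ 4) K ∈ B := fun b hb hU =>
    qShifted_mem (B.mul_mem hQ (hB b hb hU).1) hQ K
  refine B.mul_mem (B.mul_mem (qShifted_mem hq hQ K) ?_) ?_
  · exact qShifted_mem (B.mul_mem (B.pow_mem hq _) (hB _ (B.mul_mem hu hw) Uuw).1) hQ K
  · exact (hB _ (B.mul_mem (den _ hu Uu) (den _ hw Uw)) Uden).1

theorem phiTerm_apply {ι : Type*} (q c d u₁ u₂ u₃ : ι → A) (k : ℕ) (i : ι) :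
    phiTerm q c d u₁ u₂ u₃ k i = phiTerm (q i) (c i) (d i) (u₁ i) (u₂ i) (u₃ i) k := by
  simp [phiTerm, qShifted_apply]

theorem watsonPrefactor_apply {ι : Type*} (q u w : ι → A) (K : ℕ) (i : ι) :
    watsonPrefactor q K u w i = watsonPrefactor (q i) K (u i) (w i) := by
  simp [watsonPrefactor, qShifted_apply]

end Setting

/-! ### The very-well-poised sum modulo the fourth power, by interpolation on the cube. -/

section CubeFunctions

variable {F : Type*} [Field F] {Γ₀ : Type*} [LinearOrderedCommGroupWithZero Γ₀]
variable {v : Valuation F Γ₀} {q c d : F} {n : ℕ}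

theorem HasOrderAt.mem_integer (h : HasOrderAt v q n) : q ∈ v.integer :=
  le_of_eq h.map_base

/-- The deviation of `q ^ (-n)` from `1`. -/
def HasOrderAt.dev (h : HasOrderAt v q n) : v.integer :=
  ⟨q ^ (-(n : ℤ)) - 1, v.integer.sub_mem (le_of_eq (h.map_zpow _)) v.integer.one_mem⟩

theorem HasOrderAt.map_dev (h : HasOrderAt v q n) : v (h.dev : F) = v (1 - q ^ n) := by
  have h1 : q ^ (-(n : ℤ)) - 1 = q ^ (-(n : ℤ)) * (1 - q ^ n) := by
    rw [mul_sub, mul_one, zpow_neg, zpow_natCast, inv_mul_cancel₀ (pow_ne_zero _ h.ne_zero)]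
  change v (q ^ (-(n : ℤ)) - 1) = _
  rw [h1, map_mul, h.map_zpow, one_mul]

/-- The two-valued parameter with values `1` and `q ^ (-n)`. -/
def twoPoint (q : F) (n : ℕ) (b : Bool) : F := cond b 1 (q ^ (-(n : ℤ)))

theorem exists_twoPoint_eq (q : F) (n : ℕ) (b : Bool) :
    ∃ e : ℤ, twoPoint q n b = q ^ ((n : ℤ) * e) := by
  cases b
  · exact ⟨-1, by simp [twoPoint]⟩
  · exact ⟨0, by simp [twoPoint]⟩

theorem HasOrderAt.map_twoPoint (h : HasOrderAt v q n) (b : Bool) : v (twoPoint q n b) = 1 := by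
  obtain ⟨e, he⟩ := exists_twoPoint_eq q n b
  rw [he, h.map_zpow]

/-- The multiple of `n` drops out, and `0 < 4 (j + 1) < n`. Thus denominators stay units when
parameters are multiplied by powers of `q ^ n`. -/
theorem not_dvd_shift {n K j : ℕ} (hn : n = 4 * K + 1) (hj : j < K) (e : ℤ) :
    ¬ (n : ℤ) ∣ ((n : ℤ) * e + 4) + 4 * j := by
  intro hd
  have h1 : (n : ℤ) ∣ 4 * (j + 1) := by
    have := dvd_sub hd (dvd_mul_right (n : ℤ) e)
    rwa [show (n : ℤ) * e + 4 + 4 * j - n * e = 4 * (j + 1) by ring] at this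
  have := Int.le_of_dvd (by positivity) h1
  omega

theorem not_dvd_shift_two {n K j : ℕ} (hn : n = 4 * K + 1) (hj : j < K) (e : ℤ) :
    ¬ (n : ℤ) ∣ ((n : ℤ) * e + 2) + 4 * j := by
  intro hd
  have h1 : (n : ℤ) ∣ 4 * j + 2 := by
    have := dvd_sub hd (dvd_mul_right (n : ℤ) e)
    rwa [show (n : ℤ) * e + 2 + 4 * j - n * e = 4 * j + 2 by ring] at this
  have := Int.le_of_dvd (by positivity) h1
  omega

theorem HasOrderAt.map_one_sub_self (h : HasOrderAt v q n) (hn : 1 < n) : v (1 - q) = 1 := by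
  have := h.map_one_sub_zpow 1 (by intro hd; have := Int.le_of_dvd one_pos hd; omega)
  simpa using this

variable {K : ℕ}

theorem HasOrderAt.map_qShifted_den (h : HasOrderAt v q n) (hn : n = 4 * K + 1) {k : ℕ}
    (hk : k ≤ K) (a b : Bool) :
    v (qShifted (twoPoint q n a * q ^ 4 * (twoPoint q n b)⁻¹) (q ^ 4) k) = 1 := by
  obtain ⟨e, he⟩ := exists_twoPoint_eq q n a
  obtain ⟨f, hf⟩ := exists_twoPoint_eq q n b
  refine h.map_qShifted ((n : ℤ) * (e - f) + 4) ?_ fun j hj => not_dvd_shift hn (by omega) _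
  rw [he, hf, ← zpow_neg, ← zpow_natCast, ← zpow_add₀ h.ne_zero, ← zpow_add₀ h.ne_zero]
  congr 1; push_cast; ring

theorem HasOrderAt.map_qShifted_den' (h : HasOrderAt v q n) (hn : n = 4 * K + 1) {k : ℕ}
    (hk : k ≤ K) (b : Bool) :
    v (qShifted (q ^ 4 * (twoPoint q n b)⁻¹) (q ^ 4) k) = 1 := by
  have := h.map_qShifted_den hn hk true b
  rwa [show twoPoint q n true = 1 from rfl, one_mul] at this

theorem HasOrderAt.map_qShifted_base (h : HasOrderAt v q n) (hn : n = 4 * K + 1) {k : ℕ}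
    (hk : k ≤ K) : v (qShifted (q ^ 4) (q ^ 4) k) = 1 := by
  have := h.map_qShifted_den hn hk true true
  simpa [twoPoint] using this

theorem IsGenericAt.map_qShifted_den (h : HasOrderAt v q n) (hc : IsGenericAt v q c) (a : Bool)
    (k : ℕ) : v (qShifted (twoPoint q n a * q ^ 4 * c⁻¹) (q ^ 4) k) = 1 := by
  obtain ⟨e, he⟩ := exists_twoPoint_eq q n a
  refine hc.map_qShifted h ((n : ℤ) * e + 4) ?_ k
  rw [he, ← zpow_natCast q 4, ← zpow_add₀ h.ne_zero]
  norm_num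

theorem IsGenericAt.map_qShifted_den' (h : HasOrderAt v q n) (hc : IsGenericAt v q c) (k : ℕ) :
    v (qShifted (q ^ 4 * c⁻¹) (q ^ 4) k) = 1 :=
  hc.map_qShifted h 4 (by norm_cast) k

theorem HasOrderAt.map_qShifted_mid (h : HasOrderAt v q n) (hn : n = 4 * K + 1) {k : ℕ}
    (hk : k ≤ K) (b₁ b₂ b₃ : Bool) :
    v (qShifted (twoPoint q n b₁ * twoPoint q n b₂ * twoPoint q n b₃ * q ^ 2) (q ^ 4) k) = 1 := by
  obtain ⟨e, he⟩ := exists_twoPoint_eq q n b₁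
  obtain ⟨f, hf⟩ := exists_twoPoint_eq q n b₂
  obtain ⟨g, hg⟩ := exists_twoPoint_eq q n b₃
  refine h.map_qShifted ((n : ℤ) * (e + f + g) + 2) ?_ fun j hj =>
    not_dvd_shift_two hn (by omega) _
  rw [he, hf, hg, ← zpow_natCast, ← zpow_add₀ h.ne_zero, ← zpow_add₀ h.ne_zero,
    ← zpow_add₀ h.ne_zero]
  congr 1; push_cast; ring

theorem twoPoint_mem (h : HasOrderAt v q n) : twoPoint q n ∈ diffSubring h.dev := by
  refine ⟨v.integer.one_mem, 1, v.integer.one_mem, ?_⟩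
  simp [twoPoint, HasOrderAt.dev]

theorem cond_mem_step {A : Type*} [CommRing A] {B : Subring A} (δ : B) {x : A}
    (hx : x = 1 + δ) {g : Bool → A} (hg : g = fun b => cond b 1 x) : g ∈ diffSubring δ := by
  rw [hg, hx]
  have := cond_mem_diffSubring δ B.one_mem B.one_mem
  simpa using this

theorem HasOrderAt.one_add_dev (h : HasOrderAt v q n) : q ^ (-(n : ℤ)) = 1 + h.dev := by
  simp [HasOrderAt.dev]

theorem twoPoint_mem₃ (h : HasOrderAt v q n) :
    (fun a _ _ => twoPoint q n a) ∈ diffSubring₃ h.dev ∧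
    (fun _ a _ => twoPoint q n a) ∈ diffSubring₃ h.dev ∧
    (fun _ _ a => twoPoint q n a) ∈ diffSubring₃ h.dev := by
  refine ⟨cond_mem_step _ (x := fun _ _ => q ^ (-(n : ℤ))) ?_ ?_,
    const_mem_diffSubring _ (cond_mem_step _ (x := fun _ => q ^ (-(n : ℤ))) ?_ ?_),
    const_mem_diffSubring _ (const_mem_diffSubring _ (twoPoint_mem h))⟩
  · funext a b; exact h.one_add_dev
  · funext a; cases a <;> rfl
  · funext a; exact h.one_add_dev
  · funext a; cases a <;> rfl

theorem twoPoint_mem₄ (h : HasOrderAt v q n) :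
    (fun a _ _ _ => twoPoint q n a) ∈ diffSubring₄ h.dev := by
  refine cond_mem_step _ (x := fun _ _ _ => q ^ (-(n : ℤ))) ?_ ?_
  · funext a b c; exact h.one_add_dev
  · funext a; cases a <;> rfl

theorem const_mem₃ {B : Subring F} (δ : B) {a : F} (ha : a ∈ B) :
    (fun _ _ _ => a) ∈ diffSubring₃ δ :=
  const_mem_diffSubring _ (const_mem_diffSubring _ (const_mem_diffSubring _ ha))

theorem invClosed₃ (h : HasOrderAt v q n) :
    InvClosed (diffSubring₃ h.dev) fun g => ∀ a b c, v (g a b c) = 1 :=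
  (((invClosed_integer v).diffSubring _).diffSubring _).diffSubring _

theorem invClosed₄ (h : HasOrderAt v q n) :
    InvClosed (diffSubring₄ h.dev) fun g => ∀ e a b c, v (g e a b c) = 1 :=
  (invClosed₃ h).diffSubring _

theorem sum_wpTerm_mem (h : HasOrderAt v q n) (hc : IsGenericAt v q c) (hd : IsGenericAt v q d)
    (hn : n = 4 * K + 1) (hK : 0 < K) :
    (fun e a₁ a₂ a₃ => ∑ k ∈ Finset.range (K + 1), wpTerm q (twoPoint q n e) c d
      (twoPoint q n a₁) (twoPoint q n a₂) (twoPoint q n a₃) k) ∈ diffSubring₄ h.dev := by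
  -- The family is rewritten as one sum in the function ring, so that the closure properties of
  -- `diffSubring₄` apply.
  have e1 : (fun e a₁ a₂ a₃ => ∑ k ∈ Finset.range (K + 1), wpTerm q (twoPoint q n e) c d
      (twoPoint q n a₁) (twoPoint q n a₂) (twoPoint q n a₃) k) =
      ∑ k ∈ Finset.range (K + 1), wpTerm (fun _ _ _ _ => q) (fun a _ _ _ => twoPoint q n a)
        (fun _ _ _ _ => c) (fun _ _ _ _ => d) (fun _ a _ _ => twoPoint q n a)
        (fun _ _ a _ => twoPoint q n a) (fun _ _ _ a => twoPoint q n a) k := by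
    funext e a₁ a₂ a₃
    simp only [Finset.sum_apply, wpTerm_apply]
  rw [e1]
  refine Subring.sum_mem _ fun k hk => ?_
  have hk : k ≤ K := Nat.lt_succ_iff.mp (Finset.mem_range.mp hk)
  obtain ⟨m1, m2, m3⟩ := twoPoint_mem₃ h
  refine wpTerm_mem (invClosed₄ h) (const_mem_diffSubring _ (const_mem₃ _ h.mem_integer))
    (twoPoint_mem₄ h) (const_mem_diffSubring _ (const_mem₃ _ (le_of_eq hc.map_self)))
    (const_mem_diffSubring _ (const_mem₃ _ (le_of_eq hd.map_self)))
    (const_mem_diffSubring _ m1) (const_mem_diffSubring _ m2) (const_mem_diffSubring _ m3)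
    ?_ ?_ ?_ ?_ ?_ ?_ ?_ ?_ <;> intro e a₁ a₂ a₃
  · simpa using h.map_one_sub_self (by omega)
  · exact hc.map_self
  · exact hd.map_self
  · exact h.map_twoPoint _
  · exact h.map_twoPoint _
  · exact h.map_twoPoint _
  · simp only [Pi.mul_apply, map_mul, hc.map_self, hd.map_self, h.map_twoPoint, one_mul]
  · simp only [Pi.mul_apply, Pi.pow_apply, Pi.inv_apply, qShifted_apply, map_mul,
      h.map_qShifted_den hn hk, hc.map_qShifted_den h, hd.map_qShifted_den h,
      h.map_qShifted_base hn hk, one_mul]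

/-- A symmetric function of `u₁, u₂, u₃` that equals `watsonPrefactor q K u₂ u₃` when `u₁ = x`. -/
def symPrefactor {A : Type*} [CommRing A] [Inv A] (q x : A) (K : ℕ) (u₁ u₂ u₃ : A) : A :=
  watsonPrefactor q K u₂ u₃ + watsonPrefactor q K u₁ u₃ + watsonPrefactor q K u₁ u₂ -
    watsonPrefactor q K x u₁ - watsonPrefactor q K x u₂ - watsonPrefactor q K x u₃ +
    watsonPrefactor q K x x

theorem symPrefactor_apply {ι A : Type*} [CommRing A] [Inv A] (q x u₁ u₂ u₃ : ι → A) (K : ℕ)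
    (i : ι) : symPrefactor q x K u₁ u₂ u₃ i = symPrefactor (q i) (x i) K (u₁ i) (u₂ i) (u₃ i) := by
  simp [symPrefactor, watsonPrefactor_apply]

/-- All other terms cancel in pairs. The symmetric form is needed because Watson's transformation
singles out the parameter equal to `x`, while the third difference needs one function for all faces.
-/
theorem symPrefactor_eq_left (q x : F) (K : ℕ) (u₂ u₃ : F) :
    symPrefactor q x K x u₂ u₃ = watsonPrefactor q K u₂ u₃ := by
  rw [symPrefactor]; ring

theorem symPrefactor_eq_mid (q x : F) (K : ℕ) (u₁ u₃ : F) :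
    symPrefactor q x K u₁ x u₃ = watsonPrefactor q K u₁ u₃ := by
  rw [symPrefactor, watsonPrefactor_comm q K u₁ x]; ring

theorem symPrefactor_eq_right (q x : F) (K : ℕ) (u₁ u₂ : F) :
    symPrefactor q x K u₁ u₂ x = watsonPrefactor q K u₁ u₂ := by
  rw [symPrefactor, watsonPrefactor_comm q K u₁ x, watsonPrefactor_comm q K u₂ x]; ring

theorem sum_phiTerm_mem (h : HasOrderAt v q n) (hc : IsGenericAt v q c) (hd : IsGenericAt v q d)
    (hn : n = 4 * K + 1) :
    (fun a₁ a₂ a₃ => symPrefactor q (q ^ (-(n : ℤ))) K (twoPoint q n a₁) (twoPoint q n a₂)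
        (twoPoint q n a₃) * ∑ k ∈ Finset.range (K + 1), phiTerm q c d
      (twoPoint q n a₁) (twoPoint q n a₂) (twoPoint q n a₃) k) ∈ diffSubring₃ h.dev := by
  have e1 : (fun a₁ a₂ a₃ => symPrefactor q (q ^ (-(n : ℤ))) K (twoPoint q n a₁) (twoPoint q n a₂)
        (twoPoint q n a₃) * ∑ k ∈ Finset.range (K + 1), phiTerm q c d
      (twoPoint q n a₁) (twoPoint q n a₂) (twoPoint q n a₃) k) =
      symPrefactor (fun _ _ _ => q) (fun _ _ _ => twoPoint q n false) K
        (fun a _ _ => twoPoint q n a) (fun _ a _ => twoPoint q n a) (fun _ _ a => twoPoint q n a) *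
      ∑ k ∈ Finset.range (K + 1), phiTerm (fun _ _ _ => q) (fun _ _ _ => c) (fun _ _ _ => d)
        (fun a _ _ => twoPoint q n a) (fun _ a _ => twoPoint q n a)
        (fun _ _ a => twoPoint q n a) k := by
    funext a₁ a₂ a₃
    simp only [Pi.mul_apply, Finset.sum_apply, phiTerm_apply, symPrefactor_apply]
    rfl
  obtain ⟨m1, m2, m3⟩ := twoPoint_mem₃ h
  have mq := const_mem₃ h.dev h.mem_integer
  have mx : (fun _ _ _ => twoPoint q n false) ∈ diffSubring₃ h.dev :=
    const_mem₃ h.dev (le_of_eq (h.map_twoPoint false))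
  have pm : ∀ f g : Bool → Bool → Bool → Bool, (fun a₁ a₂ a₃ => twoPoint q n (f a₁ a₂ a₃)) ∈
      diffSubring₃ h.dev → (fun a₁ a₂ a₃ => twoPoint q n (g a₁ a₂ a₃)) ∈ diffSubring₃ h.dev →
      watsonPrefactor (fun _ _ _ => q) K (fun a₁ a₂ a₃ => twoPoint q n (f a₁ a₂ a₃))
        (fun a₁ a₂ a₃ => twoPoint q n (g a₁ a₂ a₃)) ∈ diffSubring₃ h.dev := by
    intro f g hf hg
    refine watsonPrefactor_mem (invClosed₃ h) mq hf hg ?_ ?_ ?_ ?_ <;> intro a₁ a₂ a₃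
    · exact h.map_twoPoint _
    · exact h.map_twoPoint _
    · simp only [Pi.mul_apply, map_mul, h.map_twoPoint, one_mul]
    · simp only [Pi.mul_apply, Pi.pow_apply, Pi.inv_apply, qShifted_apply, map_mul,
        h.map_qShifted_den' hn le_rfl, one_mul]
  rw [e1]
  refine Subring.mul_mem _ ?_ (Subring.sum_mem _ fun k hk => ?_)
  · refine Subring.add_mem _ (Subring.sub_mem _ (Subring.sub_mem _ (Subring.sub_mem _
      (Subring.add_mem _ (Subring.add_mem _ ?_ ?_) ?_) ?_) ?_) ?_) ?_
    · exact pm (fun _ a _ => a) (fun _ _ a => a) m2 m3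
    · exact pm (fun a _ _ => a) (fun _ _ a => a) m1 m3
    · exact pm (fun a _ _ => a) (fun _ a _ => a) m1 m2
    · exact pm (fun _ _ _ => false) (fun a _ _ => a) mx m1
    · exact pm (fun _ _ _ => false) (fun _ a _ => a) mx m2
    · exact pm (fun _ _ _ => false) (fun _ _ a => a) mx m3
    · exact pm (fun _ _ _ => false) (fun _ _ _ => false) mx mx
  · have hk : k ≤ K := Nat.lt_succ_iff.mp (Finset.mem_range.mp hk)
    refine phiTerm_mem (invClosed₃ h) mq (const_mem₃ _ (le_of_eq hc.map_self))
      (const_mem₃ _ (le_of_eq hd.map_self)) m1 m2 m3 ?_ ?_ ?_ ?_ <;> intro a₁ a₂ a₃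
    · exact hc.map_self
    · exact hd.map_self
    · simp only [Pi.mul_apply, map_mul, hc.map_self, hd.map_self, one_mul]
    · simp only [Pi.mul_apply, Pi.pow_apply, Pi.inv_apply, qShifted_apply, map_mul,
        h.map_qShifted_mid hn hk, hc.map_qShifted_den' h, hd.map_qShifted_den' h,
        h.map_qShifted_base hn hk, one_mul]

/-- With `v = q ^ (-n)` one has `v q (q ^ 4) ^ K = 1`, so the antisymmetry applies whatever the
other parameters are. -/
theorem sum_wpTerm_twoPoint_eq_zero [CharZero F] (h : HasOrderAt v q n) (hc : IsGenericAt v q c)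
    (hd : IsGenericAt v q d) (hn : n = 4 * K + 1) (a₁ a₂ a₃ : Bool) :
    ∑ k ∈ Finset.range (K + 1), wpTerm q (twoPoint q n false) c d
      (twoPoint q n a₁) (twoPoint q n a₂) (twoPoint q n a₃) k = 0 := by
  refine sum_wpTerm_eq_zero ?_ hc.ne_zero hd.ne_zero (ne_zero_of_map_eq_one (h.map_twoPoint _))
    (ne_zero_of_map_eq_one (h.map_twoPoint _)) (ne_zero_of_map_eq_one (h.map_twoPoint _))
    (ne_zero_of_map_eq_one (h.map_qShifted_base hn le_rfl))
    (ne_zero_of_map_eq_one (hc.map_qShifted_den h _ _))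
    (ne_zero_of_map_eq_one (hd.map_qShifted_den h _ _))
    (ne_zero_of_map_eq_one (h.map_qShifted_den hn le_rfl _ _))
    (ne_zero_of_map_eq_one (h.map_qShifted_den hn le_rfl _ _))
    (ne_zero_of_map_eq_one (h.map_qShifted_den hn le_rfl _ _))
  rw [show twoPoint q n false = q ^ (-(n : ℤ)) from rfl, mul_assoc, ← pow_mul, ← pow_succ', ← hn,
    zpow_neg, zpow_natCast, inv_mul_cancel₀ (pow_ne_zero _ h.ne_zero)]

theorem sum_wpTerm_twoPoint_eq (h : HasOrderAt v q n) (hc : IsGenericAt v q c)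
    (hd : IsGenericAt v q d) (hn : n = 4 * K + 1) (a₂ a₃ : Bool) :
    ∑ k ∈ Finset.range (K + 1), wpTerm q 1 c d (twoPoint q n false) (twoPoint q n a₂)
        (twoPoint q n a₃) k =
      (1 - q ^ n) * (1 - q)⁻¹ * (watsonPrefactor q K (twoPoint q n a₂) (twoPoint q n a₃) *
        ∑ k ∈ Finset.range (K + 1), phiTerm q c d (twoPoint q n false) (twoPoint q n a₂)
          (twoPoint q n a₃) k) := by
  have hu : twoPoint q n false * q * (q ^ 4) ^ K = 1 := by
    rw [show twoPoint q n false = q ^ (-(n : ℤ)) from rfl, mul_assoc, ← pow_mul, ← pow_succ', ← hn,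
      zpow_neg, zpow_natCast, inv_mul_cancel₀ (pow_ne_zero _ h.ne_zero)]
  have key := sum_wpTerm_eq_watson hu hc.ne_zero hd.ne_zero
    (ne_zero_of_map_eq_one (h.map_twoPoint a₂))
    (ne_zero_of_map_eq_one (h.map_twoPoint a₃)) h.pow_ne_one
    (ne_zero_of_map_eq_one (hc.map_qShifted_den' h _))
    (ne_zero_of_map_eq_one (hd.map_qShifted_den' h _))
    (ne_zero_of_map_eq_one (h.map_qShifted_den' hn le_rfl _))
    (ne_zero_of_map_eq_one (h.map_qShifted_den' hn le_rfl _))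
    (ne_zero_of_map_eq_one (h.map_qShifted_mid hn le_rfl _ _ _))
  rwa [← hn, mul_assoc _ (watsonPrefactor _ _ _ _)] at key

/-- The very-well-poised sum modulo the fourth power of `1 - q ^ n`. -/
theorem sum_wpTerm_congr [CharZero F] (h : HasOrderAt v q n) (hc : IsGenericAt v q c)
    (hd : IsGenericAt v q d) (hn : n = 4 * K + 1) (hK : 0 < K) :
    v (∑ k ∈ Finset.range (K + 1), wpTerm q 1 c d 1 1 1 k -
      (1 - q ^ n) * (1 - q)⁻¹ * (symPrefactor q (q ^ (-(n : ℤ))) K 1 1 1 *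
        ∑ k ∈ Finset.range (K + 1), phiTerm q c d 1 1 1 k)) ≤ v (1 - q ^ n) ^ 4 := by
  obtain ⟨r, hr, her⟩ := exists_fourth_difference (sum_wpTerm_mem h hc hd hn hK)
    (sum_wpTerm_twoPoint_eq_zero h hc hd hn)
  obtain ⟨s, hs, hes⟩ := exists_third_difference (sum_phiTerm_mem h hc hd hn)
  have hT : twoPoint q n true = 1 := rfl
  have hX : q ^ (-(n : ℤ)) = twoPoint q n false := rfl
  have w := sum_wpTerm_twoPoint_eq h hc hd hn
  -- Symmetry in `u₁, u₂, u₃` moves the terminating parameter to the other two positions.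
  have w1 : ∀ a₁ a₃, ∑ k ∈ Finset.range (K + 1), wpTerm q 1 c d (twoPoint q n a₁)
      (twoPoint q n false) (twoPoint q n a₃) k = (1 - q ^ n) * (1 - q)⁻¹ *
      (watsonPrefactor q K (twoPoint q n a₁) (twoPoint q n a₃) *
        ∑ k ∈ Finset.range (K + 1), phiTerm q c d (twoPoint q n a₁) (twoPoint q n false)
          (twoPoint q n a₃) k) := fun a₁ a₃ => by
    rw [wpTerm_swap₁₂, phiTerm_swap₁₂, w]
  have w2 : ∀ a₁ a₂, ∑ k ∈ Finset.range (K + 1), wpTerm q 1 c d (twoPoint q n a₁)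
      (twoPoint q n a₂) (twoPoint q n false) k = (1 - q ^ n) * (1 - q)⁻¹ *
      (watsonPrefactor q K (twoPoint q n a₁) (twoPoint q n a₂) *
        ∑ k ∈ Finset.range (K + 1), phiTerm q c d (twoPoint q n a₁) (twoPoint q n a₂)
          (twoPoint q n false) k) := fun a₁ a₂ => by
    rw [wpTerm_swap₁₃, phiTerm_swap₁₃, w, watsonPrefactor_comm]
  simp only [hX, symPrefactor_eq_left, symPrefactor_eq_mid, symPrefactor_eq_right] at hes
  simp only [hT] at her
  have hT' : (1 : F) = twoPoint q n true := rfl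
  -- The third difference, times `(1 - q ^ n) / (1 - q)`, is subtracted from the fourth. Watson's
  -- transformation identifies the seven contributions in which some `uᵢ` is `q ^ (-n)`, leaving
  -- only the vertex `(1, 1, 1)`.
  have her' : ∑ k ∈ Finset.range (K + 1), wpTerm q 1 c d 1 1 1 k -
      (1 - q ^ n) * (1 - q)⁻¹ * (symPrefactor q (q ^ (-(n : ℤ))) K 1 1 1 *
        ∑ k ∈ Finset.range (K + 1), phiTerm q c d 1 1 1 k) =
      (h.dev : F) ^ 4 * r - (1 - q ^ n) * (1 - q)⁻¹ * ((h.dev : F) ^ 3 * s) := by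
    rw [← her, ← hes]
    have a1 := w true true
    have a2 := w1 true true
    have a3 := w2 true true
    have a4 := w false true
    have a5 := w true false
    have a6 := w1 true false
    have a7 := w false false
    simp only [hT] at a1 a2 a3 a4 a5 a6 a7 ⊢
    rw [a1, a2, a3, a4, a5, a6, a7, hX]
    ring
  rw [her']
  have hδ := h.map_dev
  have hr1 : v r ≤ 1 := hr
  have hs1 : v s ≤ 1 := hs
  refine v.map_sub_le ?_ ?_
  · rw [map_mul, map_pow, hδ]
    exact mul_le_of_le_one_right' hr1
  · rw [map_mul, map_mul, map_mul, map_inv₀, h.map_one_sub_self (by omega), map_pow, hδ, inv_one,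
      mul_one, ← mul_assoc, ← pow_succ']
    exact mul_le_of_le_one_right' hs1

end CubeFunctions

/-! ### Second-order expansions of products. -/

section Expansion

variable {R : Type*} [CommRing R]

/-- Here `a` and `b` are the first two elementary symmetric functions, and Newton's identity gives
the power sums. The combination `a + 2 * b - a ^ 2` is the one that emerges in `cube_dvd_expansion`.
-/
theorem prod_one_add_expand {ι : Type*} (s : Finset ι) (α : ι → R) :
    ∃ a b : R, ∃ P : R[X], ∏ i ∈ s, (1 + C (α i) * X) = 1 + C a * X + C b * X ^ 2 + X ^ 3 * P ∧
      a + 2 * b - a ^ 2 = ∑ i ∈ s, (α i - α i ^ 2) := by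
  classical
  induction s using Finset.induction_on with
  | empty => exact ⟨0, 0, 0, by simp, by simp⟩
  | insert i s hi ih =>
    obtain ⟨a, b, P, h1, h2⟩ := ih
    refine ⟨a + α i, b + α i * a, P * (1 + C (α i) * X) + C (α i * b), ?_, ?_⟩
    · rw [Finset.prod_insert hi, h1]
      simp only [C_add, C_mul]
      ring
    · rw [Finset.sum_insert hi, ← h2]; ring

/-- With `w = 1 / (1 - z)` and `α = -z w`, one has `1 - (1 + δ) z = (1 - z) (1 + α δ)` and `α - α ^
2 = -z w ^ 2`. -/
theorem prod_sub_expand {ι : Type*} (s : Finset ι) (z w : ι → R)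
    (hw : ∀ i ∈ s, (1 - z i) * w i = 1) :
    ∃ a b : R, ∃ P : R[X],
      (∀ δ : R, ∏ i ∈ s, (1 - (1 + δ) * z i) =
        (∏ i ∈ s, (1 - z i)) * (1 + a * δ + b * δ ^ 2 + δ ^ 3 * P.eval δ)) ∧
      a + 2 * b - a ^ 2 = - ∑ i ∈ s, z i * w i ^ 2 := by
  obtain ⟨a, b, P, h1, h2⟩ := prod_one_add_expand s fun i => - z i * w i
  refine ⟨a, b, P, fun δ => ?_, ?_⟩
  · have h3 := congrArg (Polynomial.eval δ) h1
    simp only [eval_prod, eval_add, eval_mul, eval_one, eval_C, eval_X, eval_pow] at h3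
    rw [← h3, ← Finset.prod_mul_distrib]
    refine Finset.prod_congr rfl fun i hi => ?_
    linear_combination (z i * δ) * hw i hi
  · rw [h2, ← Finset.sum_neg_distrib]
    refine Finset.sum_congr rfl fun i hi => ?_
    linear_combination (z i * w i) * hw i hi

theorem trunc_mul {d : R} (hd : d ^ 3 = 0) (x₀ x₁ x₂ y₀ y₁ y₂ : R) :
    (x₀ + x₁ * d + x₂ * d ^ 2) * (y₀ + y₁ * d + y₂ * d ^ 2) =
      x₀ * y₀ + (x₀ * y₁ + x₁ * y₀) * d + (x₀ * y₂ + x₁ * y₁ + x₂ * y₀) * d ^ 2 := by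
  linear_combination (x₁ * y₂ + x₂ * y₁ + x₂ * y₂ * d) * hd

/-- This is the expansion of `3 W(1, 1) - 3 W(x, 1) + W(x, x)` after normalisation. `H` comes from
the denominators, `H'` from `(q; q ^ 4)_K`, and `W₁`, `W₂`, `W₃` are one product evaluated at `q ^
n`, `q ^ (2n)`, `q ^ (3n)`. The alternating combination eliminates its coefficients `p` and `r`. -/
theorem cube_dvd_expansion {δ ε a b p r r₁ r₂ r₃ r₄ r₅ : R} (hε : (1 + ε) * (1 + δ) = 1)
    {H H' W₁ W₂ W₃ δ₂ δ₃ : R} (h2 : δ₂ = 2 * δ + δ ^ 2) (h3 : δ₃ = 3 * δ + 3 * δ ^ 2 + δ ^ 3)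
    (hH : H = 1 + a * δ + b * δ ^ 2 + δ ^ 3 * r₁)
    (hH' : H' = 1 + a * ε + b * ε ^ 2 + ε ^ 3 * r₂)
    (hW₁ : W₁ = 1 + p * δ + r * δ ^ 2 + δ ^ 3 * r₃)
    (hW₂ : W₂ = 1 + p * δ₂ + r * δ₂ ^ 2 + δ₂ ^ 3 * r₄)
    (hW₃ : W₃ = 1 + p * δ₃ + r * δ₃ ^ 2 + δ₃ ^ 3 * r₅) :
    δ ^ 3 ∣ H' * (3 * W₁ * H ^ 2 - 3 * W₂ * H + W₃) - H ^ 2 * (1 + δ ^ 2 * (a + 2 * b - a ^ 2)) := by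
  rw [← Ideal.mem_span_singleton, ← Ideal.Quotient.eq_zero_iff_mem]
  have hd : (Ideal.Quotient.mk (Ideal.span {δ ^ 3}) δ) ^ 3 = 0 := by
    rw [← map_pow, Ideal.Quotient.eq_zero_iff_mem]
    exact Ideal.mem_span_singleton_self _
  -- The inverse of `1 + δ`, expanded to second order.
  have hε' : ε = - δ + δ ^ 2 - δ ^ 3 * (1 + ε) := by
    linear_combination (1 - δ + δ ^ 2) * hε
  generalize Ideal.Quotient.mk (Ideal.span {δ ^ 3}) = φ at *
  have e1 : φ H = 1 + φ a * φ δ + φ b * φ δ ^ 2 := by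
    rw [hH]; simp only [map_add, map_mul, map_pow, map_one]; rw [hd]; ring
  have e0 : φ ε = - φ δ + φ δ ^ 2 := by
    have := congrArg φ hε'
    simp only [map_add, map_mul, map_pow, map_one, map_neg, map_sub] at this
    rw [this, hd]; ring
  have e2 : φ H' = 1 + (- φ a) * φ δ + (φ a + φ b) * φ δ ^ 2 := by
    rw [hH']; simp only [map_add, map_mul, map_pow, map_one]; rw [e0]
    linear_combination (φ b * (-2 + φ δ) + (-1 + φ δ) ^ 3 * φ r₂) * hd
  have e3 : φ W₁ = 1 + φ p * φ δ + φ r * φ δ ^ 2 := by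
    rw [hW₁]; simp only [map_add, map_mul, map_pow, map_one]; rw [hd]; ring
  have e4 : φ W₂ = 1 + (2 * φ p) * φ δ + (φ p + 4 * φ r) * φ δ ^ 2 := by
    rw [hW₂, h2]; simp only [map_add, map_mul, map_pow, map_one, map_ofNat]
    linear_combination (φ r * (4 + φ δ) + (2 + φ δ) ^ 3 * φ r₄) * hd
  have e5 : φ W₃ = 1 + (3 * φ p) * φ δ + (3 * φ p + 9 * φ r) * φ δ ^ 2 := by
    rw [hW₃, h3]; simp only [map_add, map_mul, map_pow, map_one, map_ofNat]
    linear_combination (φ p + φ r * (18 + 15 * φ δ + 6 * φ δ ^ 2 + φ δ ^ 3) +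
      (3 + 3 * φ δ + φ δ ^ 2) ^ 3 * φ r₅) * hd
  simp only [map_add, map_mul, map_pow, map_one, map_sub, map_ofNat]
  have e6 : φ H ^ 2 = 1 + (2 * φ a) * φ δ + (2 * φ b + φ a ^ 2) * φ δ ^ 2 := by
    rw [pow_two, e1, trunc_mul hd]; ring
  have e7 : φ W₁ * φ H ^ 2 = 1 + (φ p + 2 * φ a) * φ δ +
      (φ r + 2 * φ a * φ p + 2 * φ b + φ a ^ 2) * φ δ ^ 2 := by
    rw [e6, e3, trunc_mul hd]; ring
  have e8 : φ W₂ * φ H = 1 + (2 * φ p + φ a) * φ δ +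
      (φ p + 4 * φ r + 2 * φ a * φ p + φ b) * φ δ ^ 2 := by
    rw [e1, e4, trunc_mul hd]; ring
  have e9 : 3 * φ W₁ * φ H ^ 2 - 3 * φ W₂ * φ H + φ W₃ =
      1 + (3 * φ a) * φ δ + (3 * φ b + 3 * φ a ^ 2) * φ δ ^ 2 := by
    rw [mul_assoc, mul_assoc, e7, e8, e5]; ring
  have e10 : φ H ^ 2 * (1 + 0 * φ δ + (φ a + 2 * φ b - φ a ^ 2) * φ δ ^ 2) =
      1 + (2 * φ a) * φ δ + (φ a + 4 * φ b) * φ δ ^ 2 := by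
    rw [e6, trunc_mul hd]; ring
  rw [e9, e2, trunc_mul hd]
  linear_combination -e10

end Expansion

/-! ### Sums over roots of unity in a commutative ring. -/

section RootsOfUnity

variable {S : Type*} [CommRing S]

/-- Without assuming a domain, the unit differences make the linear factors coprime; their product
divides `X ^ n - 1`, and both are monic of degree `n`. -/
theorem prod_X_sub_C_pow {z : S} {n : ℕ} (hn : 0 < n) (hz : z ^ n = 1)
    (hu : ∀ e, 0 < e → e < n → IsUnit (1 - z ^ e)) :
    ∏ e ∈ Finset.range n, (X - C (z ^ e)) = (X ^ n - 1 : S[X]) := by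
  have hzu : IsUnit z := IsUnit.of_pow_eq_one hz hn.ne'
  nontriviality S
  have hlt : ∀ i j, i < j → j < n → IsCoprime (X - C (z ^ i)) (X - C (z ^ j)) := fun i j hij hj => by
    refine isCoprime_X_sub_C_of_isUnit_sub ?_
    have : z ^ i - z ^ j = z ^ i * (1 - z ^ (j - i)) := by
      rw [mul_sub, ← pow_add, Nat.add_sub_cancel' hij.le, mul_one]
    rw [this]
    exact (hzu.pow i).mul (hu _ (by omega) (by omega))
  have hdvd : ∏ e ∈ Finset.range n, (X - C (z ^ e)) ∣ (X ^ n - 1 : S[X]) := by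
    refine Finset.prod_dvd_of_coprime ?_ ?_
    · intro i hi j hj hij
      have hi := Finset.mem_range.mp hi
      have hj := Finset.mem_range.mp hj
      rcases lt_or_gt_of_ne hij with h | h
      · exact hlt i j h hj
      · exact (hlt j i h hi).symm
    · intro e _
      rw [dvd_iff_isRoot, IsRoot.def]
      simp [← pow_mul, mul_comm e n, pow_mul z n e, hz]
  have hm : (∏ e ∈ Finset.range n, (X - C (z ^ e))).Monic :=
    monic_prod_of_monic _ _ fun _ _ => monic_X_sub_C _
  have hm2 : (X ^ n - 1 : S[X]).Monic := by simpa using monic_X_pow_sub_C (1 : S) hn.ne'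
  refine (eq_of_monic_of_dvd_of_natDegree_le hm hm2 hdvd ?_).symm
  rw [natDegree_prod_of_monic _ _ fun _ _ => monic_X_sub_C _]
  simp only [natDegree_X_sub_C, Finset.sum_const, Finset.card_range, smul_eq_mul, mul_one]
  have := natDegree_X_pow_sub_C (n := n) (r := (1 : S))
  rw [C_1] at this
  exact this.le

theorem prod_X_sub_C_pow_succ {z : S} {m : ℕ} (hz : z ^ (m + 1) = 1)
    (hu : ∀ e, 0 < e → e < m + 1 → IsUnit (1 - z ^ e)) :
    ∏ e ∈ Finset.range m, (X - C (z ^ (e + 1))) = ∑ i ∈ Finset.range (m + 1), (X ^ i : S[X]) := by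
  have h1 := prod_X_sub_C_pow m.succ_pos hz hu
  rw [Finset.prod_range_succ', pow_zero, C_1, ← geom_sum_mul] at h1
  have hm : (X - 1 : S[X]).Monic := by simpa using monic_X_sub_C (1 : S)
  exact hm.isRegular.right h1

theorem sum_choose_one (n : ℕ) : 2 * ∑ i ∈ Finset.range n, (i.choose 1 : S) = n * (n - 1) := by
  induction n with
  | zero => simp
  | succ n ih =>
    rw [Finset.sum_range_succ, mul_add, ih]
    push_cast [Nat.choose_one_right]
    ring

theorem two_mul_choose_two (n : ℕ) : 2 * (n.choose 2 : S) = n * (n - 1) := by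
  induction n with
  | zero => simp
  | succ n ih =>
    rw [Nat.choose_succ_succ' n 1, Nat.cast_add, mul_add, ih]
    push_cast [Nat.choose_one_right]
    ring

theorem sum_choose_two (n : ℕ) :
    6 * ∑ i ∈ Finset.range n, (i.choose 2 : S) = n * (n - 1) * (n - 2) := by
  induction n with
  | zero => simp
  | succ n ih =>
    rw [Finset.sum_range_succ, mul_add, ih]
    have := two_mul_choose_two (S := S) n
    push_cast
    linear_combination 3 * this

/-- Put `1 + X` for `X` in `∏ (X - z ^ e) = 1 + X + ⋯ + X ^ (n - 1)`. The coefficients up to `X ^ 2`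
give the first two elementary symmetric functions of the numbers `1 / (1 - z ^ e)`. -/
theorem sum_div_one_sub_sq {z : S} {n : ℕ} (hz : z ^ n = 1) (hn : IsUnit (n : S)) (w : ℕ → S)
    (hw : ∀ e, 0 < e → e < n → (1 - z ^ e) * w e = 1) :
    12 * ∑ e ∈ Finset.range (n - 1), z ^ (e + 1) * w (e + 1) ^ 2 = 1 - (n : S) ^ 2 := by
  rcases n with _ | m
  · rw [Nat.cast_zero] at hn
    have := isUnit_zero_iff.mp hn
    exact eq_of_zero_eq_one this _ _
  rw [Nat.add_sub_cancel]
  have h1 := prod_X_sub_C_pow_succ hz fun e h h' => IsUnit.of_mul_eq_one _ (hw e h h')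
  have h2 := congrArg (fun p : S[X] => p.comp (1 + X)) h1
  simp only [prod_comp, Polynomial.sum_comp, sub_comp, X_comp, C_comp, pow_comp] at h2
  obtain ⟨a, b, P, h3, h4⟩ := prod_one_add_expand (Finset.range m) fun e => w (e + 1)
  have h5 : ∏ e ∈ Finset.range m, (1 + X - C (z ^ (e + 1))) =
      C (∏ e ∈ Finset.range m, (1 - z ^ (e + 1))) *
        (1 + C a * X + C b * X ^ 2 + X ^ 3 * P) := by
    rw [← h3, map_prod, ← Finset.prod_mul_distrib]
    refine Finset.prod_congr rfl fun e he => ?_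
    have := congrArg (C : S → S[X]) (hw (e + 1) (by omega)
      (by have := Finset.mem_range.mp he; omega))
    simp only [C_mul, C_sub, C_1] at this ⊢
    linear_combination (-X) * this
  rw [h5] at h2
  set D := ∏ e ∈ Finset.range m, (1 - z ^ (e + 1))
  have hX3 : ∀ k < 3, (X ^ 3 * P).coeff k = 0 := fun k hk => by
    rw [coeff_X_pow_mul', if_neg (by omega)]
  have c0 := congrArg (fun p : S[X] => p.coeff 0) h2
  have c1 := congrArg (fun p : S[X] => p.coeff 1) h2
  have c2 := congrArg (fun p : S[X] => p.coeff 2) h2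
  simp only [finsetSum_coeff, coeff_one_add_X_pow, coeff_C_mul, coeff_add, coeff_one, coeff_X,
    coeff_X_pow, hX3 0 (by norm_num), hX3 1 (by norm_num), hX3 2 (by norm_num)] at c0 c1 c2
  norm_num at c0 c1 c2
  have s1 := sum_choose_one (S := S) (m + 1)
  have s2 := sum_choose_two (S := S) (m + 1)
  simp only [Nat.choose_one_right] at s1
  rw [← c1] at s1
  rw [← c2] at s2
  push_cast at s1 s2 hn ⊢
  rw [c0] at s1 s2
  -- Since `D = n = m + 1` is a unit, `a = (n - 1) / 2` and `b = (n - 1) (n - 2) / 6`, written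
  -- without denominators.
  have t1 : 2 * a = m := hn.mul_left_cancel (by linear_combination s1)
  have t2 : 6 * b = m * (m - 1) := hn.mul_left_cancel (by linear_combination s2)
  have h6 : ∑ e ∈ Finset.range m, z ^ (e + 1) * w (e + 1) ^ 2 = - (a + 2 * b - a ^ 2) := by
    rw [h4, ← Finset.sum_neg_distrib]
    refine Finset.sum_congr rfl fun e he => ?_
    have := hw (e + 1) (by omega) (by have := Finset.mem_range.mp he; omega)
    linear_combination (-w (e + 1)) * this
  rw [h6]
  linear_combination (-6 + 3 * (2 * a + m)) * t1 - 4 * t2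

theorem sum_range_two_mul {M : Type*} [AddCommMonoid M] (f : ℕ → M) (m : ℕ) :
    ∑ i ∈ Finset.range (2 * m), f i = ∑ i ∈ Finset.range m, (f (2 * i) + f (2 * i + 1)) := by
  induction m with
  | zero => simp
  | succ m ih => rw [Finset.sum_range_succ, ← ih, mul_add, mul_one, Finset.sum_range_succ,
      Finset.sum_range_succ, add_assoc]

/-- The summand is invariant under `e ↦ n - e`, which exchanges odd and even exponents because `n`
is odd. The even exponents therefore carry half of the full sum. -/
theorem sum_even_div_one_sub_sq {z : S} {n K : ℕ} (hnK : n = 4 * K + 1) (hz : z ^ n = 1)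
    (hn : IsUnit (n : S)) (w : ℕ → S) (hw : ∀ e, 0 < e → e < n → (1 - z ^ e) * w e = 1) :
    24 * (∑ i ∈ Finset.range K, z ^ (4 * i + 2) * w (4 * i + 2) ^ 2 +
      ∑ i ∈ Finset.range K, z ^ (4 * i + 4) * w (4 * i + 4) ^ 2) = 1 - (n : S) ^ 2 := by
  rw [← sum_div_one_sub_sq hz hn w hw, show n - 1 = 2 * (2 * K) by omega, sum_range_two_mul,
    Finset.sum_add_distrib]
  have hrefl : ∀ e, 0 < e → e < n → z ^ (n - e) * w (n - e) ^ 2 = z ^ e * w e ^ 2 := by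
    intro e h0 h1
    have h2 := hw e h0 h1
    have h3 := hw (n - e) (by omega) (by omega)
    have h4 : z ^ e * z ^ (n - e) = 1 := by rw [← pow_add, Nat.add_sub_cancel' h1.le, hz]
    have h5 : w (n - e) = - z ^ e * w e := by
      linear_combination (-w (n - e)) * h2 - w e * z ^ e * h3 - w e * w (n - e) * h4
    rw [h5]
    linear_combination (z ^ e * w e ^ 2) * h4
  have h1 : ∑ i ∈ Finset.range (2 * K), z ^ (2 * i + 1) * w (2 * i + 1) ^ 2 =
      ∑ i ∈ Finset.range (2 * K), z ^ (2 * i + 1 + 1) * w (2 * i + 1 + 1) ^ 2 := by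
    rw [← Finset.sum_range_reflect]
    refine Finset.sum_congr rfl fun i hi => ?_
    have hi := Finset.mem_range.mp hi
    rw [← hrefl (2 * i + 1 + 1) (by omega) (by omega),
      show n - (2 * i + 1 + 1) = 2 * (2 * K - 1 - i) + 1 by omega]
  rw [h1, sum_range_two_mul (fun i => z ^ (2 * i + 1 + 1) * w (2 * i + 1 + 1) ^ 2),
    Finset.sum_add_distrib]
  have e1 : ∀ i, 2 * (2 * i) + 1 + 1 = 4 * i + 2 := fun i => by ring
  have e2 : ∀ i, 2 * (2 * i + 1) + 1 + 1 = 4 * i + 4 := fun i => by ring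
  simp only [e1, e2]
  ring

end RootsOfUnity

/-! ### The prefactor modulo the third power of `1 - q ^ n`. -/

section Prefactor

variable {F : Type*} [Field F] {Γ₀ : Type*} [LinearOrderedCommGroupWithZero Γ₀]
variable {v : Valuation F Γ₀} {q : F} {n K : ℕ}

/-- In reverse order the exponents `3 + 4j` become `n - (4i + 2)`, which exhibits the product as a
perturbation by `q ^ n t` of `∏ (1 - q ^ (-(4i + 2)))`. -/
theorem qShifted_cube_eq_prod (hq : q ≠ 0) (hn : n = 4 * K + 1) (t : F) :
    qShifted (q ^ 3 * t) (q ^ 4) K =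
      ∏ i ∈ Finset.range K, (1 - q ^ n * t * q⁻¹ ^ (4 * i + 2)) := by
  rw [qShifted, ← Finset.prod_range_reflect]
  refine Finset.prod_congr rfl fun i hi => ?_
  have hi := Finset.mem_range.mp hi
  obtain ⟨s, rfl⟩ := Nat.exists_eq_add_of_le (show i + 1 ≤ K by omega)
  rw [show i + 1 + s - 1 - i = s by omega, hn, inv_pow]
  congr 1
  field_simp
  ring

/-- In reverse order the exponents are `n - (4i + 4)`. Extracting a monomial leaves `(q ^ 4; q ^
4)_K` perturbed by `q ^ (-n)`, which has the same expansion coefficients as the denominators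
perturbed by `q ^ n`. -/
theorem qShifted_self_eq_prod (hq : q ≠ 0) (hn : n = 4 * K + 1) :
    qShifted q (q ^ 4) K = (∏ i ∈ Finset.range K, (-q⁻¹ ^ (4 * i + 4))) * (q ^ n) ^ K *
      ∏ i ∈ Finset.range K, (1 - q⁻¹ ^ n * q ^ (4 * i + 4)) := by
  have h1 : (q ^ n) ^ K = ∏ i ∈ Finset.range K, q ^ n := by simp
  rw [qShifted, ← Finset.prod_range_reflect, h1, ← Finset.prod_mul_distrib,
    ← Finset.prod_mul_distrib]
  refine Finset.prod_congr rfl fun i hi => ?_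
  have hi := Finset.mem_range.mp hi
  obtain ⟨s, rfl⟩ := Nat.exists_eq_add_of_le (show i + 1 ≤ K by omega)
  rw [show i + 1 + s - 1 - i = s by omega, hn, inv_pow, inv_pow]
  field_simp
  ring

/-- The signs cancel, and the exponents satisfy `∑ (8i + 6) = 4K² + 2K`, which exceeds `n K = 4K² +
K` by `K`. -/
theorem prod_neg_inv_pow (hq : q ≠ 0) (hn : n = 4 * K + 1) :
    (∏ i ∈ Finset.range K, (-q⁻¹ ^ (4 * i + 4))) * (∏ i ∈ Finset.range K, (-q⁻¹ ^ (4 * i + 2))) *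
      (q ^ n) ^ K = q⁻¹ ^ K := by
  have h1 : ∀ m : ℕ, (∏ i ∈ Finset.range m, (-q⁻¹ ^ (4 * i + 4))) *
      (∏ i ∈ Finset.range m, (-q⁻¹ ^ (4 * i + 2))) * q ^ (4 * m * m + 2 * m) = 1 := by
    intro m
    induction m with
    | zero => simp
    | succ m ih =>
      rw [Finset.prod_range_succ, Finset.prod_range_succ]
      have h2 : q⁻¹ ^ (8 * m + 6) * q ^ (8 * m + 6) = 1 := by
        rw [← mul_pow, inv_mul_cancel₀ hq, one_pow]
      linear_combination h2 * (∏ i ∈ Finset.range m, (-q⁻¹ ^ (4 * i + 4))) *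
        (∏ i ∈ Finset.range m, (-q⁻¹ ^ (4 * i + 2))) * q ^ (4 * m * m + 2 * m) + ih
  have h2 : q⁻¹ ^ K * q ^ K = 1 := by rw [← mul_pow, inv_mul_cancel₀ hq, one_pow]
  have hqK : q ^ K ≠ 0 := pow_ne_zero _ hq
  rw [hn]
  apply mul_right_cancel₀ hqK
  rw [h2, ← h1 K]
  ring

theorem prod_one_sub_inv_pow (hq : q ≠ 0) :
    ∏ i ∈ Finset.range K, (1 - q⁻¹ ^ (4 * i + 2)) =
      (∏ i ∈ Finset.range K, (-q⁻¹ ^ (4 * i + 2))) * qShifted (q ^ 2) (q ^ 4) K := by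
  rw [qShifted, ← Finset.prod_mul_distrib]
  refine Finset.prod_congr rfl fun i _ => ?_
  rw [inv_pow]
  field_simp
  ring

theorem sum_Icc_eq_sum_range {M : Type*} [AddCommMonoid M] (f : ℕ → M) (K : ℕ) :
    ∑ k ∈ Finset.Icc 1 K, f k = ∑ i ∈ Finset.range K, f (i + 1) := by
  induction K with
  | zero => simp
  | succ K ih => rw [Finset.sum_Icc_succ_top (by omega), ih, Finset.sum_range_succ]

theorem symPrefactor_congr (h : HasOrderAt v q n) (hn : n = 4 * K + 1) (hK : 0 < K) :
    v (symPrefactor q (q ^ (-(n : ℤ))) K 1 1 1 -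
      qShifted (q ^ 2) (q ^ 4) K * (qShifted (q ^ 4) (q ^ 4) K)⁻¹ * q⁻¹ ^ K *
        (1 + (1 - q ^ n) ^ 2 * (((n : F) ^ 2 - 1) / 24 +
          ∑ k ∈ Finset.Icc 1 K, q ^ (4 * k - 2) * (1 - q ^ (4 * k - 2))⁻¹ ^ 2))) ≤
      v (1 - q ^ n) ^ 3 := by
  have hq := h.ne_zero
  obtain ⟨qR, hqR⟩ : ∃ qR : v.integer, (qR : F) = q := ⟨⟨q, h.mem_integer⟩, rfl⟩
  obtain ⟨qI, hqI⟩ : ∃ qI : v.integer, (qI : F) = q⁻¹ :=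
    ⟨⟨q⁻¹, by rw [Valuation.mem_integer_iff, map_inv₀, h.map_base, inv_one]⟩, rfl⟩
  have hqq : qR * qI = 1 := by ext; push_cast; rw [hqR, hqI, mul_inv_cancel₀ hq]
  have hunit : ∀ e : ℕ, 0 < e → e < n → v (1 - q ^ e) = 1 := fun e h0 h1 => by
    have := h.map_one_sub_zpow e (fun hd => by have := Int.le_of_dvd (by exact_mod_cast h0) hd; omega)
    rwa [zpow_natCast] at this
  -- A total choice of inverses in the valuation ring; the value 0 outside `0 < e < n` is only a
  -- default.
  have hinv : ∀ e : ℕ, ∃ w : v.integer, 0 < e → e < n → (w : F) = (1 - q ^ e)⁻¹ := by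
    intro e
    by_cases he : 0 < e ∧ e < n
    · exact ⟨⟨(1 - q ^ e)⁻¹, by
        rw [Valuation.mem_integer_iff, map_inv₀, hunit e he.1 he.2, inv_one]⟩, fun _ _ => rfl⟩
    · exact ⟨0, fun h0 h1 => absurd ⟨h0, h1⟩ he⟩
  choose w hwF using hinv
  have hw : ∀ e, 0 < e → e < n → (1 - qR ^ e) * w e = 1 := fun e h0 h1 => by
    ext
    push_cast
    rw [hqR, hwF e h0 h1, mul_inv_cancel₀ (ne_zero_of_map_eq_one (hunit e h0 h1))]
  set δ : v.integer := qR ^ n - 1 with hδ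
  set ε : v.integer := qI ^ n - 1 with hε
  have hδF : 1 + (δ : F) = q ^ n := by rw [hδ]; push_cast; rw [hqR]; ring
  have hεF : 1 + (ε : F) = q⁻¹ ^ n := by rw [hε]; push_cast; rw [hqI]; ring
  have hδε : (1 + ε) * (1 + δ) = 1 := by
    rw [hδ, hε, add_sub_cancel, add_sub_cancel, ← mul_pow, mul_comm, hqq, one_pow]
  obtain ⟨a, b, P, hP, hL⟩ := prod_sub_expand (Finset.range K) (fun i => qR ^ (4 * i + 4))
    (fun i => w (4 * i + 4)) fun i hi =>
      hw _ (by omega) (by have := Finset.mem_range.mp hi; omega)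
  obtain ⟨p, r, T, hT, -⟩ := prod_sub_expand (Finset.range K) (fun i => qI ^ (4 * i + 2))
    (fun i => - qR ^ (4 * i + 2) * w (4 * i + 2)) fun i hi => by
      have h1 := hw (4 * i + 2) (by omega) (by have := Finset.mem_range.mp hi; omega)
      have h2 : qR ^ (4 * i + 2) * qI ^ (4 * i + 2) = 1 := by rw [← mul_pow, hqq, one_pow]
      linear_combination h1 + w (4 * i + 2) * h2
  -- `δ₂` and `δ₃` are `(1 + δ) ^ 2 - 1` and `(1 + δ) ^ 3 - 1`, that is `q ^ (2n) - 1` and `q ^ (3n)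
  -- - 1`.
  obtain ⟨ρ, hρ⟩ := cube_dvd_expansion (δ₂ := 2 * δ + δ ^ 2) (δ₃ := 3 * δ + 3 * δ ^ 2 + δ ^ 3)
    (r₁ := P.eval δ) (r₂ := P.eval ε) (r₃ := T.eval δ) (r₄ := T.eval (2 * δ + δ ^ 2))
    (r₅ := T.eval (3 * δ + 3 * δ ^ 2 + δ ^ 3)) (a := a) (b := b) (p := p) (r := r)
    hδε rfl rfl rfl rfl rfl rfl rfl
  have hH := hP δ
  have hH' := hP ε
  have hW₁ := hT δ
  have hW₂ := hT (2 * δ + δ ^ 2)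
  have hW₃ := hT (3 * δ + 3 * δ ^ 2 + δ ^ 3)
  generalize 1 + a * δ + b * δ ^ 2 + δ ^ 3 * P.eval δ = H at *
  generalize 1 + a * ε + b * ε ^ 2 + ε ^ 3 * P.eval ε = H' at *
  generalize 1 + p * δ + r * δ ^ 2 + δ ^ 3 * T.eval δ = W₁ at *
  generalize 1 + p * (2 * δ + δ ^ 2) + r * (2 * δ + δ ^ 2) ^ 2 +
    (2 * δ + δ ^ 2) ^ 3 * T.eval (2 * δ + δ ^ 2) = W₂ at *
  generalize 1 + p * (3 * δ + 3 * δ ^ 2 + δ ^ 3) + r * (3 * δ + 3 * δ ^ 2 + δ ^ 3) ^ 2 +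
    (3 * δ + 3 * δ ^ 2 + δ ^ 3) ^ 3 * T.eval (3 * δ + 3 * δ ^ 2 + δ ^ 3) = W₃ at *
  -- the sum over the residues
  have hSum : δ ∣ 24 * (∑ i ∈ Finset.range K, qR ^ (4 * i + 2) * w (4 * i + 2) ^ 2 +
      ∑ i ∈ Finset.range K, qR ^ (4 * i + 4) * w (4 * i + 4) ^ 2) - (1 - (n : v.integer) ^ 2) := by
    rw [← Ideal.mem_span_singleton, ← Ideal.Quotient.eq_zero_iff_mem]
    have hz : (Ideal.Quotient.mk (Ideal.span {δ}) qR) ^ n = 1 := by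
      rw [← sub_eq_zero, ← map_pow, ← map_one (Ideal.Quotient.mk (Ideal.span {δ})), ← map_sub,
        Ideal.Quotient.eq_zero_iff_mem]
      exact Ideal.mem_span_singleton_self _
    have hnu : IsUnit (n : v.integer) := by
      refine IsUnit.of_mul_eq_one (⟨(n : F)⁻¹, by
        rw [Valuation.mem_integer_iff, map_inv₀, h.map_natCast n (by omega), inv_one]⟩) ?_
      ext
      push_cast
      exact mul_inv_cancel₀ (ne_zero_of_map_eq_one (h.map_natCast n (by omega)))
    have := sum_even_div_one_sub_sq hn hz
      (by simpa using hnu.map (Ideal.Quotient.mk (Ideal.span {δ})))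
      (fun e => Ideal.Quotient.mk (Ideal.span {δ}) (w e)) fun e h0 h1 => by
        rw [← map_pow, ← map_one (Ideal.Quotient.mk (Ideal.span {δ})), ← map_sub, ← map_mul,
          hw e h0 h1]
    simp only [map_sub, map_mul, map_add, map_sum, map_pow, map_one, map_natCast, map_ofNat]
    rw [this, sub_self]
  obtain ⟨σ, hσ⟩ := hSum
  -- transfer to the field
  have cF := fun {x y : v.integer} (hxy : x = y) => congrArg (Subtype.val : v.integer → F) hxy
  have fH := cF hH
  have fH' := cF hH'
  have fW₁ := cF hW₁
  have fW₂ := cF hW₂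
  have fW₃ := cF hW₃
  have fρ := cF hρ
  have fσ := cF hσ
  have fL := cF hL
  push_cast at fH fH' fW₁ fW₂ fW₃ fρ fσ fL
  have n2 : ((2 : v.integer) : F) = 2 := rfl
  have n3 : ((3 : v.integer) : F) = 3 := rfl
  have n24 : ((24 : v.integer) : F) = 24 := rfl
  simp only [n2, n3, n24] at fW₂ fW₃ fρ fσ fL
  have g2 : 1 + (2 * (δ : F) + (δ : F) ^ 2) = q ^ n * q ^ n := by rw [← hδF]; ring
  have g3 : 1 + (3 * (δ : F) + 3 * (δ : F) ^ 2 + (δ : F) ^ 3) = q ^ n * (q ^ n * q ^ n) := by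
    rw [← hδF]; ring
  rw [g2] at fW₂
  rw [g3] at fW₃
  rw [hδF] at fH fW₁
  rw [hεF] at fH'
  simp only [hqR, hqI] at fH fH' fW₁ fW₂ fW₃ fσ fL
  have hw0 := prod_one_sub_inv_pow (K := K) hq
  have hEE := prod_neg_inv_pow (K := K) hq hn
  have hA := qShifted_self_eq_prod hq hn
  have hxinv : (q ^ (-(n : ℤ)))⁻¹ = q ^ n := by rw [zpow_neg, inv_inv, zpow_natCast]
  have hC : qShifted (q ^ 4) (q ^ 4) K = ∏ i ∈ Finset.range K, (1 - q ^ (4 * i + 4)) := by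
    rw [qShifted]; exact Finset.prod_congr rfl fun i _ => by ring
  have hC2 : qShifted (q ^ 4 * q ^ n) (q ^ 4) K =
      ∏ i ∈ Finset.range K, (1 - q ^ n * q ^ (4 * i + 4)) := by
    rw [qShifted]; exact Finset.prod_congr rfl fun i _ => by ring
  have hB1 := qShifted_cube_eq_prod hq hn 1
  have hB2 := qShifted_cube_eq_prod hq hn (q ^ n)
  have hB3 := qShifted_cube_eq_prod hq hn (q ^ n * q ^ n)
  have hh0 : v (qShifted (q ^ 4) (q ^ 4) K) = 1 := h.map_qShifted_base hn le_rfl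
  have hhX : v (qShifted (q ^ 4 * q ^ n) (q ^ 4) K) = 1 := by
    have := h.map_qShifted_den' hn le_rfl false
    rwa [show twoPoint q n false = q ^ (-(n : ℤ)) from rfl, hxinv] at this
  simp only [mul_one] at hB1
  rw [fW₁] at hB1
  rw [fW₂] at hB2
  rw [fW₃] at hB3
  rw [fH', ← hC] at hA
  rw [fH, ← hC] at hC2
  rw [hw0] at hB1 hB2 hB3
  set E := ∏ i ∈ Finset.range K, (-q⁻¹ ^ (4 * i + 4))
  set E₂ := ∏ i ∈ Finset.range K, (-q⁻¹ ^ (4 * i + 2))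
  have hHv : v (H : F) = 1 := by
    rw [hC2, map_mul, hh0, one_mul] at hhX; exact hhX
  have hH0 := ne_zero_of_map_eq_one hHv
  have hh00 := ne_zero_of_map_eq_one hh0
  have hsym : symPrefactor q (q ^ (-(n : ℤ))) K 1 1 1 =
      qShifted (q ^ 2) (q ^ 4) K * (qShifted (q ^ 4) (q ^ 4) K)⁻¹ * q⁻¹ ^ K *
        ((H' * (3 * W₁ * H ^ 2 - 3 * W₂ * H + W₃) : F) / (H : F) ^ 2) := by
    have e1 : symPrefactor q (q ^ (-(n : ℤ))) K 1 1 1 = 3 * watsonPrefactor q K 1 1 -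
        3 * watsonPrefactor q K (q ^ (-(n : ℤ))) 1 +
          watsonPrefactor q K (q ^ (-(n : ℤ))) (q ^ (-(n : ℤ))) := by
      rw [symPrefactor]; ring
    rw [e1]
    simp only [watsonPrefactor, mul_inv, hxinv, inv_one, mul_one]
    rw [hA, hB1, hB2, hB3, hC2, ← hEE]
    generalize qShifted (q ^ 4) (q ^ 4) K = h₀ at *
    field_simp
  have hnat : ∀ m : ℕ, m ≠ 0 → (m : F) ≠ 0 := fun m hm =>
    ne_zero_of_map_eq_one (h.map_natCast m hm)
  have h24 : (24 : F) ≠ 0 := by exact_mod_cast hnat 24 (by norm_num)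
  have hv24 : v (24 : F) = 1 := by exact_mod_cast h.map_natCast 24 (by norm_num)
  have hsum2 : ∑ k ∈ Finset.Icc 1 K, q ^ (4 * k - 2) * (1 - q ^ (4 * k - 2))⁻¹ ^ 2 =
      ∑ i ∈ Finset.range K, q ^ (4 * i + 2) * (w (4 * i + 2) : F) ^ 2 := by
    rw [sum_Icc_eq_sum_range]
    refine Finset.sum_congr rfl fun i hi => ?_
    have := Finset.mem_range.mp hi
    rw [show 4 * (i + 1) - 2 = 4 * i + 2 by omega, hwF _ (by omega) (by omega)]
  rw [hsum2, hsym]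
  set S₂ := ∑ i ∈ Finset.range K, q ^ (4 * i + 2) * (w (4 * i + 2) : F) ^ 2
  have hX : (1 - q ^ n) ^ 2 = (δ : F) ^ 2 := by rw [← hδF]; ring
  have hvδ : v (δ : F) = v (1 - q ^ n) := by rw [← hδF, ← Valuation.map_neg]; congr 1; ring
  -- The second-order coefficient is minus the sum over the exponents `4i + 4`. By `fσ` it equals,
  -- modulo `δ`, the sum over the exponents `4i + 2` plus `(n ^ 2 - 1) / 24`; the error is absorbed
  -- into `δ ^ 3`.
  have hfin : qShifted (q ^ 2) (q ^ 4) K * (qShifted (q ^ 4) (q ^ 4) K)⁻¹ * q⁻¹ ^ K *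
        ((H' * (3 * W₁ * H ^ 2 - 3 * W₂ * H + W₃) : F) / (H : F) ^ 2) -
      qShifted (q ^ 2) (q ^ 4) K * (qShifted (q ^ 4) (q ^ 4) K)⁻¹ * q⁻¹ ^ K *
        (1 + (1 - q ^ n) ^ 2 * (((n : F) ^ 2 - 1) / 24 + S₂)) =
      (qShifted (q ^ 2) (q ^ 4) K * (qShifted (q ^ 4) (q ^ 4) K)⁻¹ * q⁻¹ ^ K) * (δ : F) ^ 3 *
        (ρ * ((H : F) ^ 2)⁻¹ - σ * 24⁻¹) := by
    have e2 : (H' * (3 * W₁ * H ^ 2 - 3 * W₂ * H + W₃) : F) = (δ : F) ^ 3 * ρ +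
        (H : F) ^ 2 * (1 + (δ : F) ^ 2 * (a + 2 * b - a ^ 2)) := by linear_combination fρ
    rw [e2, hX, ← mul_sub]
    rw [mul_assoc (qShifted (q ^ 2) (q ^ 4) K * (qShifted (q ^ 4) (q ^ 4) K)⁻¹ * q⁻¹ ^ K)]
    congr 1
    field_simp
    linear_combination (24 * (δ : F) ^ 2 * (H : F) ^ 2) * fL - (δ : F) ^ 2 * (H : F) ^ 2 * fσ
  rw [hfin]
  have hq2 : v (qShifted (q ^ 2) (q ^ 4) K) ≤ 1 :=
    qShifted_mem (v.integer.pow_mem h.mem_integer 2) (v.integer.pow_mem h.mem_integer 4) K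
  rw [map_mul, map_mul, map_mul, map_mul, map_inv₀, hh0, map_pow, map_pow, map_inv₀, h.map_base,
    inv_one, one_pow, mul_one, mul_one, hvδ]
  have hlast : v ((ρ : F) * ((H : F) ^ 2)⁻¹ - σ * 24⁻¹) ≤ 1 := by
    refine v.map_sub_le ?_ ?_
    · rw [map_mul, map_inv₀, map_pow, hHv, one_pow, inv_one, mul_one]; exact ρ.2
    · rw [map_mul, map_inv₀, hv24, inv_one, mul_one]; exact σ.2
  calc _ ≤ 1 * v (1 - q ^ n) ^ 3 * 1 := by gcongr
    _ = _ := by rw [one_mul, mul_one]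

end Prefactor

/-! ### The congruence at primes where `q` has order exactly `n`. -/

section PrimitiveCase

variable {F : Type*} [Field F]

/-- The summand on the left-hand side of the supercongruence. -/
theorem wpTerm_one_eq {q c d : F} (hq : q ≠ 1) (k : ℕ) :
    qInt q (8 * k + 1) *
          (qShifted q (q ^ 4) k ^ 4 * qShifted (c * q) (q ^ 4) k * qShifted (d * q) (q ^ 4) k) /
          (qShifted (q ^ 4) (q ^ 4) k ^ 4 * qShifted (q ^ 4 / c) (q ^ 4) k *
            qShifted (q ^ 4 / d) (q ^ 4) k) *
          (c * d) ^ (-(k : ℤ)) * q ^ (5 * k) = wpTerm q 1 c d 1 1 1 k := by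
  rw [qInt_eq_div hq, wpTerm]
  simp only [one_mul, mul_one, one_pow, inv_one, div_eq_mul_inv, mul_inv, zpow_neg, zpow_natCast,
    mul_pow, inv_pow]
  ring

theorem phiTerm_one_eq (q c d : F) (k : ℕ) :
    qShifted (q ^ 3 / (c * d)) (q ^ 4) k * qShifted q (q ^ 4) k ^ 3 /
            (qShifted (q ^ 4) (q ^ 4) k * qShifted (q ^ 4 / c) (q ^ 4) k *
              qShifted (q ^ 4 / d) (q ^ 4) k * qShifted (q ^ 2) (q ^ 4) k) *
            q ^ (4 * k) = phiTerm q c d 1 1 1 k := by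
  rw [phiTerm]
  simp only [one_mul, div_eq_mul_inv, mul_inv]
  ring

/-- The right-hand side of the supercongruence, as a function of `K = (n - 1) / 4`. -/
def watsonRHS (q c d : F) (n K : ℕ) : F :=
  qShifted (q ^ 2) (q ^ 4) K / qShifted (q ^ 4) (q ^ 4) K *
    qInt q n * q ^ (-(K : ℤ)) * (1 + qInt q n ^ 2 * qB n q) *
    ∑ k ∈ Finset.range (K + 1), phiTerm q c d 1 1 1 k

theorem qInt_sq_mul_qB {q : F} (hq : ∀ j : ℕ, j ≠ 0 → q ^ j ≠ 1) (n : ℕ) :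
    qInt q n ^ 2 * qB n q = (1 - q ^ n) ^ 2 * (((n : F) ^ 2 - 1) / 24 +
      ∑ k ∈ Finset.Icc 1 ((n - 1) / 4), q ^ (4 * k - 2) * (1 - q ^ (4 * k - 2))⁻¹ ^ 2) := by
  have hq1 : q ≠ 1 := by simpa using hq 1 one_ne_zero
  have h1 : 1 - q ≠ 0 := sub_ne_zero.mpr hq1.symm
  rw [qB, mul_add, mul_add, Finset.mul_sum, Finset.mul_sum]
  congr 1
  · rw [qInt_eq_div hq1]
    field_simp
  · refine Finset.sum_congr rfl fun k hk => ?_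
    have hk := Finset.mem_Icc.mp hk
    have h2 : 1 - q ^ (4 * k - 2) ≠ 0 := sub_ne_zero.mpr (hq _ (by omega)).symm
    rw [qInt_eq_div hq1, qInt_eq_div hq1]
    field_simp

variable {Γ₀ : Type*} [LinearOrderedCommGroupWithZero Γ₀]
variable {v : Valuation F Γ₀} {q c d : F} {n K : ℕ}

theorem map_phiTerm_le (h : HasOrderAt v q n) (hc : IsGenericAt v q c) (hd : IsGenericAt v q d)
    (hn : n = 4 * K + 1) {k : ℕ} (hk : k ≤ K) : v (phiTerm q c d 1 1 1 k) ≤ 1 := by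
  refine phiTerm_mem (invClosed_integer v) h.mem_integer (le_of_eq hc.map_self)
    (le_of_eq hd.map_self) v.integer.one_mem v.integer.one_mem v.integer.one_mem hc.map_self
    hd.map_self ?_ ?_
  · rw [map_mul, hc.map_self, hd.map_self, one_mul]
  · have := h.map_qShifted_mid hn hk true true true
    simp only [twoPoint, cond_true] at this
    rw [map_mul, map_mul, map_mul, h.map_qShifted_base hn hk, hc.map_qShifted_den' h,
      hd.map_qShifted_den' h, this, one_mul, one_mul, one_mul]

/-- The prefactor is known only modulo the third power, but it is multiplied by `1 - q ^ n` and by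
an integral sum. -/
theorem sum_wpTerm_congr_watsonRHS [CharZero F] (h : HasOrderAt v q n) (hc : IsGenericAt v q c)
    (hd : IsGenericAt v q d) (hn : n = 4 * K + 1) (hK : 0 < K) :
    v (∑ k ∈ Finset.range (K + 1), wpTerm q 1 c d 1 1 1 k - watsonRHS q c d n K) ≤
      v (1 - q ^ n) ^ 4 := by
  have h1 := sum_wpTerm_congr h hc hd hn hK
  have h2 := symPrefactor_congr h hn hK
  have hq1 : q ≠ 1 := by simpa using h.pow_ne_one 1 one_ne_zero
  have hB := qInt_sq_mul_qB h.pow_ne_one n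
  rw [show (n - 1) / 4 = K by omega] at hB
  rw [← hB] at h2
  set S := ∑ k ∈ Finset.range (K + 1), phiTerm q c d 1 1 1 k with hS
  have hSv : v S ≤ 1 := v.map_sum_le fun k hk =>
    map_phiTerm_le h hc hd hn (Nat.lt_succ_iff.mp (Finset.mem_range.mp hk))
  have hR : watsonRHS q c d n K = (1 - q ^ n) * (1 - q)⁻¹ * ((qShifted (q ^ 2) (q ^ 4) K *
      (qShifted (q ^ 4) (q ^ 4) K)⁻¹ * q⁻¹ ^ K * (1 + qInt q n ^ 2 * qB n q)) * S) := by
    rw [watsonRHS, ← hS, zpow_neg, zpow_natCast, inv_pow]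
    generalize 1 + qInt q n ^ 2 * qB n q = Y
    rw [qInt_eq_div hq1]
    simp only [div_eq_mul_inv]
    ring
  set P := qShifted (q ^ 2) (q ^ 4) K * (qShifted (q ^ 4) (q ^ 4) K)⁻¹ * q⁻¹ ^ K *
    (1 + qInt q n ^ 2 * qB n q) with hP
  set G := symPrefactor q (q ^ (-(n : ℤ))) K 1 1 1
  have e : ∑ k ∈ Finset.range (K + 1), wpTerm q 1 c d 1 1 1 k - watsonRHS q c d n K =
      (∑ k ∈ Finset.range (K + 1), wpTerm q 1 c d 1 1 1 k -
        (1 - q ^ n) * (1 - q)⁻¹ * (G * S)) +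
      (1 - q ^ n) * (1 - q)⁻¹ * (G - P) * S := by
    rw [hR]; ring
  rw [e]
  refine v.map_add_le h1 ?_
  rw [map_mul, map_mul, map_mul, map_inv₀, h.map_one_sub_self (by omega), inv_one, mul_one]
  calc v (1 - q ^ n) * v (G - P) * v S ≤ v (1 - q ^ n) * v (1 - q ^ n) ^ 3 * 1 := by gcongr
    _ = v (1 - q ^ n) ^ 4 := by rw [mul_one, ← pow_succ']

/-- Terms of the left-hand side beyond `K` vanish modulo the fourth power of `1 - q ^ n`. -/
theorem map_wpTerm_le (h : HasOrderAt v q n) (hc : IsGenericAt v q c)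
    (hd : IsGenericAt v q d) (hn : n = 4 * K + 1) (hK : 0 < K) {k : ℕ} (hk : K < k) (hkn : k < n) :
    v (wpTerm q 1 c d 1 1 1 k) ≤ v (1 - q ^ n) ^ 4 := by
  have hqm := h.mem_integer
  have hQ := v.integer.pow_mem hqm 4
  have h4 : v (qShifted (q ^ 4) (q ^ 4) k) = 1 := by
    refine h.map_qShifted 4 (by norm_cast) fun j hj hdv => ?_
    have h5 : (n : ℤ) ∣ 4 * ((j + 1 : ℕ) : ℤ) := by convert hdv using 1; push_cast; ring
    have h6 : n ∣ 4 * (j + 1) := by exact_mod_cast h5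
    have h7 : Nat.Coprime n 4 := by
      rw [hn, Nat.coprime_mul_left_add_left]; exact Nat.coprime_one_left 4
    have := Nat.le_of_dvd (by omega) (h7.dvd_of_dvd_mul_left h6)
    omega
  -- The factor of index `K` is `1 - q ^ n`; the four copies of this factorial yield the fourth
  -- power.
  have h1 : v (qShifted q (q ^ 4) k) ≤ v (1 - q ^ n) := by
    obtain ⟨s, rfl⟩ := Nat.exists_eq_add_of_le (show K + 1 ≤ k from hk)
    rw [qShifted_add, qShifted_succ, ← pow_mul, ← pow_succ', ← hn, map_mul, map_mul]
    have a1 : v (qShifted q (q ^ 4) K) ≤ 1 := qShifted_mem hqm hQ K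
    have a2 : v (qShifted (q * (q ^ 4) ^ (K + 1)) (q ^ 4) s) ≤ 1 :=
      qShifted_mem (v.integer.mul_mem hqm (v.integer.pow_mem hQ _)) hQ s
    calc _ ≤ 1 * v (1 - q ^ n) * 1 := by gcongr
      _ = _ := by rw [one_mul, mul_one]
  have hcq : v (qShifted (c * q) (q ^ 4) k) ≤ 1 :=
    qShifted_mem (v.integer.mul_mem (le_of_eq hc.map_self) hqm) hQ k
  have hdq : v (qShifted (d * q) (q ^ 4) k) ≤ 1 :=
    qShifted_mem (v.integer.mul_mem (le_of_eq hd.map_self) hqm) hQ k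
  have h8 : v (1 - q * (q ^ 4) ^ (2 * k)) ≤ 1 :=
    v.integer.sub_mem v.integer.one_mem (v.integer.mul_mem hqm (v.integer.pow_mem hQ _))
  rw [wpTerm]
  simp only [one_mul, mul_one, inv_one, one_pow, map_mul, map_inv₀, map_pow, h4, h.map_base,
    hc.map_self, hd.map_self, hc.map_qShifted_den' h, hd.map_qShifted_den' h,
    h.map_one_sub_self (show 1 < n by omega)]
  calc _ ≤ 1 * (v (1 - q ^ n) * 1 * 1 * v (1 - q ^ n) * v (1 - q ^ n) * v (1 - q ^ n)) := by gcongr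
    _ = _ := by simp only [one_mul, mul_one, pow_succ, pow_zero]

theorem sum_wpTerm_congr_watsonRHS' [CharZero F] (h : HasOrderAt v q n) (hc : IsGenericAt v q c)
    (hd : IsGenericAt v q d) (hn : n = 4 * K + 1) (hK : 0 < K) {M : ℕ} (hM : M = K ∨ M = n - 1) :
    v (∑ k ∈ Finset.range (M + 1), wpTerm q 1 c d 1 1 1 k - watsonRHS q c d n K) ≤
      v (1 - q ^ n) ^ 4 := by
  have h1 := sum_wpTerm_congr_watsonRHS h hc hd hn hK
  rcases hM with rfl | rfl
  · exact h1
  · obtain ⟨s, hs⟩ := Nat.exists_eq_add_of_le (show K + 1 ≤ n - 1 + 1 by omega)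
    rw [hs, Finset.sum_range_add, add_sub_right_comm]
    refine v.map_add_le h1 (v.map_sum_le fun i hi => ?_)
    have := Finset.mem_range.mp hi
    exact map_wpTerm_le h hc hd hn hK (by omega) (by omega)

end PrimitiveCase

/-! ### Zeros of `q`-shifted factorials counted by blocks of length `m`. -/

section BlockValuations

variable {F : Type*} [Field F] {Γ₀ : Type*} [LinearOrderedCommGroupWithZero Γ₀]
variable {v : Valuation F Γ₀} {q c d : F} {m : ℕ}

/-- The quotient `1 + q ^ m + ⋯ + q ^ (m (j - 1))` is congruent to `j`, a unit because the residue
characteristic is zero. -/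
theorem HasOrderAt.map_one_sub_pow_mul (h : HasOrderAt v q m) {j : ℕ} (hj : j ≠ 0) :
    v (1 - q ^ (m * j)) = v (1 - q ^ m) := by
  have h1 : 1 - q ^ (m * j) = (∑ i ∈ Finset.range j, (q ^ m) ^ i) * (1 - q ^ m) := by
    rw [geom_sum_mul_neg, pow_mul]
  have h2 : v (∑ i ∈ Finset.range j, (q ^ m) ^ i) = 1 := by
    have h3 : v (∑ i ∈ Finset.range j, (q ^ m) ^ i - (j : F)) < 1 := by
      have : ∑ i ∈ Finset.range j, (q ^ m) ^ i - (j : F) =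
          ∑ i ∈ Finset.range j, ((q ^ m) ^ i - 1) := by simp
      rw [this]
      refine v.map_sum_lt one_ne_zero fun i _ => ?_
      rw [← geom_sum_mul, map_mul]
      have h4 : v (∑ i ∈ Finset.range i, (q ^ m) ^ i) ≤ 1 :=
        v.integer.sum_mem fun _ _ => v.integer.pow_mem (v.integer.pow_mem h.mem_integer _) _
      have h5 : v (q ^ m - 1) < 1 := by rw [Valuation.map_sub_swap]; exact h.map_one_sub_pow_lt
      exact (mul_le_of_le_one_left' h4).trans_lt h5
    have h6 := h.map_natCast j hj
    have h7 := v.map_add_eq_of_lt_right (x := ∑ i ∈ Finset.range j, (q ^ m) ^ i - (j : F))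
      (y := (j : F)) (by rw [h6]; exact h3)
    rwa [sub_add_cancel, h6] at h7
  rw [h1, map_mul, h2, one_mul]

/-- `r < m` is the residue class of the indices `j` with `m ∣ s + 4 j`. -/
theorem HasOrderAt.map_qShifted_block (h : HasOrderAt v q m) (hm : Odd m) {s r : ℕ} (hs : 0 < s)
    (hr : r < m) (hsr : m ∣ s + 4 * r) (a b : ℕ) (hb : b ≤ m) :
    v (qShifted (q ^ s) (q ^ 4) (m * a + b)) =
      v (1 - q ^ m) ^ (a + if r < b then 1 else 0) := by
  have h4 : Nat.Coprime m 4 := by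
    have : Nat.Coprime m (2 ^ 2) := Nat.Coprime.pow_right 2 (Nat.coprime_two_right.mpr hm)
    exact this
  have hj : ∀ a j, j < m → v (1 - q ^ s * (q ^ 4) ^ (m * a + j)) =
      if j = r then v (1 - q ^ m) else 1 := by
    intro a j hjm
    rw [← pow_mul, ← pow_add]
    split_ifs with hjr
    · subst hjr
      obtain ⟨e, he⟩ := hsr
      rw [show s + 4 * (m * a + j) = m * (e + 4 * a) by linarith]
      refine h.map_one_sub_pow_mul ?_
      rintro h0
      have : e = 0 := by omega
      subst this
      omega
    · have h5 := h.map_one_sub_zpow ((s + 4 * (m * a + j) : ℕ) : ℤ) (fun hd => hjr ?_)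
      · rwa [zpow_natCast] at h5
      · have hd : m ∣ s + 4 * (m * a + j) := by exact_mod_cast hd
        have hd2 : s + 4 * (m * a + j) ≡ s + 4 * r [MOD m] := by
          rw [Nat.ModEq, Nat.mod_eq_zero_of_dvd hd, Nat.mod_eq_zero_of_dvd hsr]
        have hd3 := Nat.ModEq.cancel_left_of_coprime (c := 4) h4 (Nat.ModEq.add_left_cancel' s hd2)
        have hd4 : j ≡ r [MOD m] := by
          have : m * a + j ≡ j [MOD m] := by simp [Nat.ModEq]
          exact this.symm.trans hd3
        exact Nat.ModEq.eq_of_lt_of_lt hd4 hjm hr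
  have hblock : ∀ a b, b ≤ m → v (∏ j ∈ Finset.range b, (1 - q ^ s * (q ^ 4) ^ (m * a + j))) =
      v (1 - q ^ m) ^ (if r < b then 1 else 0) := by
    intro a b hb
    rw [map_prod, Finset.prod_congr rfl fun j hj' => hj a j (by
      have := Finset.mem_range.mp hj'; omega)]
    rw [Finset.prod_ite_eq']
    simp only [Finset.mem_range]
    split_ifs <;> simp
  have hfull : ∀ a, v (qShifted (q ^ s) (q ^ 4) (m * a)) = v (1 - q ^ m) ^ a := by
    intro a
    induction a with
    | zero => simp [qShifted_zero]
    | succ a ih =>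
      rw [mul_add, mul_one, qShifted, Finset.prod_range_add, map_mul, hblock a m le_rfl, if_pos hr,
        pow_one, pow_succ (v (1 - q ^ m)) a]
      exact congrArg (· * v (1 - q ^ m)) ih
  rw [qShifted, Finset.prod_range_add, map_mul, hblock a b hb, pow_add]
  exact congrArg (· * _) (hfull a)

end BlockValuations

/-! ### The left-hand side at primes where `q` has order `m`. -/

section ImprimitiveCase

variable {F : Type*} [Field F] {Γ₀ : Type*} [LinearOrderedCommGroupWithZero Γ₀]
variable {v : Valuation F Γ₀} {q c d : F} {m t : ℕ}

/-- The factor of `wpTerm q 1 c d 1 1 1` that is a product, with all factors shifted by `σ`. -/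
def shiftProd {A : Type*} [CommRing A] [Inv A] (q σ c d : A) (k : ℕ) : A :=
  qShifted (σ * q) (q ^ 4) k ^ 4 * qShifted (c * (σ * q)) (q ^ 4) k *
      qShifted (d * (σ * q)) (q ^ 4) k *
    (qShifted (σ * q ^ 4) (q ^ 4) k ^ 4 * qShifted (σ * q ^ 4 * c⁻¹) (q ^ 4) k *
      qShifted (σ * q ^ 4 * d⁻¹) (q ^ 4) k)⁻¹ * (q ^ 5 * (c * d)⁻¹) ^ k

/-- The very-well-poised factor that complements `shiftProd`. -/
def shiftTerm {A : Type*} [CommRing A] [Inv A] (q σ c d : A) (k : ℕ) : A :=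
  (1 - σ ^ 2 * q ^ (8 * k + 1)) * (1 - q)⁻¹ * shiftProd q σ c d k

theorem shiftTerm_one (q c d : F) (k : ℕ) : shiftTerm q 1 c d k = wpTerm q 1 c d 1 1 1 k := by
  rw [shiftTerm, shiftProd, wpTerm]
  simp only [one_mul, mul_one, one_pow, inv_one, mul_inv]
  ring

/-- This separates the position of a block from the index inside it: with `σ = q ^ (4k)`, the factor
`1 - q ^ (8 (k + l) + 1)` becomes `1 - σ ^ 2 q ^ (8l + 1)`. -/
theorem shiftTerm_add (q c d : F) (k l : ℕ) :
    shiftTerm q 1 c d (k + l) = shiftProd q 1 c d k * shiftTerm q ((q ^ 4) ^ k) c d l := by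
  rw [shiftTerm, shiftTerm, shiftProd, shiftProd, shiftProd]
  simp only [qShifted_add _ _ k l, one_mul, one_pow]
  rw [mul_comm q ((q ^ 4) ^ k), mul_comm (q ^ 4) ((q ^ 4) ^ k),
    show c * q * (q ^ 4) ^ k = c * ((q ^ 4) ^ k * q) by ring,
    show d * q * (q ^ 4) ^ k = d * ((q ^ 4) ^ k * q) by ring,
    show q ^ 4 * c⁻¹ * (q ^ 4) ^ k = (q ^ 4) ^ k * q ^ 4 * c⁻¹ by ring,
    show q ^ 4 * d⁻¹ * (q ^ 4) ^ k = (q ^ 4) ^ k * q ^ 4 * d⁻¹ by ring]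
  simp only [mul_inv, mul_pow, pow_add]
  ring

theorem shiftTerm_mem {A : Type*} [CommRing A] [Inv A] {B : Subring A} {U : A → Prop}
    (hB : InvClosed B U) {q σ c d : A} {k : ℕ} (hq : q ∈ B) (hσ : σ ∈ B) (hc : c ∈ B) (hd : d ∈ B)
    (Uq : U (1 - q)) (Uc : U c) (Ud : U d) (Ucd : U (c * d))
    (Uden : U (qShifted (σ * q ^ 4) (q ^ 4) k ^ 4 * qShifted (σ * q ^ 4 * c⁻¹) (q ^ 4) k *
      qShifted (σ * q ^ 4 * d⁻¹) (q ^ 4) k)) : shiftTerm q σ c d k ∈ B := by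
  have hQ : q ^ 4 ∈ B := B.pow_mem hq 4
  have hσq := B.mul_mem hσ hq
  have hσQ := B.mul_mem hσ hQ
  refine B.mul_mem (B.mul_mem ?_ (hB _ (B.sub_mem B.one_mem hq) Uq).1)
    (B.mul_mem (B.mul_mem (B.mul_mem (B.mul_mem ?_ ?_) ?_) ?_) ?_)
  · exact B.sub_mem B.one_mem (B.mul_mem (B.pow_mem hσ _) (B.pow_mem hq _))
  · exact B.pow_mem (qShifted_mem hσq hQ k) _
  · exact qShifted_mem (B.mul_mem hc hσq) hQ k
  · exact qShifted_mem (B.mul_mem hd hσq) hQ k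
  · refine (hB _ (B.mul_mem (B.mul_mem (B.pow_mem (qShifted_mem hσQ hQ k) _) ?_) ?_) Uden).1
    · exact qShifted_mem (B.mul_mem hσQ (hB _ hc Uc).1) hQ k
    · exact qShifted_mem (B.mul_mem hσQ (hB _ hd Ud).1) hQ k
  · exact B.pow_mem (B.mul_mem (B.pow_mem hq _) (hB _ (B.mul_mem hc hd) Ucd).1) _

theorem map_sub_le_of_mem_diffSubring {δ : v.integer} {g : Bool → F} (hg : g ∈ diffSubring δ) :
    v (g false - g true) ≤ v (δ : F) := by
  obtain ⟨-, r, hr, he⟩ := hg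
  rw [he, add_sub_cancel_left, map_mul]
  exact mul_le_of_le_one_right' hr

/-- The two-valued function with values `1` and `q ^ e`. -/
theorem cond_zpow_mem (h : HasOrderAt v q m) (e : ℤ) :
    ∃ δ : v.integer, (δ : F) = q ^ e - 1 ∧ (fun b => cond b 1 (q ^ e)) ∈ diffSubring δ := by
  refine ⟨⟨q ^ e - 1, v.integer.sub_mem (le_of_eq (h.map_zpow e)) v.integer.one_mem⟩, rfl,
    cond_mem_step _ (x := q ^ e) (by simp) rfl⟩

theorem not_dvd_four_mul (hm : Odd m) {j : ℕ} (hj : 0 < j) (hjm : j < m) : ¬ (m : ℤ) ∣ 4 * j := by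
  intro hd
  have hd : m ∣ 4 * j := by exact_mod_cast hd
  have h4 : Nat.Coprime m (2 ^ 2) := Nat.Coprime.pow_right 2 (Nat.coprime_two_right.mpr hm)
  have := Nat.le_of_dvd hj (h4.dvd_of_dvd_mul_left hd)
  omega

theorem HasOrderAt.map_qShifted_four (h : HasOrderAt v q m) (hm : Odd m) {e : ℤ}
    (he : (m : ℤ) ∣ e) {k : ℕ} (hk : k < m) : v (qShifted (q ^ e * q ^ 4) (q ^ 4) k) = 1 := by
  refine h.map_qShifted (e + 4) (by rw [zpow_add₀ h.ne_zero]; norm_cast) fun j hj hd => ?_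
  refine not_dvd_four_mul hm (Nat.succ_pos j) (by omega : j + 1 < m) ?_
  have := dvd_sub hd he
  rwa [show e + 4 + 4 * j - e = 4 * ((j + 1 : ℕ) : ℤ) by push_cast; ring] at this

theorem HasOrderAt.map_qShifted_four' (h : HasOrderAt v q m) (hm : Odd m)
    {k : ℕ} (hk : k < m) : v (qShifted (q ^ 4) (q ^ 4) k) = 1 := by
  have := h.map_qShifted_four hm (dvd_zero _) hk
  rwa [zpow_zero, one_mul] at this

/-- The shift `q ^ e` is congruent to 1, and for `k < m` the denominators are units, so the
difference principle applies with `δ = q ^ e - 1`. -/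
theorem shiftTerm_congr (h : HasOrderAt v q m) (hc : IsGenericAt v q c)
    (hd : IsGenericAt v q d) (hm : Odd m) (hm1 : 1 < m) (e : ℕ) (he : m ∣ e) {k : ℕ} (hk : k < m) :
    v (shiftTerm q (q ^ e) c d k - shiftTerm q 1 c d k) ≤ v (1 - q ^ m) := by
  obtain ⟨δ, hδ, hmem⟩ := cond_zpow_mem h (e : ℤ)
  have hδv : v (δ : F) ≤ v (1 - q ^ m) := by
    obtain ⟨f, rfl⟩ := he
    rw [hδ, zpow_natCast, Valuation.map_sub_swap]
    rcases Nat.eq_zero_or_pos f with rfl | hf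
    · simp
    · rw [h.map_one_sub_pow_mul hf.ne']
  have hg : shiftTerm (fun _ => q) (fun b => cond b 1 (q ^ (e : ℤ))) (fun _ => c) (fun _ => d) k ∈
      diffSubring δ := by
    refine shiftTerm_mem ((invClosed_integer v).diffSubring δ)
      (const_mem_diffSubring δ h.mem_integer) hmem (const_mem_diffSubring δ (le_of_eq hc.map_self))
      (const_mem_diffSubring δ (le_of_eq hd.map_self)) ?_ ?_ ?_ ?_ ?_ <;> intro b
    · simpa using h.map_one_sub_self hm1
    · exact hc.map_self
    · exact hd.map_self
    · simp only [Pi.mul_apply, map_mul, hc.map_self, hd.map_self, one_mul]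
    · obtain ⟨f, hf, hfd⟩ : ∃ f : ℤ, cond b 1 (q ^ (e : ℤ)) = q ^ f ∧ (m : ℤ) ∣ f := by
        cases b
        · exact ⟨e, rfl, by exact_mod_cast he⟩
        · exact ⟨0, by simp, dvd_zero _⟩
      have hcf : ∀ {c : F}, IsGenericAt v q c →
          v (qShifted (q ^ f * q ^ 4 * c⁻¹) (q ^ 4) k) = 1 := fun hc =>
        hc.map_qShifted h (f + 4) (by rw [zpow_add₀ h.ne_zero]; norm_cast) k
      simp only [Pi.mul_apply, Pi.pow_apply, Pi.inv_apply, qShifted_apply, hf, map_mul, map_pow,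
        h.map_qShifted_four hm hfd hk, hcf hc, hcf hd, one_pow, one_mul]
  refine le_trans ?_ ((map_sub_le_of_mem_diffSubring hg).trans hδv)
  simp [shiftTerm, shiftProd, qShifted_apply]

/-- Replacing `v = 1` by `q ^ (-(4t + 1))` alters the sum by a multiple of `1 - q ^ m`, and the
altered sum is zero by antisymmetry about `t / 2`. -/
theorem map_sum_shiftTerm_le [CharZero F] (h : HasOrderAt v q m) (hc : IsGenericAt v q c)
    (hd : IsGenericAt v q d) (hm : Odd m) (hm1 : 1 < m) (ht : t < m) (htm : m ∣ 4 * t + 1) :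
    v (∑ k ∈ Finset.range (t + 1), shiftTerm q 1 c d k) ≤ v (1 - q ^ m) := by
  obtain ⟨δ, hδ, hmem⟩ := cond_zpow_mem h (-((4 * t + 1 : ℕ) : ℤ))
  have hδv : v (δ : F) ≤ v (1 - q ^ m) := by
    have h1 : (δ : F) = q ^ (-((4 * t + 1 : ℕ) : ℤ)) * (1 - q ^ (4 * t + 1)) := by
      rw [hδ, mul_sub, mul_one, zpow_neg, zpow_natCast,
        inv_mul_cancel₀ (pow_ne_zero _ h.ne_zero)]
    rw [h1, map_mul, h.map_zpow, one_mul]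
    obtain ⟨f, hf⟩ := htm
    rw [hf, h.map_one_sub_pow_mul (by rintro rfl; omega)]
  have hval : ∀ b, ∃ f : ℤ, cond b 1 (q ^ (-((4 * t + 1 : ℕ) : ℤ))) = q ^ f ∧ (m : ℤ) ∣ f := by
    intro b
    cases b
    · exact ⟨_, rfl, (dvd_neg).mpr (by exact_mod_cast htm)⟩
    · exact ⟨0, by simp, dvd_zero _⟩
  have hcf : ∀ {c : F}, IsGenericAt v q c → ∀ (f : ℤ) (k : ℕ),
      v (qShifted (q ^ f * q ^ 4 * c⁻¹) (q ^ 4) k) = 1 := fun hc f k =>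
    hc.map_qShifted h (f + 4) (by rw [zpow_add₀ h.ne_zero]; norm_cast) k
  have hg : ∑ k ∈ Finset.range (t + 1), wpTerm (fun _ => q)
      (fun b => cond b 1 (q ^ (-((4 * t + 1 : ℕ) : ℤ)))) (fun _ => c) (fun _ => d) 1 1 1 k ∈
      diffSubring δ := by
    refine Subring.sum_mem _ fun k hk => ?_
    have hk := Finset.mem_range.mp hk
    refine wpTerm_mem ((invClosed_integer v).diffSubring δ)
      (const_mem_diffSubring δ h.mem_integer) hmem (const_mem_diffSubring δ (le_of_eq hc.map_self))
      (const_mem_diffSubring δ (le_of_eq hd.map_self)) (Subring.one_mem _) (Subring.one_mem _)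
      (Subring.one_mem _) ?_ ?_ ?_ ?_ ?_ ?_ ?_ ?_ <;> intro b
    · simpa using h.map_one_sub_self hm1
    · exact hc.map_self
    · exact hd.map_self
    · simp
    · simp
    · simp
    · simp only [Pi.mul_apply, Pi.one_apply, map_mul, hc.map_self, hd.map_self, one_mul, map_one]
    · obtain ⟨f, hf, hfd⟩ := hval b
      simp only [Pi.mul_apply, Pi.pow_apply, Pi.inv_apply, inv_one, mul_one,
        qShifted_apply, hf, map_mul, h.map_qShifted_four hm hfd (show k < m by omega), hcf hc,
        hcf hd, h.map_qShifted_four' hm (show k < m by omega)]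
  have h0 : ∑ k ∈ Finset.range (t + 1), wpTerm q (q ^ (-((4 * t + 1 : ℕ) : ℤ))) c d 1 1 1 k = 0 := by
    have hfd : (m : ℤ) ∣ -((4 * t + 1 : ℕ) : ℤ) := (dvd_neg).mpr (by exact_mod_cast htm)
    have hn : qShifted (q ^ (-((4 * t + 1 : ℕ) : ℤ)) * q ^ 4 * 1⁻¹) (q ^ 4) t ≠ 0 := by
      rw [inv_one, mul_one]
      exact ne_zero_of_map_eq_one (h.map_qShifted_four hm hfd ht)
    refine sum_wpTerm_eq_zero ?_ hc.ne_zero hd.ne_zero one_ne_zero one_ne_zero one_ne_zero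
      (ne_zero_of_map_eq_one (h.map_qShifted_four' hm ht))
      (ne_zero_of_map_eq_one (hcf hc _ _)) (ne_zero_of_map_eq_one (hcf hd _ _)) hn hn hn
    rw [mul_assoc, ← pow_mul, ← pow_succ', zpow_neg, zpow_natCast,
      inv_mul_cancel₀ (pow_ne_zero _ h.ne_zero)]
  have := (map_sub_le_of_mem_diffSubring hg).trans hδv
  simp only [Finset.sum_apply, wpTerm_apply, cond_true, cond_false, Pi.one_apply, h0, zero_sub,
    Valuation.map_neg] at this
  simpa only [shiftTerm_one] using this

/-- For `k > t` the numerator `(q; q ^ 4)_k` contains `1 - q ^ (4t + 1)`, which is divisible by `1 -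
q ^ m`. -/
theorem map_shiftTerm_le (h : HasOrderAt v q m) (hc : IsGenericAt v q c)
    (hd : IsGenericAt v q d) (hm : Odd m) (hm1 : 1 < m) (htm : m ∣ 4 * t + 1)
    {k : ℕ} (htk : t < k) (hk : k < m) : v (shiftTerm q 1 c d k) ≤ v (1 - q ^ m) := by
  have hqm := h.mem_integer
  have hQ := v.integer.pow_mem hqm 4
  have hcm : c ∈ v.integer := le_of_eq hc.map_self
  have hdm : d ∈ v.integer := le_of_eq hd.map_self
  have h1 : v (qShifted q (q ^ 4) k) = v (1 - q ^ m) := by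
    have := h.map_qShifted_block hm one_pos (show t < m by omega) (by rwa [add_comm]) 0 k hk.le
    simpa [htk] using this
  have hlt := h.map_one_sub_pow_lt
  have hcq : v (qShifted (c * q) (q ^ 4) k) ≤ 1 := qShifted_mem (v.integer.mul_mem hcm hqm) hQ k
  have hdq : v (qShifted (d * q) (q ^ 4) k) ≤ 1 := qShifted_mem (v.integer.mul_mem hdm hqm) hQ k
  have h8 : v (1 - q ^ (8 * k + 1)) ≤ 1 :=
    v.integer.sub_mem v.integer.one_mem (v.integer.pow_mem hqm _)
  have hp : v (1 - q ^ m) ^ 4 ≤ v (1 - q ^ m) := pow_le_of_le_one zero_le hlt.le (by norm_num)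
  rw [shiftTerm, shiftProd]
  simp only [one_mul, one_pow, map_mul, map_inv₀, map_pow, h1, h.map_base,
    hc.map_self, hd.map_self, hc.map_qShifted_den' h, hd.map_qShifted_den' h, mul_one, inv_one,
    h.map_one_sub_self hm1, h.map_qShifted_four' hm hk]
  calc _ ≤ 1 * (v (1 - q ^ m) * 1 * 1) := by gcongr
    _ = _ := by simp only [one_mul, mul_one]

theorem map_sum_shiftTerm_block_le [CharZero F] (h : HasOrderAt v q m) (hc : IsGenericAt v q c)
    (hd : IsGenericAt v q d) (hm : Odd m) (hm1 : 1 < m) (ht : t < m) (htm : m ∣ 4 * t + 1)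
    {b : ℕ} (htb : t < b) (hb : b ≤ m) (a : ℕ) :
    v (∑ k ∈ Finset.range b, shiftTerm q 1 c d (m * a + k)) ≤ v (1 - q ^ m) := by
  have h1 : ∑ k ∈ Finset.range b, shiftTerm q 1 c d (m * a + k) = shiftProd q 1 c d (m * a) *
      (∑ k ∈ Finset.range b, (shiftTerm q (q ^ (4 * (m * a))) c d k - shiftTerm q 1 c d k) +
        ∑ k ∈ Finset.range b, shiftTerm q 1 c d k) := by
    rw [← Finset.sum_add_distrib, Finset.mul_sum]
    refine Finset.sum_congr rfl fun k _ => ?_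
    rw [sub_add_cancel, shiftTerm_add, ← pow_mul]
  -- Over `a` full blocks `(q; q ^ 4)` and `(q ^ 4; q ^ 4)` acquire the same power of `1 - q ^ m`,
  -- so the fourth powers cancel. The vanishing residues are `t` and `m - 1`.
  have h2 : v (shiftProd q 1 c d (m * a)) ≤ 1 := by
    have hqm := h.mem_integer
    have hQ := v.integer.pow_mem hqm 4
    have hcq : v (qShifted (c * q) (q ^ 4) (m * a)) ≤ 1 :=
      qShifted_mem (v.integer.mul_mem (le_of_eq hc.map_self) hqm) hQ _
    have hdq : v (qShifted (d * q) (q ^ 4) (m * a)) ≤ 1 :=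
      qShifted_mem (v.integer.mul_mem (le_of_eq hd.map_self) hqm) hQ _
    have e1 := h.map_qShifted_block hm one_pos ht (by rwa [add_comm]) a 0 (Nat.zero_le _)
    have e4 := h.map_qShifted_block hm (s := 4) (r := m - 1) (by norm_num) (by omega)
      ⟨4, by omega⟩ a 0 (Nat.zero_le _)
    simp only [add_zero, not_lt_zero, if_false] at e1 e4
    rw [pow_one] at e1
    have hne : v (1 - q ^ m) ^ a ≠ 0 := pow_ne_zero _ ((Valuation.ne_zero_iff v).mpr
      (sub_ne_zero.mpr (h.pow_ne_one m (by omega)).symm))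
    rw [shiftProd]
    simp only [one_mul, map_mul, map_inv₀, map_pow, e1, e4, h.map_base, hc.map_self, hd.map_self,
      hc.map_qShifted_den' h, hd.map_qShifted_den' h, mul_one, inv_one, one_pow]
    rw [mul_assoc, mul_assoc, mul_comm, mul_assoc, mul_assoc,
      inv_mul_cancel₀ (pow_ne_zero 4 hne), mul_one]
    exact mul_le_one' hcq hdq
  rw [h1, map_mul]
  refine (mul_le_of_le_one_left' h2).trans (v.map_add_le (v.map_sum_le fun k hk => ?_) ?_)
  · have := Finset.mem_range.mp hk
    exact shiftTerm_congr h hc hd hm hm1 _ (Dvd.intro _ (by ring : m * (4 * a) = _)) (by omega)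
  · obtain ⟨s, hs⟩ := Nat.exists_eq_add_of_le (show t + 1 ≤ b from htb)
    rw [hs, Finset.sum_range_add]
    refine v.map_add_le (map_sum_shiftTerm_le h hc hd hm hm1 ht htm) (v.map_sum_le fun k hk => ?_)
    have := Finset.mem_range.mp hk
    exact map_shiftTerm_le h hc hd hm hm1 htm (by omega) (by omega)

/-- The left-hand side vanishes modulo every prime at which `q` has order `m`. -/
theorem map_sum_wpTerm_le [CharZero F] (h : HasOrderAt v q m) (hc : IsGenericAt v q c)
    (hd : IsGenericAt v q d) (hm : Odd m) (hm1 : 1 < m) (ht : t < m) (htm : m ∣ 4 * t + 1)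
    (A : ℕ) {b : ℕ} (hb : b = 0 ∨ b = t + 1) :
    v (∑ k ∈ Finset.range (m * A + b), wpTerm q 1 c d 1 1 1 k) ≤ v (1 - q ^ m) := by
  simp only [← shiftTerm_one]
  have h1 : ∀ A : ℕ, v (∑ k ∈ Finset.range (m * A), shiftTerm q 1 c d k) ≤ v (1 - q ^ m) := by
    intro A
    induction A with
    | zero => simp
    | succ A ih =>
      rw [mul_add, mul_one, Finset.sum_range_add]
      exact v.map_add_le ih (map_sum_shiftTerm_block_le h hc hd hm hm1 ht htm ht le_rfl A)
  rcases hb with rfl | rfl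
  · exact h1 A
  · rw [Finset.sum_range_add]
    exact v.map_add_le (h1 A)
      (map_sum_shiftTerm_block_le h hc hd hm hm1 ht htm (Nat.lt_succ_self t) ht A)

end ImprimitiveCase

/-! ### The right-hand side at primes where `q` has order `m`. -/

section ImprimitiveRHS

variable {F : Type*} [Field F] {Γ₀ : Type*} [LinearOrderedCommGroupWithZero Γ₀]
variable {v : Valuation F Γ₀} {q c d : F} {m t : ℕ}

/-- Within a block `(q; q ^ 4)` vanishes at index `t`, `(q ^ 2; q ^ 4)` at `s` and `(q ^ 4; q ^ 4)`
at `m - 1`. An uncompensated pole can arise only for `s < t`, and then it is simple. -/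
theorem map_phiTerm_mul_le (h : HasOrderAt v q m) (hc : IsGenericAt v q c)
    (hd : IsGenericAt v q d) (ht : t < m) (htm : m ∣ 4 * t + 1) {s : ℕ}
    (hs : m = 2 * s + 1) (k : ℕ) :
    v (phiTerm q c d 1 1 1 k) * v (1 - q ^ m) ^ (if s < t then 1 else 0) ≤ 1 := by
  have hm : Odd m := ⟨s, hs⟩
  have hqm := h.mem_integer
  have hQ := v.integer.pow_mem hqm 4
  obtain ⟨a, b, hb, rfl⟩ : ∃ a b, b < m ∧ k = m * a + b :=
    ⟨k / m, k % m, Nat.mod_lt _ (by omega), (Nat.div_add_mod k m).symm⟩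
  have e1 := h.map_qShifted_block hm one_pos ht (by rwa [add_comm]) a b hb.le
  have e2 := h.map_qShifted_block hm (s := 2) (r := s) (by norm_num) (by omega)
    ⟨2, by omega⟩ a b hb.le
  have e4 := h.map_qShifted_block hm (s := 4) (r := m - 1) (by norm_num) (by omega)
    ⟨4, by omega⟩ a b hb.le
  have hn : v (qShifted (q ^ 3 * (c * d)⁻¹) (q ^ 4) (m * a + b)) ≤ 1 := by
    refine qShifted_mem (v.integer.mul_mem (v.integer.pow_mem hqm 3) ?_) hQ _
    rw [Valuation.mem_integer_iff, map_inv₀, map_mul, hc.map_self, hd.map_self, one_mul, inv_one]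
  have hlt := h.map_one_sub_pow_lt
  have hne : v (1 - q ^ m) ≠ 0 := (Valuation.ne_zero_iff v).mpr
      (sub_ne_zero.mpr (h.pow_ne_one m (by omega)).symm)
  rw [if_neg (by omega : ¬ m - 1 < b), add_zero] at e4
  rw [pow_one] at e1
  rw [phiTerm]
  simp only [one_mul, map_mul, map_inv₀, map_pow, e1, e2, e4, h.map_base,
    hc.map_qShifted_den' h, hd.map_qShifted_den' h, mul_one, one_pow]
  generalize v (1 - q ^ m) = w at *
  set x := a + if t < b then 1 else 0 with hx
  set y := a + if s < b then 1 else 0 with hy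
  have hxy : a + y ≤ x + x + x + if s < t then 1 else 0 := by
    rw [hx, hy]; split_ifs <;> omega
  calc _ ≤ 1 * w ^ x * w ^ x * w ^ x * (w ^ a * w ^ y)⁻¹ * w ^ (if s < t then 1 else 0) := by
        gcongr
    _ = w ^ (x + x + x + if s < t then 1 else 0) * (w ^ (a + y))⁻¹ := by
        rw [one_mul, mul_right_comm]; simp only [pow_add]
    _ ≤ w ^ (a + y) * (w ^ (a + y))⁻¹ :=
        mul_le_mul_left (pow_le_pow_of_le_one zero_le hlt.le hxy) _
    _ = 1 := mul_inv_cancel₀ (pow_ne_zero _ hne)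

/-- No denominator `1 - q ^ (4k - 2)` vanishes to higher order than `1 - q ^ n`: it is either a unit
or has the valuation of `1 - q ^ m`. -/
theorem map_qInt_sq_mul_qB_le (h : HasOrderAt v q m) {n : ℕ} (hn : n ≠ 0) (hmn : m ∣ n) :
    v (qInt q n ^ 2 * qB n q) ≤ 1 := by
  obtain ⟨e, rfl⟩ := hmn
  have he : e ≠ 0 := by rintro rfl; simp at hn
  have hm : m ≠ 0 := by rintro rfl; simp at hn
  have hlt := h.map_one_sub_pow_lt
  have hne : v (1 - q ^ m) ≠ 0 := (Valuation.ne_zero_iff v).mpr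
      (sub_ne_zero.mpr (h.pow_ne_one m hm).symm)
  rw [qInt_sq_mul_qB h.pow_ne_one, mul_add, Finset.mul_sum]
  refine v.map_add_le ?_ (v.map_sum_le fun k hk => ?_)
  · have h24 : v (((m * e : ℕ) : F) ^ 2 - 1) ≤ 1 :=
      v.integer.sub_mem (v.integer.pow_mem (le_of_eq (h.map_natCast _ hn)) 2) v.integer.one_mem
    have h24' := h.map_natCast 24 (by norm_num)
    rw [map_mul, map_div₀, map_pow, h.map_one_sub_pow_mul he]
    norm_num only [Nat.cast_ofNat] at h24'
    rw [h24', div_one]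
    exact mul_le_one' (pow_le_one₀ zero_le hlt.le) h24
  · have hk := Finset.mem_Icc.mp hk
    have hj : 4 * k - 2 ≠ 0 := by omega
    have hle : v (1 - q ^ m) ≤ v (1 - q ^ (4 * k - 2)) := by
      by_cases hd : m ∣ 4 * k - 2
      · obtain ⟨f, hf⟩ := hd
        rw [hf, h.map_one_sub_pow_mul (by rintro rfl; omega)]
      · have := h.map_one_sub_zpow ((4 * k - 2 : ℕ) : ℤ) (by exact_mod_cast hd)
        rw [zpow_natCast] at this
        rw [this]
        exact hlt.le
    have hne' : v (1 - q ^ (4 * k - 2)) ≠ 0 := (Valuation.ne_zero_iff v).mpr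
      (sub_ne_zero.mpr (h.pow_ne_one _ hj).symm)
    rw [map_mul, map_mul, map_pow, map_pow, map_pow, map_inv₀, h.map_base, one_pow, one_mul,
      h.map_one_sub_pow_mul he]
    calc _ ≤ v (1 - q ^ (4 * k - 2)) ^ 2 * (v (1 - q ^ (4 * k - 2)))⁻¹ ^ 2 := by gcongr
      _ = 1 := by rw [← mul_pow, mul_inv_cancel₀ hne', one_pow]

theorem HasOrderAt.map_qInt (h : HasOrderAt v q m) (hm : 1 < m) {n : ℕ} (hn : n ≠ 0)
    (hmn : m ∣ n) : v (qInt q n) = v (1 - q ^ m) := by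
  obtain ⟨e, rfl⟩ := hmn
  rw [qInt_eq_div (by simpa using h.pow_ne_one 1 one_ne_zero), map_div₀, h.map_one_sub_self hm,
    div_one, h.map_one_sub_pow_mul (by rintro rfl; simp at hn)]

/-- The right-hand side vanishes modulo every prime at which `q` has order `m`. -/
theorem map_watsonRHS_le (h : HasOrderAt v q m) (hc : IsGenericAt v q c)
    (hd : IsGenericAt v q d) (hm : Odd m) (hm1 : 1 < m) (ht : t < m) (htm : m ∣ 4 * t + 1)
    {n : ℕ} (hn : n ≠ 0) (hmn : m ∣ n) (A : ℕ) :
    v (watsonRHS q c d n (m * A + t)) ≤ v (1 - q ^ m) := by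
  obtain ⟨s, hs⟩ := id hm
  have e2 := h.map_qShifted_block hm (s := 2) (r := s) (by norm_num) (by omega)
    ⟨2, by omega⟩ A t ht.le
  have e4 := h.map_qShifted_block hm (s := 4) (r := m - 1) (by norm_num) (by omega)
    ⟨4, by omega⟩ A t ht.le
  rw [if_neg (by omega : ¬ m - 1 < t), add_zero] at e4
  have hne : v (1 - q ^ m) ≠ 0 := (Valuation.ne_zero_iff v).mpr
      (sub_ne_zero.mpr (h.pow_ne_one m (by omega)).symm)
  have hB : v (1 + qInt q n ^ 2 * qB n q) ≤ 1 :=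
    v.map_add_le (le_of_eq v.map_one) (map_qInt_sq_mul_qB_le h hn hmn)
  rw [watsonRHS, map_mul, map_mul, map_mul, map_mul, map_div₀, e2, e4, h.map_zpow,
    h.map_qInt hm1 hn hmn, mul_one, pow_add, mul_div_cancel_left₀ _ (pow_ne_zero _ hne)]
  generalize hS : ∑ k ∈ Finset.range (m * A + t + 1), phiTerm q c d 1 1 1 k = S
  -- For `s < t` the ratio `(q ^ 2; q ^ 4)_K / (q ^ 4; q ^ 4)_K` has exactly the zero that clears
  -- the possible simple pole of the sum; `[n]` is then still available.
  have hle : v S * v (1 - q ^ m) ^ (if s < t then 1 else 0) ≤ 1 := by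
    rw [← map_pow, ← map_mul, ← hS, Finset.sum_mul]
    refine v.map_sum_le fun k _ => ?_
    rw [map_mul, map_pow]
    exact map_phiTerm_mul_le h hc hd ht htm hs k
  calc _ ≤ v (1 - q ^ m) ^ (if s < t then 1 else 0) * v (1 - q ^ m) * 1 * v S := by gcongr
    _ = v S * v (1 - q ^ m) ^ (if s < t then 1 else 0) * v (1 - q ^ m) := by
      rw [mul_one, mul_comm, mul_assoc]
    _ ≤ _ := mul_le_of_le_one_left' hle

/-- The two sides agree modulo every prime at which `q` has order `m`. -/
theorem sum_wpTerm_congr_watsonRHS_of_dvd [CharZero F] (h : HasOrderAt v q m)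
    (hc : IsGenericAt v q c) (hd : IsGenericAt v q d) (hm1 : 1 < m) {n K M : ℕ}
    (hn : n = 4 * K + 1) (hM : M = K ∨ M = n - 1) (hmn : m ∣ n) :
    v (∑ k ∈ Finset.range (M + 1), wpTerm q 1 c d 1 1 1 k - watsonRHS q c d n K) ≤
      v (1 - q ^ m) := by
  have hm : Odd m := Odd.of_dvd_nat ⟨2 * K, by omega⟩ hmn
  have hK : m * (K / m) + K % m = K := Nat.div_add_mod K m
  have ht : K % m < m := Nat.mod_lt _ (by omega)
  have htm : m ∣ 4 * (K % m) + 1 := by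
    have h1 : m ∣ m * (4 * (K / m)) + (4 * (K % m) + 1) := by
      convert hmn using 1; rw [hn]; nth_rw 3 [← hK]; ring
    exact (Nat.dvd_add_right (dvd_mul_right m _)).mp h1
  refine v.map_sub_le ?_ ?_
  -- For `M = K` the range ends `t + 1` terms into a block; for `M = n - 1` it consists of complete
  -- blocks.
  · rcases hM with rfl | rfl
    · have := map_sum_wpTerm_le h hc hd hm hm1 ht htm (M / m) (Or.inr rfl)
      rwa [← add_assoc, hK] at this
    · obtain ⟨e, he⟩ := hmn
      have := map_sum_wpTerm_le h hc hd hm hm1 ht htm e (Or.inl rfl)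
      rwa [add_zero, ← he, show n = n - 1 + 1 by omega] at this
  · have := map_watsonRHS_le h hc hd hm hm1 ht htm (by omega : n ≠ 0) hmn (K / m)
    rwa [hK] at this

end ImprimitiveRHS

/-! ### The order of `q` in the residue field. -/

section OneUnits

variable {F : Type*} [Field F] {Γ₀ : Type*} [LinearOrderedCommGroupWithZero Γ₀]

theorem Valuation.map_eq_one_of_map_one_sub_lt {v : Valuation F Γ₀} {x : F} (hx : v (1 - x) < 1) :
    v x = 1 := by
  simpa using v.map_one_sub_of_lt hx

/-- The units congruent to `1` modulo the maximal ideal of the valuation ring. -/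
def Valuation.oneUnits (v : Valuation F Γ₀) : Subgroup Fˣ where
  carrier := {x | v (1 - (x : F)) < 1}
  one_mem' := by simp
  mul_mem' := by
    intro x y hx hy
    have hy1 : v (y : F) = 1 := Valuation.map_eq_one_of_map_one_sub_lt hy
    rw [Set.mem_ofPred_eq, Units.val_mul,
      show 1 - (x : F) * y = (1 - (x : F)) * y + (1 - y) by ring]
    exact v.map_add_lt (by rwa [map_mul, hy1, mul_one]) hy
  inv_mem' := by
    intro x hx
    have hx1 : v (x : F) = 1 := Valuation.map_eq_one_of_map_one_sub_lt hx
    have : 1 - ((x⁻¹ : Fˣ) : F) = -((1 - (x : F)) * ((x⁻¹ : Fˣ) : F)) := by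
      rw [sub_mul, one_mul, Units.mul_inv]; ring
    rw [Set.mem_ofPred_eq, this, Valuation.map_neg, map_mul, Units.val_inv_eq_inv_val, map_inv₀, hx1,
      inv_one, mul_one]
    exact hx

theorem Valuation.mem_oneUnits {v : Valuation F Γ₀} {x : Fˣ} :
    x ∈ v.oneUnits ↔ v (1 - (x : F)) < 1 := Iff.rfl

/-- Take `m` to be the order of `q` modulo the one-units; `m ∣ j` then amounts to `v (1 - q ^ j) <
1`, also for negative `j`. -/
theorem exists_hasOrderAt {v : Valuation F Γ₀} {q : F}
    (hv : ∀ j : ℕ, j ≠ 0 → v (j : F) = 1) (hq1 : ∀ j : ℕ, j ≠ 0 → q ^ j ≠ 1) {n : ℕ}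
    (hn : n ≠ 0) (hqn : v (1 - q ^ n) < 1) : ∃ m, m ∣ n ∧ HasOrderAt v q m := by
  have hq' : v q = 1 := by
    have h1 : v (q ^ n) = 1 := Valuation.map_eq_one_of_map_one_sub_lt hqn
    rw [map_pow] at h1
    exact (pow_eq_one_iff_of_nonneg zero_le hn).mp h1
  have hq0 : q ≠ 0 := ne_zero_of_map_eq_one hq'
  set Q : Fˣ := Units.mk0 q hq0
  have key : ∀ j : ℤ, (orderOf (Q : Fˣ ⧸ v.oneUnits) : ℤ) ∣ j ↔ v (1 - q ^ j) < 1 := by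
    intro j
    rw [orderOf_dvd_iff_zpow_eq_one, ← QuotientGroup.mk_zpow, QuotientGroup.eq_one_iff,
      Valuation.mem_oneUnits, Units.val_zpow_eq_zpow_val, Units.val_mk0]
  refine ⟨orderOf (Q : Fˣ ⧸ v.oneUnits), ?_, hv, hq1, hq', fun j hj => ?_, ?_⟩
  · have := (key n).mpr (by rwa [zpow_natCast])
    exact_mod_cast this
  · refine le_antisymm (v.map_sub_le (le_of_eq v.map_one) ?_) (not_lt.mp (mt (key j).mpr hj))
    rw [map_zpow₀, hq', one_zpow]
  · have := (key _).mp dvd_rfl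
    rwa [zpow_natCast] at this

/-- If `c` were congruent to `q ^ j`, then `c ^ m` would be congruent to `q ^ (m j)`, hence to 1. -/
theorem HasOrderAt.isGenericAt {v : Valuation F Γ₀} {q c : F} {m : ℕ} (h : HasOrderAt v q m)
    (hc : v c = 1) (hcm : v (1 - c ^ m) = 1) : IsGenericAt v q c := by
  refine ⟨hc, fun j => ?_⟩
  refine le_antisymm (v.map_sub_le (le_of_eq v.map_one) ?_) (not_lt.mp fun hlt => ?_)
  · rw [map_mul, h.map_zpow, map_inv₀, hc, inv_one, one_mul]
  · set Q : Fˣ := Units.mk0 q h.ne_zero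
    set C : Fˣ := Units.mk0 c (ne_zero_of_map_eq_one hc)
    have h1 : Q ^ j * C⁻¹ ∈ v.oneUnits := by
      rw [Valuation.mem_oneUnits]
      simpa [Q, C] using hlt
    have h2 : Q ^ m ∈ v.oneUnits := by
      rw [Valuation.mem_oneUnits]
      simpa [Q] using h.map_one_sub_pow_lt
    have h3 : C ^ m ∈ v.oneUnits := by
      have := mul_mem (inv_mem (pow_mem h1 m)) (zpow_mem h2 j)
      convert this using 1
      rw [mul_pow, inv_pow, mul_inv, inv_inv, ← zpow_natCast, ← zpow_natCast, ← zpow_mul,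
        ← zpow_natCast, ← zpow_mul, mul_comm j, mul_right_comm, inv_mul_cancel, one_mul]
    rw [Valuation.mem_oneUnits, Units.val_pow_eq_pow_val, Units.val_mk0, hcm] at h3
    exact lt_irrefl _ h3

end OneUnits

/-! ### From valuations at the primes of `k[X]` to the congruence. -/

section RatFuncValuation

open IsDedekindDomain

variable {k : Type*} [Field k]

/-- Write `(A - B) / P` in lowest terms. A prime dividing both its denominator and `P` would, by the
bound at that prime, divide the numerator as well. -/
theorem ratCongr_of_valuation_le {P : k[X]} (hP : P ≠ 0) {A B : RatFunc k}
    (h : ∀ w : HeightOneSpectrum k[X], w.valuation (RatFunc k) (algebraMap k[X] (RatFunc k) P) < 1 →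
      w.valuation (RatFunc k) (A - B) ≤
        w.valuation (RatFunc k) (algebraMap k[X] (RatFunc k) P)) : RatCongr P A B := by
  have hP' : algebraMap k[X] (RatFunc k) P ≠ 0 := RatFunc.algebraMap_ne_zero hP
  set y := (A - B) / algebraMap k[X] (RatFunc k) P with hy
  refine ⟨y.num, y.denom, y.denom_ne_zero, ?_, ?_⟩
  · refine isCoprime_of_prime_dvd (fun h0 => hP h0.2) fun z hz hzd hzP => ?_
    let w : HeightOneSpectrum k[X] :=
      ⟨Ideal.span {z}, (Ideal.span_singleton_prime hz.ne_zero).mpr hz, by simpa using hz.ne_zero⟩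
    have hlt : ∀ r : k[X], w.valuation (RatFunc k) (algebraMap k[X] (RatFunc k) r) < 1 ↔ z ∣ r :=
      fun r => (w.valuation_lt_one_iff_mem r).trans Ideal.mem_span_singleton
    have h1 := h w ((hlt P).mpr hzP)
    have hP0 : w.valuation (RatFunc k) (algebraMap k[X] (RatFunc k) P) ≠ 0 :=
      (Valuation.ne_zero_iff _).mpr hP'
    have h2 : w.valuation (RatFunc k) y ≤ 1 := by
      rw [hy, map_div₀]
      exact (div_le_one₀ (zero_lt_iff.mpr hP0)).mpr h1
    have h3 : w.valuation (RatFunc k) (algebraMap k[X] (RatFunc k) y.num) < 1 := by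
      have h4 : algebraMap k[X] (RatFunc k) y.num = y * algebraMap k[X] (RatFunc k) y.denom := by
        rw [← div_eq_iff (RatFunc.algebraMap_ne_zero y.denom_ne_zero), RatFunc.num_div_denom]
      rw [h4, map_mul]
      exact (mul_le_of_le_one_left' h2).trans_lt ((hlt _).mpr hzd)
    exact hz.not_isUnit (y.isCoprime_num_denom.isUnit_of_dvd' ((hlt _).mp h3) hzd)
  · rw [map_mul, mul_div_assoc, RatFunc.num_div_denom, hy, mul_div_cancel₀ _ hP']

theorem valuation_C_eq_one (w : HeightOneSpectrum k[X]) {a : k} (ha : a ≠ 0) :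
    w.valuation (RatFunc k) (RatFunc.C a) = 1 := by
  rw [← RatFunc.algebraMap_C, w.valuation_eq_one_iff_notMem]
  intro hmem
  exact w.isPrime.ne_top (Ideal.eq_top_of_isUnit_mem _ hmem (isUnit_C.mpr ha.isUnit))

theorem RatFunc.X_pow_ne_one {j : ℕ} (hj : j ≠ 0) : (RatFunc.X : RatFunc k) ^ j ≠ 1 := by
  rw [← RatFunc.algebraMap_X, ← map_pow, ← map_one (algebraMap k[X] (RatFunc k))]
  intro h
  have := congrArg (Polynomial.eval 0) (RatFunc.algebraMap_injective k h)
  simp [hj] at this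

theorem algebraMap_qInt (n : ℕ) :
    algebraMap k[X] (RatFunc k) (qInt X n) = qInt RatFunc.X n := by
  simp [qInt]

variable [CharZero k]

theorem isGenericAt_C {w : HeightOneSpectrum k[X]} {m : ℕ}
    (h : HasOrderAt (w.valuation (RatFunc k)) RatFunc.X m) {a : k} (ha : a ≠ 0) (ham : a ^ m ≠ 1) :
    IsGenericAt (w.valuation (RatFunc k)) RatFunc.X (RatFunc.C a) := by
  refine h.isGenericAt (valuation_C_eq_one w ha) ?_
  rw [← map_pow, ← (RatFunc.C (K := k)).map_one, ← map_sub]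
  exact valuation_C_eq_one w (sub_ne_zero.mpr ham.symm)

/-- At every prime dividing the modulus the indeterminate has an order `m ∣ n`, and the modulus has
the same valuation as `(1 - q ^ n) ^ 4` or `1 - q ^ m`, according to whether `m = n`. -/
theorem exists_hasOrderAt_of_modulus {w : HeightOneSpectrum k[X]} {n : ℕ} (hn : 1 < n)
    (hw : w.valuation (RatFunc k)
      (algebraMap k[X] (RatFunc k) (qInt (X : k[X]) n * cyclotomic n k ^ 3)) < 1) :
    ∃ m, 1 < m ∧ m ∣ n ∧ HasOrderAt (w.valuation (RatFunc k)) RatFunc.X m ∧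
      (if m = n then w.valuation (RatFunc k) (1 - RatFunc.X ^ n) ^ 4
        else w.valuation (RatFunc k) (1 - RatFunc.X ^ m)) ≤ w.valuation (RatFunc k)
        (algebraMap k[X] (RatFunc k) (qInt (X : k[X]) n * cyclotomic n k ^ 3)) := by
  have hn0 : n ≠ 0 := by omega
  have hint : ∀ r : k[X], w.valuation (RatFunc k) (algebraMap k[X] (RatFunc k) r) ≤ 1 :=
    w.valuation_le_one
  have hle : ∀ {r s : k[X]}, r ∣ s → w.valuation (RatFunc k) (algebraMap k[X] (RatFunc k) s) ≤
      w.valuation (RatFunc k) (algebraMap k[X] (RatFunc k) r) := by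
    rintro r _ ⟨s, rfl⟩
    rw [map_mul, map_mul]
    exact mul_le_of_le_one_right' (hint s)
  have hX : ∀ j : ℕ, w.valuation (RatFunc k) (algebraMap k[X] (RatFunc k) (X ^ j - 1)) =
      w.valuation (RatFunc k) (1 - RatFunc.X ^ j) := by
    intro j
    rw [Valuation.map_sub_swap, map_sub, map_pow, map_one, RatFunc.algebraMap_X]
  have hΦ : w.valuation (RatFunc k) (qInt RatFunc.X n) ≤
      w.valuation (RatFunc k) (algebraMap k[X] (RatFunc k) (cyclotomic n k)) := by
    rw [← algebraMap_qInt]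
    exact hle (cyclotomic_dvd_geom_sum_of_dvd k dvd_rfl (by omega))
  rw [map_mul, map_mul, map_pow, map_pow, algebraMap_qInt] at hw ⊢
  set y := w.valuation (RatFunc k) (algebraMap k[X] (RatFunc k) (cyclotomic n k))
  -- If `[n]` were a unit at `w`, so would be its divisor `Φ_n`, and hence the modulus.
  have hq1 : w.valuation (RatFunc k) (qInt RatFunc.X n) < 1 := by
    by_contra! h1
    exact absurd hw (not_lt.mpr (one_le_mul h1 (one_le_pow_of_one_le' (h1.trans hΦ) 3)))
  have hqn : w.valuation (RatFunc k) (1 - RatFunc.X ^ n) < 1 := by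
    have : qInt (X : k[X]) n ∣ X ^ n - 1 := ⟨X - 1, (geom_sum_mul _ _).symm⟩
    have := hle this
    rw [hX, algebraMap_qInt] at this
    exact this.trans_lt hq1
  obtain ⟨m, hmn, hm⟩ := exists_hasOrderAt (v := w.valuation (RatFunc k)) (q := RatFunc.X)
    (fun j hj => by
      rw [← map_natCast RatFunc.C]
      exact valuation_C_eq_one w (Nat.cast_ne_zero.mpr hj))
    (fun j hj => RatFunc.X_pow_ne_one hj) hn0 hqn
  have hne : ∀ j : ℕ, j ≠ 0 → w.valuation (RatFunc k) (1 - RatFunc.X ^ j) ≠ 0 := fun j hj =>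
    (Valuation.ne_zero_iff _).mpr (sub_ne_zero.mpr (hm.pow_ne_one j hj).symm)
  -- For `m = 1` the quotient `[n] = (1 - q ^ n) / (1 - q)` would be a unit.
  have hm1 : 1 < m := by
    by_contra hm1
    have hm0 : m ≠ 0 := by rintro rfl; simp at hmn; omega
    obtain rfl : m = 1 := by omega
    have h1 := hm.map_one_sub_pow_mul hn0
    rw [one_mul] at h1
    rw [qInt_eq_div (by simpa using hm.pow_ne_one 1 one_ne_zero), map_div₀, h1, pow_one,
      div_self (by simpa using hne 1 one_ne_zero)] at hq1
    exact lt_irrefl _ hq1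
  refine ⟨m, hm1, hmn, hm, ?_⟩
  have hqm := hm.map_qInt hm1 hn0 hmn
  split_ifs with hmn'
  · subst hmn'
    rw [hqm] at hΦ ⊢
    rw [pow_succ']
    gcongr
  -- For a proper divisor `m`, `(X ^ m - 1) Φ_n` divides `X ^ n - 1`; as `1 - q ^ m` and `1 - q ^ n`
  -- have equal valuation, `Φ_n` is a unit at `w`.
  · have hy : 1 ≤ y := by
      have h1 := hle (X_pow_sub_one_mul_cyclotomic_dvd_X_pow_sub_one_of_dvd k
        (Nat.mem_properDivisors.mpr ⟨hmn, lt_of_le_of_ne (Nat.le_of_dvd (by omega) hmn) hmn'⟩))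
      rw [map_mul, map_mul, hX, hX] at h1
      obtain ⟨e, rfl⟩ := hmn
      rw [hm.map_one_sub_pow_mul (by rintro rfl; simp at hn0)] at h1
      exact (le_mul_iff_one_le_right (zero_lt_iff.mpr (hne m (by omega)))).mp h1
    rw [hqm]
    exact le_mul_of_one_le_right' (one_le_pow_of_one_le' hy 3)

end RatFuncValuation

theorem MvPolynomial.algebraMap_X_pow_ne_one {σ R K : Type*} [CommRing R] [Nontrivial R]
    [CommRing K] [Algebra (MvPolynomial σ R) K] [IsFractionRing (MvPolynomial σ R) K]
    (i : σ) {m : ℕ} (hm : m ≠ 0) :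
    algebraMap (MvPolynomial σ R) K (MvPolynomial.X i) ^ m ≠ 1 := by
  rw [← map_pow, ← map_one (algebraMap (MvPolynomial σ R) K)]
  intro h
  have := congrArg (MvPolynomial.eval 0) (IsFractionRing.injective (MvPolynomial σ R) K h)
  simp [hm] at this

instance : CharZero (RatFunc ParamField) :=
  charZero_of_injective_algebraMap (algebraMap ParamField (RatFunc ParamField)).injective

theorem theorem3 (n : ℕ) (hn : n ≡ 1 [MOD 4]) (M : ℕ) (hM : M = (n - 1) / 4 ∨ M = n - 1)
    (q c d : RatFunc ParamField) (hq : q = RatFunc.X) (hc : c = parC) (hd : d = parD) :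
    RatCongr (qInt (X : ParamField[X]) n * cyclotomic n ParamField ^ 3)
      (∑ k ∈ Finset.range (M + 1),
        qInt q (8 * k + 1) *
          (qShifted q (q ^ 4) k ^ 4 * qShifted (c * q) (q ^ 4) k * qShifted (d * q) (q ^ 4) k) /
          (qShifted (q ^ 4) (q ^ 4) k ^ 4 * qShifted (q ^ 4 / c) (q ^ 4) k *
            qShifted (q ^ 4 / d) (q ^ 4) k) *
          (c * d) ^ (-(k : ℤ)) * q ^ (5 * k))
      (qShifted (q ^ 2) (q ^ 4) ((n - 1) / 4) / qShifted (q ^ 4) (q ^ 4) ((n - 1) / 4) *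
        qInt q n * q ^ (-(((n - 1) / 4 : ℕ) : ℤ)) * (1 + qInt q n ^ 2 * qB n q) *
        ∑ k ∈ Finset.range ((n - 1) / 4 + 1),
          qShifted (q ^ 3 / (c * d)) (q ^ 4) k * qShifted q (q ^ 4) k ^ 3 /
            (qShifted (q ^ 4) (q ^ 4) k * qShifted (q ^ 4 / c) (q ^ 4) k *
              qShifted (q ^ 4 / d) (q ^ 4) k * qShifted (q ^ 2) (q ^ 4) k) *
            q ^ (4 * k)) := by
  have hq1 : q ≠ 1 := by simpa [hq] using RatFunc.X_pow_ne_one (k := ParamField) one_ne_zero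
  obtain ⟨K, hK⟩ : ∃ K, n = 4 * K + 1 := by
    have : n % 4 = 1 := hn
    exact ⟨n / 4, by omega⟩
  simp only [wpTerm_one_eq hq1, phiTerm_one_eq, show (n - 1) / 4 = K by omega] at hM ⊢
  rw [← watsonRHS]
  -- For `n = 1` the only prime of the modulus is `q - 1`, at which `1 - q` is not a unit and the
  -- method fails; there both sides equal 1.
  rcases Nat.eq_zero_or_pos K with rfl | hK0
  · obtain rfl : n = 1 := hK
    obtain rfl : M = 0 := by simpa using hM
    refine ⟨0, 1, one_ne_zero, isCoprime_one_left, ?_⟩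
    simp [watsonRHS, qB, wpTerm, phiTerm, qShifted, qInt, sub_ne_zero.mpr hq1.symm]
  have hn1 : 1 < n := by omega
  refine ratCongr_of_valuation_le ?_ fun w hw => ?_
  · refine mul_ne_zero (fun h0 => ?_) (pow_ne_zero 3 (cyclotomic_ne_zero n ParamField))
    have := congrArg (Polynomial.eval 0) h0
    rw [hK, qInt, Finset.sum_range_succ'] at this
    simp [eval_finsetSum] at this
  obtain ⟨m, hm1, hmn, hm, hle⟩ := exists_hasOrderAt_of_modulus hn1 hw
  have hgen : ∀ i : Fin 2, IsGenericAt (w.valuation (RatFunc ParamField)) RatFunc.X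
      (RatFunc.C (algebraMap (MvPolynomial (Fin 2) ℚ) ParamField (MvPolynomial.X i))) := fun i =>
    isGenericAt_C hm (by simp)
      (MvPolynomial.algebraMap_X_pow_ne_one i (by omega))
  subst hq hc hd
  refine le_trans ?_ hle
  split_ifs with hmn'
  · subst hmn'
    exact sum_wpTerm_congr_watsonRHS' hm (hgen 0) (hgen 1) hK hK0 hM
  · exact sum_wpTerm_congr_watsonRHS_of_dvd hm (hgen 0) (hgen 1) hm1 hK hM hmn
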